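/- Let $d\ge 2$, $\mathbb{T}=\mathbb{R}/\mathbb{Z}$ and $\Omega=\mathbb{R}\times\mathbb{T}^{d-1}$, with points $x=(x_1,x')$. Let $\dot H^1_{div}(\Omega,\mathbb{R}^d)$ be the set of all $u\in H^1_{loc}(\Omega,\mathbb{R}^d)$ with $\nabla u\in L^2(\Omega)$ and $\nabla\cdot u=0$. For such $u$, let $\bar u(x_1)=\int_{\mathbb{T}^{d-1}}u(x_1,x')\,dx'$ (identified with its continuous representative). Let $\Phi=(\Phi_1,\dots,\Phi_d)\in C^1(\mathbb{R}^d,\mathbb{R}^d)$ be such that, for every $z\in\mathbb{R}^d$, the Jacobian $\nabla\Phi(z)$ is symmetric and $\partial_1\Phi_1(z)=\dots=\partial_d\Phi_d(z)$. Let $$W(z)=\frac12\sum_{1\le i<j\le d}|\partial_i\Phi_j(z)|^2,\qquad z\in\mathbb{R}^d.$$ Let $a\in\mathbb{R}$, $\mathbb{R}^d_a=\{z\in\mathbb{R}^d : z_1=a\}$, and let $u^-,u^+\in\mathbb{R}^d_a$ with $W(u^\pm)=0$. Assume the saturation condition $$\Phi_1(u^+)-\Phi_1(u^-)=\mathrm{geod}^a_W(u^-,u^+):=\inf\Big\{\int_{-1}^1\sqrt{2W(\gamma(t))}\,|\dot\gamma(t)|\,dt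 \;:\; \gamma\in\mathrm{Lip}([-1,1],\mathbb{R}^d_a),\ \gamma(\pm1)=u^\pm\Big\}.$$ Let $u$ be a global minimizer of $$(\mathcal P)\qquad \inf\Big\{E(v)=\int_\Omega \tfrac12|\nabla v|^2+W(v)\,dx \;:\; v\in\dot H^1_{div}(\Omega,\mathbb{R}^d),\ \lim_{x_1\to\pm\infty}\bar v(x_1)=u^\pm\Big\},$$ and assume that at least one of the following holds: 1. $u\in L^\infty(\Omega,\mathbb{R}^d)$ and $W\in C^2(\mathbb{R}^d)$; 2. there are $C,\beta>0$ such that for all $z\in\mathbb{R}^d$, $W(z)\le C e^{\beta|z|^2}$ if $d=2$, and $W(z)\le C\,(1+|z|^{2d/(d-2)})$ if $d\ge3$. Then $u$ is one-dimensional: there is a map $g:\mathbb{R}\to\mathbb{R}^d$ with $u(x)=g(x_1)$ for almost every $x=(x_1,x')\in\Omega$. -/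

import Mathlib

open MeasureTheory Filter Topology

noncomputable section

/-! Throughout, the dimension is `d = n + 1`. The coordinate called `x₁` on paper has index
`0 : Fin (n + 1)`, and `x' = (x₂, …, x_d)` are the coordinates with indices `k.succ`. -/

/-- Euclidean space `ℝ^d`. -/
abbrev Vec (d : ℕ) : Type := EuclideanSpace ℝ (Fin d)

/-- The flat torus `𝕋ⁿ`, where `𝕋 = ℝ/ℤ`; its `volume` has total mass `1`. -/
abbrev Torus (n : ℕ) : Type := Fin n → UnitAddCircle

/-- The infinite cylinder `Ω = ℝ × 𝕋ⁿ` of dimension `d = n + 1`. -/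
abbrev Cylinder (n : ℕ) : Type := ℝ × Torus n

/-- The quotient map `ℝ^(n+1) → Ω = ℝ × (ℝ/ℤ)ⁿ`. -/
def Cylinder.proj (n : ℕ) (y : Vec (n + 1)) : Cylinder n :=
  (y 0, fun k => ((y k.succ : ℝ) : UnitAddCircle))

/-- The classical partial derivative `∂ᵢ φ` of a real function on the cylinder. -/
def Cylinder.partialDeriv {n : ℕ} (i : Fin (n + 1)) (φ : Cylinder n → ℝ) (x : Cylinder n) : ℝ :=
  deriv (fun t : ℝ => φ (x + Cylinder.proj n (EuclideanSpace.single i t))) 0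

/-- `φ ∈ C_c^∞(Ω)`: compactly supported, and smooth as a function on the covering `ℝ^(n+1)`. -/
structure IsTestFunction {n : ℕ} (φ : Cylinder n → ℝ) : Prop where
  smooth : ContDiff ℝ ((⊤ : ℕ∞) : WithTop ℕ∞) (φ ∘ Cylinder.proj n)
  compact : HasCompactSupport φ

/-- `g ∈ L¹_loc(Ω)` is the weak partial derivative `∂ᵢ f` of `f ∈ L¹_loc(Ω)`. -/
structure IsWeakPartial {n : ℕ} (i : Fin (n + 1)) (f g : Cylinder n → ℝ) : Prop where
  locInt_fun : LocallyIntegrable f volume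
  locInt_deriv : LocallyIntegrable g volume
  integral_eq : ∀ φ : Cylinder n → ℝ, IsTestFunction φ →
    ∫ x, f x * Cylinder.partialDeriv i φ x = - ∫ x, g x * φ x

open Classical in
/-- The weak partial derivative `∂ᵢ f` (unique up to null sets; `0` if there is none). -/
def weakPartial {n : ℕ} (i : Fin (n + 1)) (f : Cylinder n → ℝ) : Cylinder n → ℝ :=
  if h : ∃ g, IsWeakPartial i f g then h.choose else 0

/-- `u ∈ Ḣ¹_div(Ω, ℝ^d)`: `u ∈ H¹_loc`, `∇u ∈ L²(Ω)` and `∇·u = 0`. -/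
structure MemHDotOneDiv {n : ℕ} (u : Cylinder n → Vec (n + 1)) : Prop where
  memLp_loc : ∀ K : Set (Cylinder n), IsCompact K → MemLp u 2 (volume.restrict K)
  weak_diff : ∀ i j, ∃ g, IsWeakPartial i (fun x => u x j) g
  memLp_grad : ∀ i j, MemLp (weakPartial i (fun x => u x j)) 2 volume
  div_free : ∀ᵐ x ∂(volume : Measure (Cylinder n)), ∑ i, weakPartial i (fun y => u y i) x = 0

/-- The energy `E(u) = ∫_Ω ½|∇u|² + W(u) dx ∈ [0, ∞]` for a nonnegative potential `W`. -/
def energy {n : ℕ} (W : Vec (n + 1) → ℝ) (u : Cylinder n → Vec (n + 1)) : ENNReal :=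
  ∫⁻ x, ENNReal.ofReal
    ((1 / 2) * (∑ i, ∑ j, (weakPartial i (fun y => u y j) x) ^ 2) + W (u x))

/-- The `x'`-average `ū(x₁) = ∫_{𝕋ⁿ} u(x₁, x') dx'`. -/
def average {n : ℕ} (u : Cylinder n → Vec (n + 1)) (t : ℝ) : Vec (n + 1) :=
  ∫ y : Torus n, u (t, y)

/-- The boundary condition `ū(±∞) = u^±`, read on the continuous representative of `ū`. -/
def BoundaryCondition {n : ℕ} (um up : Vec (n + 1)) (u : Cylinder n → Vec (n + 1)) : Prop :=
  ∃ m : ℝ → Vec (n + 1), Continuous m ∧ (∀ᵐ t, average u t = m t) ∧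
    Tendsto m atBot (𝓝 um) ∧ Tendsto m atTop (𝓝 up)

/-- `u` is a global minimizer of `E` over the `u ∈ Ḣ¹_div(Ω, ℝ^d)` with `ū(±∞) = u^±`. -/
structure IsGlobalMinimizer {n : ℕ} (W : Vec (n + 1) → ℝ) (um up : Vec (n + 1))
    (u : Cylinder n → Vec (n + 1)) : Prop where
  mem : MemHDotOneDiv u
  boundary : BoundaryCondition um up u
  le : ∀ v : Cylinder n → Vec (n + 1), MemHDotOneDiv v → BoundaryCondition um up v →
    energy W u ≤ energy W v

/-- The geodesic pseudo-distance between `x` and `y` in the hyperplane `{z | z₁ = a}` endowed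
with the pseudo-metric `2 W g₀`: the infimum of `∫_{-1}^1 √(2 W(γ)) |γ'| dt` over Lipschitz
curves `γ : [-1, 1] → {z | z₁ = a}` from `x` to `y`. -/
def geodDist {n : ℕ} (a : ℝ) (W : Vec (n + 1) → ℝ) (x y : Vec (n + 1)) : ℝ :=
  sInf {L : ℝ | ∃ γ : ℝ → Vec (n + 1),
    (∃ K, LipschitzOnWith K γ (Set.Icc (-1) 1)) ∧
    (∀ t ∈ Set.Icc (-1 : ℝ) 1, γ t 0 = a) ∧ γ (-1) = x ∧ γ 1 = y ∧
    L = ∫ t in (-1 : ℝ)..1, Real.sqrt (2 * W (γ t)) * ‖deriv γ t‖}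

/-- The entry `∂ᵢ Φⱼ(z)` of the Jacobian of `Φ : ℝ^d → ℝ^d`. -/
def jac {d : ℕ} (Φ : Vec d → Vec d) (i j : Fin d) (z : Vec d) : ℝ :=
  fderiv ℝ Φ z (EuclideanSpace.single i 1) j

/-- The potential `W = ½ ∑_{i<j} |∂ᵢ Φⱼ|²`. -/
def potential {d : ℕ} (Φ : Vec d → Vec d) (z : Vec d) : ℝ :=
  (1 / 2) * ∑ i, ∑ j ∈ Finset.Ioi i, (jac Φ i j z) ^ 2

/-- The growth condition on `W : ℝ^d → ℝ` for `d ≥ 2`: Gaussian growth if `d = 2`, growth with the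
critical Sobolev exponent `2d/(d-2)` if `d ≥ 3`. -/
def GrowthCondition {d : ℕ} (W : Vec d → ℝ) : Prop :=
  ∃ C > 0, ∃ β > 0, ∀ z : Vec d,
    W z ≤ if d = 2 then C * Real.exp (β * ‖z‖ ^ 2)
      else C * (1 + ‖z‖ ^ (2 * (d : ℝ) / ((d : ℝ) - 2)))

end

/-!
The proof is a calibration argument. Write `gᵢⱼ = ∂ᵢuⱼ` and let `A` be the off-diagonal part of
`∇Φ(u)`. Since `∇Φ` is symmetric with scalar diagonal and `u` is divergence free,
`∇·Φ(u) = ∑ᵢⱼ Aᵢⱼ gᵢⱼ`, so that `∫ ∑ᵢⱼ Aᵢⱼ gᵢⱼ = Φ₁(u⁺) - Φ₁(u⁻) =: D`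
(`calibration_identity`, `tendsto_flux`). Since `∑ᵢⱼ gᵢⱼ gⱼᵢ` is the divergence of
`∑ⱼ uⱼ ∂ⱼuᵢ`, its integral vanishes (`trace_identity`, `tendsto_trace_flux`). As `W = ¼ |A|²`,
completing the square gives
`E(u) = D + ¼ ∫ |g + gᵀ - A|²`.

For the upper bound `E(u) ≤ D`, follow a Lipschitz curve of the hyperplane `{z | z₁ = a}` in the
variable `x₁`, with a speed that nearly balances kinetic and potential energy: the result is an
admissible field whose energy is as close as desired to the length of the curve, so that
`E(u) ≤ geodDist` (`IsGlobalMinimizer.energy_le_geodDist`), and saturation says `geodDist = D`.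

Hence `g + gᵀ = A`. The entry `(1, 1)` gives `∂₁u₁ = 0`; the derivatives of `u₁` are then square
integrable on the cylinder and independent of `x₁`, so they vanish (`grad_first_eq_zero`), and
`A₁ⱼ = ∂₁uⱼ`. The chain rule for `Φ₁(u)` along `x₁` now yields `∫ |∂₁u|² = D`, while `W` contains
`½ |∂₁u|²`, so `D ≥ E(u) ≥ ∫ |∂₁u|² + ½ ∫ |∇'u|² = D + ½ ∫ |∇'u|²`. Thus the derivatives along the
torus vanish (`grad_succ_eq_zero`) and `u` equals its average over the torus (`ae_eq_average`).

The identities are proved for mollifications of `u` and passed to the limit, which requires a bound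
`|∇Φ(z)|² ≤ K (1 + |z|^q)` on a closed convex set containing the values of `u`, together with `L^q`
bounds of `u` on slabs of unit width. For bounded `u` the set is a ball and `q = 2`. In dimension
`d ≥ 3`, `q` is the critical Sobolev exponent (`hasLimits_sobolev`), and the growth of `W`, which
controls the off-diagonal entries of `∇Φ`, controls the diagonal as well: `Φᵢ ± Φⱼ` is constant
along `eᵢ ∓ eⱼ` (`comb_add_smul`), so the diagonal varies no more than the off-diagonal entries
(`exists_fderiv_growth`). In the plane the same fact says that `Φ₁ ± Φ₂` is a function of
`z₁ ± z₂` alone; truncating the derivatives of these two functions gives a field with bounded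
gradient, the same first component at `u⁺` and `u⁻`, and a potential that is nowhere larger
(`exists_planar_truncation`), to which the argument with `q = 2` applies.
-/

noncomputable section

/-! ### The cylinder as a measured group -/

instance unitAddCircle_isProbabilityMeasure :
    IsProbabilityMeasure (volume : Measure UnitAddCircle) := ⟨by simp⟩

instance torus_isAddHaarMeasure (n : ℕ) : (volume : Measure (Torus n)).IsAddHaarMeasure :=
  inferInstanceAs (Measure.pi (fun _ => volume) : Measure (Torus n)).IsAddHaarMeasure

instance torus_isProbabilityMeasure (n : ℕ) :
    IsProbabilityMeasure (volume : Measure (Torus n)) :=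
  inferInstanceAs (IsProbabilityMeasure (Measure.pi (fun _ => volume) : Measure (Torus n)))

instance cylinder_isAddHaarMeasure (n : ℕ) : (volume : Measure (Cylinder n)).IsAddHaarMeasure :=
  inferInstanceAs ((volume : Measure ℝ).prod (volume : Measure (Torus n))).IsAddHaarMeasure

instance cylinder_regular (n : ℕ) : (volume : Measure (Cylinder n)).Regular :=
  Measure.Regular.of_sigmaCompactSpace_of_isLocallyFiniteMeasure _

namespace Cylinder

variable {n : ℕ}

/-- The splitting `ℝ^(n+1) ≃ ℝ × ℝⁿ` that separates the first coordinate from the others. -/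
def splitEquiv (n : ℕ) : Vec (n + 1) ≃L[ℝ] ℝ × (Fin n → ℝ) :=
  LinearEquiv.toContinuousLinearEquiv
    { toFun := fun y => (y 0, fun k => y k.succ)
      map_add' := fun _ _ => rfl
      map_smul' := fun _ _ => rfl
      invFun := fun p => WithLp.toLp 2 (Fin.cons p.1 p.2)
      left_inv := fun y => by
        ext i
        refine Fin.cases ?_ (fun k => ?_) i <;> simp
      right_inv := fun p => by
        ext <;> simp }

/-- The covering map in the splitting `ℝ^(n+1) = ℝ × ℝⁿ`. -/
def cover (n : ℕ) (p : ℝ × (Fin n → ℝ)) : Cylinder n :=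
  (p.1, fun k => ((p.2 k : ℝ) : UnitAddCircle))

lemma proj_eq_cover (y : Vec (n + 1)) : proj n y = cover n (splitEquiv n y) := rfl

lemma cover_eq_proj (p : ℝ × (Fin n → ℝ)) : cover n p = proj n ((splitEquiv n).symm p) := by
  rw [proj_eq_cover, ContinuousLinearEquiv.apply_symm_apply]

lemma isOpenQuotientMap_proj : IsOpenQuotientMap (proj n) := by
  have h1 : IsOpenQuotientMap (cover n) := by
    have : IsOpenQuotientMap (Pi.map (fun (_ : Fin n) (t : ℝ) => (t : UnitAddCircle))) :=
      IsOpenQuotientMap.piMap (fun _ => QuotientAddGroup.isOpenQuotientMap_mk)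
    exact IsOpenQuotientMap.id.prodMap this
  exact h1.comp (splitEquiv n).toHomeomorph.isOpenQuotientMap

lemma continuous_proj : Continuous (proj n) := isOpenQuotientMap_proj.continuous

lemma proj_surjective : Function.Surjective (proj n) := isOpenQuotientMap_proj.surjective

lemma proj_add (y z : Vec (n + 1)) : proj n (y + z) = proj n y + proj n z := by
  ext <;> simp [proj]

lemma proj_zero : proj n 0 = 0 := by
  ext <;> simp [proj]

lemma proj_neg (y : Vec (n + 1)) : proj n (-y) = -proj n y := by
  rw [eq_neg_iff_add_eq_zero, ← proj_add, neg_add_cancel, proj_zero]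

lemma proj_sub (y z : Vec (n + 1)) : proj n (y - z) = proj n y - proj n z := by
  rw [sub_eq_add_neg, proj_add, proj_neg, ← sub_eq_add_neg]

/-- The point `t eᵢ` of the cylinder; `t ↦ dir i t` is a one-parameter group. -/
def dir (i : Fin (n + 1)) (t : ℝ) : Cylinder n := proj n (EuclideanSpace.single i t)

lemma dir_add (i : Fin (n + 1)) (s t : ℝ) : dir i (s + t) = dir i s + dir i t := by
  have : EuclideanSpace.single i (s + t) =
      EuclideanSpace.single i s + EuclideanSpace.single i t := by
    ext j
    by_cases h : j = i <;> simp [h]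
  rw [dir, this, proj_add]; rfl

@[simp] lemma dir_zero (i : Fin (n + 1)) : dir i 0 = (0 : Cylinder n) := by
  have : EuclideanSpace.single i (0 : ℝ) = (0 : Vec (n + 1)) := by
    ext j
    by_cases h : j = i <;> simp [h]
  rw [dir, this, proj_zero]

lemma dir_neg (i : Fin (n + 1)) (t : ℝ) : dir i (-t) = -dir i t := by
  rw [eq_neg_iff_add_eq_zero, ← dir_add, neg_add_cancel, dir_zero]

lemma dir_first (t : ℝ) : dir (0 : Fin (n + 1)) t = (t, 0) := by
  ext <;> simp [dir, proj]

lemma dir_first_fst (t : ℝ) : (dir (0 : Fin (n + 1)) t).1 = t := by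
  rw [dir_first]

@[simp] lemma dir_succ_fst (k : Fin n) (t : ℝ) : (dir k.succ t).1 = 0 := by
  simp [dir, proj, (Fin.succ_ne_zero k).symm]

lemma dir_fst (i : Fin (n + 1)) (t : ℝ) : (dir i t).1 = if i = 0 then t else 0 := by
  refine Fin.cases ?_ (fun k => ?_) i
  · simp [dir_first_fst]
  · simp [Fin.succ_ne_zero]

lemma continuous_dir (i : Fin (n + 1)) : Continuous (dir i) := by
  refine continuous_proj.comp ?_
  have : (EuclideanSpace.single i : ℝ → Vec (n + 1)) =
      fun t : ℝ => t • EuclideanSpace.single i (1 : ℝ) := by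
    funext t; ext j; by_cases h : j = i <;> simp [h]
  rw [this]; fun_prop

/-! ### Directional derivatives and integration by parts -/

/-- `F'` is the partial derivative `∂ᵢ F` of `F` at every point of the cylinder. -/
def HasPartial {E : Type*} [NormedAddCommGroup E] [NormedSpace ℝ E] (i : Fin (n + 1))
    (F F' : Cylinder n → E) : Prop :=
  ∀ x, HasDerivAt (fun t => F (x + dir i t)) (F' x) 0

section
variable {E : Type*} [NormedAddCommGroup E] [NormedSpace ℝ E]

lemma HasPartial.hasDerivAt {i : Fin (n + 1)} {F F' : Cylinder n → E} (h : HasPartial i F F')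
    (x : Cylinder n) (s : ℝ) : HasDerivAt (fun t => F (x + dir i t)) (F' (x + dir i s)) s := by
  have h1 := h (x + dir i s)
  have h2 : HasDerivAt (fun t : ℝ => t - s) 1 s := by simpa using (hasDerivAt_id s).sub_const s
  have h1' : HasDerivAt (fun t => F (x + dir i s + dir i t)) (F' (x + dir i s)) (s - s) := by
    simpa using h1
  have h3 := HasDerivAt.scomp (h := fun t => t - s) s h1' h2
  simp only [one_smul] at h3
  convert! h3 using 1
  funext t
  simp only [Function.comp]
  rw [add_assoc, ← dir_add, add_sub_cancel]

lemma HasPartial.sub_eq_integral [CompleteSpace E] {i : Fin (n + 1)} {F F' : Cylinder n → E}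
    (h : HasPartial i F F') (hc : Continuous F') (x : Cylinder n) (s : ℝ) :
    F (x + dir i s) - F x = ∫ t in (0 : ℝ)..s, F' (x + dir i t) := by
  have := intervalIntegral.integral_eq_sub_of_hasDerivAt (a := 0) (b := s)
    (fun t _ => h.hasDerivAt x t)
    ((hc.comp (continuous_const.add (continuous_dir i))).intervalIntegrable _ _)
  rw [this]; simp

/-- Integration by parts on the cylinder: a partial derivative of a compactly supported function
has vanishing integral, because translations preserve the integral. -/
lemma HasPartial.integral_eq_zero [CompleteSpace E] {i : Fin (n + 1)} {F F' : Cylinder n → E}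
    (h : HasPartial i F F') (hF : Continuous F) (hF' : Continuous F') (hs : HasCompactSupport F)
    (hs' : HasCompactSupport F') : ∫ x, F' x = 0 := by
  have hint : Integrable F volume := hF.integrable_of_hasCompactSupport hs
  have hint' : Integrable F' volume := hF'.integrable_of_hasCompactSupport hs'
  have h1 : ∀ x, F (x + dir i 1) - F x = ∫ t in Set.Ioc (0 : ℝ) 1, F' (x + dir i t) := fun x => by
    rw [h.sub_eq_integral hF', intervalIntegral.integral_of_le zero_le_one]
  have h2 : ∫ x, (F (x + dir i 1) - F x) = 0 := by
    rw [integral_sub (hint.comp_add_right _) hint, integral_add_right_eq_self, sub_self]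
  simp_rw [h1] at h2
  have hmeas : AEStronglyMeasurable
      (Function.uncurry fun (x : Cylinder n) (t : ℝ) => F' (x + dir i t))
      ((volume : Measure (Cylinder n)).prod (volume.restrict (Set.Ioc (0 : ℝ) 1))) :=
    Continuous.aestronglyMeasurable
      (hF'.comp (continuous_fst.add ((continuous_dir i).comp continuous_snd)))
  rw [integral_integral_swap] at h2
  · simp_rw [integral_add_right_eq_self F'] at h2
    simpa using h2
  · refine (integrable_prod_iff' hmeas).2 ⟨?_, ?_⟩
    · exact Eventually.of_forall fun t => hint'.comp_add_right (dir i t)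
    · simp only [Function.uncurry]
      simp_rw [integral_add_right_eq_self (fun x => ‖F' x‖)]
      exact integrable_const _

end

end Cylinder

open Cylinder
open scoped ENNReal NNReal

section TestFunctions
variable {n : ℕ} {φ : Cylinder n → ℝ}

namespace IsTestFunction

lemma continuous (hφ : IsTestFunction φ) : Continuous φ :=
  isOpenQuotientMap_proj.isQuotientMap.continuous_iff.2 hφ.smooth.continuous

lemma hasDerivAt_proj (hφ : IsTestFunction φ) (i : Fin (n + 1)) (y : Vec (n + 1)) :
    HasDerivAt (fun t => φ (proj n y + dir i t))
      (fderiv ℝ (φ ∘ proj n) y (EuclideanSpace.single i 1)) 0 := by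
  have h1 : HasFDerivAt (φ ∘ proj n) (fderiv ℝ (φ ∘ proj n) y)
      (y + (0 : ℝ) • EuclideanSpace.single i (1 : ℝ)) := by
    simpa using (hφ.smooth.differentiable (by simp) y).hasFDerivAt
  have h2 : HasDerivAt (fun t : ℝ => y + t • EuclideanSpace.single i (1 : ℝ))
      (EuclideanSpace.single i (1 : ℝ)) 0 := by
    simpa using ((hasDerivAt_id (0 : ℝ)).smul_const (EuclideanSpace.single i (1 : ℝ))).const_add y
  have h3 := h1.comp_hasDerivAt (0 : ℝ) h2
  convert! h3 using 1
  funext t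
  have : EuclideanSpace.single i t = t • EuclideanSpace.single i (1 : ℝ) := by
    ext j; by_cases h : j = i <;> simp [h]
  simp only [Function.comp, dir]
  rw [proj_add, this]

lemma partialDeriv_proj (hφ : IsTestFunction φ) (i : Fin (n + 1)) (y : Vec (n + 1)) :
    partialDeriv i φ (proj n y) = fderiv ℝ (φ ∘ proj n) y (EuclideanSpace.single i 1) :=
  (hφ.hasDerivAt_proj i y).deriv

lemma hasPartial (hφ : IsTestFunction φ) (i : Fin (n + 1)) :
    HasPartial i φ (partialDeriv i φ) := by
  intro x
  obtain ⟨y, rfl⟩ := proj_surjective x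
  rw [hφ.partialDeriv_proj]
  exact hφ.hasDerivAt_proj i y

lemma partialDeriv_eq_zero (i : Fin (n + 1)) {x : Cylinder n} (hx : x ∉ tsupport φ) :
    partialDeriv i φ x = 0 := by
  have h1 : ∀ᶠ t in 𝓝 (0 : ℝ), φ (x + dir i t) = 0 := by
    have hc : Tendsto (fun t => x + dir i t) (𝓝 0) (𝓝 x) := by
      have := (continuous_const.add (continuous_dir i) : Continuous fun t => x + dir i t).tendsto 0
      rwa [Pi.add_apply, dir_zero, add_zero] at this
    exact hc.eventually (notMem_tsupport_iff_eventuallyEq.1 hx)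
  have h2 : (fun t : ℝ => φ (x + dir i t)) =ᶠ[𝓝 0] fun _ => 0 := h1
  exact h2.deriv_eq.trans (by simp)

lemma partialDeriv (hφ : IsTestFunction φ) (i : Fin (n + 1)) :
    IsTestFunction (Cylinder.partialDeriv i φ) where
  smooth := by
    have : Cylinder.partialDeriv i φ ∘ proj n =
        fun y => fderiv ℝ (φ ∘ proj n) y (EuclideanSpace.single i 1) :=
      funext fun y => hφ.partialDeriv_proj i y
    rw [this]
    exact (hφ.smooth.fderiv_right (m := ((⊤ : ℕ∞) : WithTop ℕ∞)) (by simp)).clm_apply contDiff_const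
  compact := HasCompactSupport.intro hφ.compact fun _ hx => partialDeriv_eq_zero i hx

lemma partialDeriv_comm (hφ : IsTestFunction φ) (i j : Fin (n + 1)) :
    Cylinder.partialDeriv i (Cylinder.partialDeriv j φ) =
      Cylinder.partialDeriv j (Cylinder.partialDeriv i φ) := by
  have key : ∀ i j y, Cylinder.partialDeriv i (Cylinder.partialDeriv j φ) (proj n y) =
      fderiv ℝ (fderiv ℝ (φ ∘ proj n)) y (EuclideanSpace.single i 1)
        (EuclideanSpace.single j 1) := by
    intro i j y
    rw [(hφ.partialDeriv j).partialDeriv_proj]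
    have : Cylinder.partialDeriv j φ ∘ proj n =
        fun y => fderiv ℝ (φ ∘ proj n) y (EuclideanSpace.single j 1) :=
      funext fun y => hφ.partialDeriv_proj j y
    rw [this]
    have hd : DifferentiableAt ℝ (fderiv ℝ (φ ∘ proj n)) y :=
      ((hφ.smooth.fderiv_right (m := ((⊤ : ℕ∞) : WithTop ℕ∞)) (by simp)).differentiable (by simp)) y
    rw [fderiv_clm_apply hd (by fun_prop)]
    simp
  funext x
  obtain ⟨y, rfl⟩ := proj_surjective x
  rw [key, key]
  have hs : IsSymmSndFDerivAt ℝ (φ ∘ proj n) y :=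
    (hφ.smooth.contDiffAt).isSymmSndFDerivAt (by
      rw [minSmoothness_of_isRCLikeNormedField]; exact WithTop.coe_le_coe.2 (le_top : (2 : ℕ∞) ≤ ⊤))
  exact hs _ _

lemma comp_const_sub (hφ : IsTestFunction φ) (x : Cylinder n) :
    IsTestFunction (fun y => φ (x - y)) where
  smooth := by
    obtain ⟨z, rfl⟩ := proj_surjective x
    have : (fun y => φ (proj n z - y)) ∘ proj n = fun y => (φ ∘ proj n) (z - y) := by
      funext y; simp [proj_sub]
    rw [this]
    exact hφ.smooth.comp (contDiff_const.sub contDiff_id)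
  compact := hφ.compact.comp_homeomorph (Homeomorph.subLeft x)

lemma partialDeriv_comp_const_sub (hφ : IsTestFunction φ) (i : Fin (n + 1)) (x y : Cylinder n) :
    Cylinder.partialDeriv i (fun y => φ (x - y)) y = -Cylinder.partialDeriv i φ (x - y) := by
  have h := hφ.hasPartial i (x - y)
  have h0 : HasDerivAt (fun t => φ (x - y + dir i t)) (Cylinder.partialDeriv i φ (x - y)) (-0) := by
    simpa using h
  have h1 := h0.scomp (0 : ℝ) (hasDerivAt_neg (0 : ℝ))
  have : (fun t : ℝ => φ (x - (y + dir i t))) =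
      (fun t => φ (x - y + dir i t)) ∘ fun t => -t := by
    funext t
    simp only [Function.comp, dir_neg]
    congr 1; abel
  have h2 : HasDerivAt (fun t : ℝ => φ (x - (y + dir i t)))
      (-Cylinder.partialDeriv i φ (x - y)) 0 := by
    rw [this]; simpa using h1
  exact h2.deriv

end IsTestFunction

end TestFunctions

namespace Cylinder
variable {n : ℕ}

/-! ### Mollifying kernels -/

/-- A smooth exhaustion of the cylinder vanishing only at the origin: it plays the role of the
squared distance to `0`. -/
def gauge (x : Cylinder n) : ℝ :=
  x.1 ^ 2 + ∑ k, (1 - ((AddCircle.toCircle (x.2 k) : Circle) : ℂ).re)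

lemma circle_re_le_one (z : Circle) : (z : ℂ).re ≤ 1 :=
  (Complex.re_le_norm _).trans (Circle.norm_coe z).le

lemma gauge_nonneg (x : Cylinder n) : 0 ≤ gauge x :=
  add_nonneg (sq_nonneg _) (Finset.sum_nonneg fun _ _ => sub_nonneg.2 (circle_re_le_one _))

lemma gauge_zero : gauge (0 : Cylinder n) = 0 := by
  simp [gauge]

lemma eq_zero_of_gauge_eq_zero {x : Cylinder n} (h : gauge x = 0) : x = 0 := by
  have h1 : 0 ≤ ∑ k, (1 - ((AddCircle.toCircle (x.2 k) : Circle) : ℂ).re) :=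
    Finset.sum_nonneg fun _ _ => sub_nonneg.2 (circle_re_le_one _)
  have h2 : x.1 ^ 2 = 0 := by
    unfold gauge at h; nlinarith [sq_nonneg x.1]
  have h3 : ∑ k, (1 - ((AddCircle.toCircle (x.2 k) : Circle) : ℂ).re) = 0 := by
    unfold gauge at h; linarith
  rw [Finset.sum_eq_zero_iff_of_nonneg fun _ _ => sub_nonneg.2 (circle_re_le_one _)] at h3
  ext k
  · simpa using h2
  · have h4 := h3 k (Finset.mem_univ _)
    set z := AddCircle.toCircle (x.2 k) with hz
    have h5 : (z : ℂ).re = 1 := by linarith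
    have h6 : (z : ℂ).re ^ 2 + (z : ℂ).im ^ 2 = 1 := by
      have := Circle.normSq_coe z
      rw [Complex.normSq_apply] at this; nlinarith
    have h7 : (z : ℂ).im = 0 := by nlinarith
    have h8 : z = 1 := by
      refine Circle.ext ?_
      exact Complex.ext (by rw [h5]; rfl) (by rw [h7]; rfl)
    have := AddCircle.injective_toCircle (T := 1) one_ne_zero
      (hz.symm.trans (h8.trans AddCircle.toCircle_zero.symm))
    simpa using this

lemma continuous_gauge : Continuous (gauge : Cylinder n → ℝ) := by
  unfold gauge
  refine (continuous_fst.pow 2).add (continuous_finsetSum _ fun k _ => ?_)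
  refine continuous_const.sub (Complex.continuous_re.comp ?_)
  exact continuous_subtype_val.comp
    (AddCircle.continuous_toCircle.comp ((continuous_apply k).comp continuous_snd))

lemma contDiff_gauge_proj : ContDiff ℝ ((⊤ : ℕ∞) : WithTop ℕ∞) (gauge ∘ proj n) := by
  have : gauge ∘ proj n = fun y : Vec (n + 1) =>
      (y 0) ^ 2 + ∑ k : Fin n, (1 - Real.cos (2 * Real.pi * y k.succ)) := by
    funext y
    simp only [gauge, Function.comp, proj, AddCircle.toCircle_apply_mk, Circle.coe_exp]
    congr 1
    refine Finset.sum_congr rfl fun k _ => ?_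
    rw [Complex.exp_ofReal_mul_I_re]; simp
  rw [this]
  fun_prop

lemma isCompact_gauge_le (c : ℝ) : IsCompact {x : Cylinder n | gauge x ≤ c} := by
  refine ((isCompact_Icc (a := -(1 + |c|)) (b := 1 + |c|)).prod
    (isCompact_univ (X := Torus n))).of_isClosed_subset
    (isClosed_le continuous_gauge continuous_const) ?_
  intro x hx
  have h1 : 0 ≤ ∑ k, (1 - ((AddCircle.toCircle (x.2 k) : Circle) : ℂ).re) :=
    Finset.sum_nonneg fun _ _ => sub_nonneg.2 (circle_re_le_one _)
  have h2 : x.1 ^ 2 ≤ |c| := by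
    have : gauge x ≤ c := hx
    unfold gauge at this
    linarith [le_abs_self c]
  refine ⟨abs_le.1 (abs_le_of_sq_le_sq ?_ (by positivity)), trivial⟩
  nlinarith [abs_nonneg c]

lemma exists_gauge_lt_subset {U : Set (Cylinder n)} (hU : U ∈ 𝓝 0) :
    ∃ δ > 0, {x : Cylinder n | gauge x ≤ δ} ⊆ U := by
  obtain ⟨V, hVU, hV, h0⟩ := mem_nhds_iff.1 hU
  have hK : IsCompact ({x : Cylinder n | gauge x ≤ 1} \ V) := (isCompact_gauge_le 1).diff hV
  rcases ({x : Cylinder n | gauge x ≤ 1} \ V).eq_empty_or_nonempty with he | hne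
  · exact ⟨1, one_pos, (Set.sdiff_eq_empty.1 he).trans hVU⟩
  · obtain ⟨x, hx, hmin⟩ := hK.exists_isMinOn hne continuous_gauge.continuousOn
    have hpos : 0 < gauge x := lt_of_le_of_ne (gauge_nonneg x) fun h =>
      hx.2 (eq_zero_of_gauge_eq_zero h.symm ▸ h0)
    refine ⟨min 1 (gauge x / 2), by positivity, fun y hy => hVU ?_⟩
    by_contra hyV
    have h1 := hmin (show y ∈ _ from ⟨le_trans (show gauge y ≤ _ from hy) (min_le_left _ _), hyV⟩)
    have h2 : gauge y ≤ gauge x / 2 := le_trans (show gauge y ≤ _ from hy) (min_le_right _ _)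
    have h3 : gauge x ≤ gauge y := h1
    linarith

/-- A mollifying kernel: a nonnegative test function of integral one. -/
structure IsKernel (ρ : Cylinder n → ℝ) : Prop where
  test : IsTestFunction ρ
  nonneg : ∀ x, 0 ≤ ρ x
  integral_eq_one : ∫ x, ρ x = 1

/-- There are mollifying kernels supported in arbitrarily small neighbourhoods of the origin. -/
lemma exists_isKernel {U : Set (Cylinder n)} (hU : U ∈ 𝓝 0) :
    ∃ ρ : Cylinder n → ℝ, IsKernel ρ ∧ ∀ x, ρ x ≠ 0 → x ∈ U := by
  obtain ⟨δ, hδ, hsub⟩ := exists_gauge_lt_subset hU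
  set f : Cylinder n → ℝ := fun x => expNegInvGlue (δ - gauge x) with hf
  have hf0 : ∀ x, 0 ≤ f x := fun x => expNegInvGlue.nonneg _
  have hfs : ∀ x, f x ≠ 0 → gauge x ≤ δ := fun x hx => by
    by_contra h
    exact hx (expNegInvGlue.zero_of_nonpos (by linarith [not_le.1 h]))
  have htest : IsTestFunction f :=
    { smooth := (expNegInvGlue.contDiff (n := ⊤)).comp (contDiff_const.sub contDiff_gauge_proj)
      compact := HasCompactSupport.intro (isCompact_gauge_le δ) fun x hx => by
        by_contra h
        exact hx (hfs x h) }
  have hpos : 0 < ∫ x, f x := by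
    refine htest.continuous.integral_pos_of_hasCompactSupport_nonneg_nonzero htest.compact hf0
      (x := 0) ?_
    exact (expNegInvGlue.pos_of_pos (by rw [gauge_zero]; linarith)).ne'
  refine ⟨fun x => (∫ x, f x)⁻¹ * f x, ⟨⟨?_, ?_⟩, ?_, ?_⟩, ?_⟩
  · exact contDiff_const.mul htest.smooth
  · exact htest.compact.mul_left
  · exact fun x => mul_nonneg (inv_nonneg.2 hpos.le) (hf0 x)
  · rw [integral_const_mul, inv_mul_cancel₀ hpos.ne']
  · exact fun x hx => hsub (hfs x (right_ne_zero_of_mul hx))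

end Cylinder

/-! ### Mollification on the cylinder -/

/-- Jensen's inequality for powers of the norm of a Bochner integral. -/
lemma enorm_integral_rpow_le {Y E : Type*} [MeasurableSpace Y] [NormedAddCommGroup E]
    [NormedSpace ℝ E] (ν : Measure Y) [IsProbabilityMeasure ν] {h : Y → E}
    (hm : AEStronglyMeasurable h ν) {q : ℝ} (hq : 1 ≤ q) :
    ‖∫ y, h y ∂ν‖ₑ ^ q ≤ ∫⁻ y, ‖h y‖ₑ ^ q ∂ν := by
  have hq0 : 0 < q := by linarith
  have h1 : ‖∫ y, h y ∂ν‖ₑ ≤ eLpNorm h 1 ν := by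
    rw [eLpNorm_one_eq_lintegral_enorm]; exact enorm_integral_le_lintegral_enorm _
  have h2 : eLpNorm h 1 ν ≤ eLpNorm h (ENNReal.ofReal q) ν :=
    eLpNorm_le_eLpNorm_of_exponent_le (by simpa using ENNReal.ofReal_le_ofReal hq) hm
  have h3 : eLpNorm h (ENNReal.ofReal q) ν = (∫⁻ y, ‖h y‖ₑ ^ q ∂ν) ^ (1 / q) := by
    rw [eLpNorm_eq_lintegral_rpow_enorm_toReal (by simpa using hq0) ENNReal.ofReal_ne_top,
      ENNReal.toReal_ofReal hq0.le]
  calc ‖∫ y, h y ∂ν‖ₑ ^ q ≤ ((∫⁻ y, ‖h y‖ₑ ^ q ∂ν) ^ (1 / q)) ^ q :=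
        ENNReal.rpow_le_rpow ((h1.trans h2).trans h3.le) hq0.le
    _ = ∫⁻ y, ‖h y‖ₑ ^ q ∂ν := by
        rw [← ENNReal.rpow_mul, one_div, inv_mul_cancel₀ hq0.ne', ENNReal.rpow_one]

namespace Cylinder
variable {n : ℕ} {E : Type*} [NormedAddCommGroup E] [NormedSpace ℝ E]

/-- The mollification `(ρ ⋆ f)(x) = ∫ ρ(x - y) f(y) dy`. -/
def moll (ρ : Cylinder n → ℝ) (f : Cylinder n → E) (x : Cylinder n) : E :=
  ∫ y, ρ (x - y) • f y

/-- The probability measure `ρ dx`. -/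
def kernelMeasure (ρ : Cylinder n → ℝ) : Measure (Cylinder n) :=
  volume.withDensity fun y => ENNReal.ofReal (ρ y)

lemma moll_eq_integral_sub (ρ : Cylinder n → ℝ) (f : Cylinder n → E) (x : Cylinder n) :
    moll ρ f x = ∫ y, ρ y • f (x - y) := by
  rw [moll, ← integral_sub_left_eq_self (fun y => ρ (x - y) • f y) volume x]
  simp

lemma IsKernel.moll_eq {ρ : Cylinder n → ℝ} (hρ : IsKernel ρ) (f : Cylinder n → E)
    (x : Cylinder n) : moll ρ f x = ∫ y, f (x - y) ∂kernelMeasure ρ := by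
  rw [moll_eq_integral_sub, kernelMeasure, integral_withDensity_eq_integral_toReal_smul
    (hρ.test.continuous.measurable.ennreal_ofReal) (by simp)]
  simp [ENNReal.toReal_ofReal (hρ.nonneg _)]

lemma IsKernel.isProbabilityMeasure {ρ : Cylinder n → ℝ} (hρ : IsKernel ρ) :
    IsProbabilityMeasure (kernelMeasure ρ) := by
  refine ⟨?_⟩
  rw [kernelMeasure, withDensity_apply _ MeasurableSet.univ, Measure.restrict_univ,
    ← ofReal_integral_eq_lintegral_ofReal
      (hρ.test.continuous.integrable_of_hasCompactSupport hρ.test.compact)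
      (Eventually.of_forall hρ.nonneg), hρ.integral_eq_one, ENNReal.ofReal_one]

lemma moll_congr_ae {ρ : Cylinder n → ℝ} {f g : Cylinder n → E} (h : f =ᵐ[volume] g) :
    moll ρ f = moll ρ g := by
  funext x
  exact integral_congr_ae (h.mono fun y hy => by simp only [hy])

lemma integrable_moll_integrand {ρ : Cylinder n → ℝ} (hρ : Continuous ρ)
    (hρs : HasCompactSupport ρ) {f : Cylinder n → E} (hf : LocallyIntegrable f volume)
    (x : Cylinder n) : Integrable (fun y => ρ (x - y) • f y) volume := by
  refine hf.integrable_smul_left_of_hasCompactSupport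
    (hρ.comp (continuous_const.sub continuous_id)) ?_
  exact hρs.comp_homeomorph (Homeomorph.subLeft x)

lemma IsKernel.integrable_sub {ρ : Cylinder n → ℝ} (hρ : IsKernel ρ) {f : Cylinder n → E}
    (hf : LocallyIntegrable f volume) (x : Cylinder n) :
    Integrable (fun y => f (x - y)) (kernelMeasure ρ) := by
  rw [kernelMeasure, integrable_withDensity_iff_integrable_smul'
    (hρ.test.continuous.measurable.ennreal_ofReal) (by simp)]
  have := (integrable_moll_integrand hρ.test.continuous hρ.test.compact hf x).comp_sub_left x
  simpa [ENNReal.toReal_ofReal (hρ.nonneg _)] using this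

/-- The `L^q`-distance between a function and its average under translations is at most the
average of the distances to the translates. -/
lemma lintegral_sub_average_le {f : Cylinder n → E} (hf : StronglyMeasurable f)
    (ν : Measure (Cylinder n)) [IsProbabilityMeasure ν] (A : Set (Cylinder n))
    (hint : ∀ x, Integrable (fun y => f (x - y)) ν) {q : ℝ} (hq : 1 ≤ q) [CompleteSpace E] :
    ∫⁻ x in A, ‖f x - ∫ y, f (x - y) ∂ν‖ₑ ^ q ≤
      ∫⁻ y, (∫⁻ x in A, ‖f x - f (x - y)‖ₑ ^ q) ∂ν := by
  have hm : StronglyMeasurable (Function.uncurry fun (x y : Cylinder n) => f x - f (x - y)) :=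
    (hf.comp_measurable measurable_fst).sub
      (hf.comp_measurable (measurable_fst.sub measurable_snd))
  calc ∫⁻ x in A, ‖f x - ∫ y, f (x - y) ∂ν‖ₑ ^ q
      ≤ ∫⁻ x in A, (∫⁻ y, ‖f x - f (x - y)‖ₑ ^ q ∂ν) := by
        refine lintegral_mono fun x => ?_
        have : f x - ∫ y, f (x - y) ∂ν = ∫ y, (f x - f (x - y)) ∂ν := by
          rw [integral_sub (integrable_const _) (hint x)]; simp
        rw [this]
        exact enorm_integral_rpow_le ν
          (hm.comp_measurable measurable_prodMk_left).aestronglyMeasurable hq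
    _ = _ := lintegral_lintegral_swap (hm.enorm.pow_const q).aemeasurable

/-- Translations act continuously on `L^q`. -/
lemma tendsto_lintegral_translate_sub {E : Type*} [NormedAddCommGroup E] {f : Cylinder n → E}
    {q : ℝ} (hq : 1 ≤ q)
    (hf : MemLp f (ENNReal.ofReal q) volume) :
    Tendsto (fun y => ∫⁻ x, ‖f x - f (x - y)‖ₑ ^ q) (𝓝 0) (𝓝 0) := by
  have hq0 : 0 < q := by linarith
  have : Fact (1 ≤ ENNReal.ofReal q) := ⟨by simpa using ENNReal.ofReal_le_ofReal hq⟩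
  let g : Cylinder n → C(Cylinder n, Cylinder n) := fun y => ⟨fun x => x - y, by fun_prop⟩
  have hg : Continuous g :=
    (ContinuousMap.curry ⟨fun p : Cylinder n × Cylinder n => p.2 - p.1, by fun_prop⟩).continuous
  have hgm : ∀ y, MeasurePreserving (g y) volume volume := fun y =>
    measurePreserving_sub_right volume y
  have h1 := Filter.Tendsto.compMeasurePreservingLp (f := fun _ => hf.toLp f) (l := 𝓝 0)
    tendsto_const_nhds (hg.tendsto 0) hgm (hgm 0) ENNReal.ofReal_ne_top
  rw [Lp.tendsto_Lp_iff_tendsto_eLpNorm'] at h1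
  have h2 : ∀ y, eLpNorm (⇑(Lp.compMeasurePreserving (g y) (hgm y) (hf.toLp f)) -
      ⇑(Lp.compMeasurePreserving (g 0) (hgm 0) (hf.toLp f))) (ENNReal.ofReal q) volume ^ q =
      ∫⁻ x, ‖f x - f (x - y)‖ₑ ^ q := by
    intro y
    rw [eLpNorm_eq_lintegral_rpow_enorm_toReal (by simpa using hq0) ENNReal.ofReal_ne_top,
      ENNReal.toReal_ofReal hq0.le, ← ENNReal.rpow_mul, one_div, inv_mul_cancel₀ hq0.ne',
      ENNReal.rpow_one]
    refine lintegral_congr_ae ?_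
    have e1 : ∀ y, ⇑(Lp.compMeasurePreserving (g y) (hgm y) (hf.toLp f)) =ᵐ[volume]
        fun x => f (x - y) := fun y =>
      (Lp.coeFn_compMeasurePreserving _ _).trans
        ((hgm y).quasiMeasurePreserving.ae_eq_comp hf.coeFn_toLp)
    filter_upwards [e1 y, e1 0] with x hx hx0
    rw [Pi.sub_apply, hx, hx0, sub_zero, ← enorm_neg, neg_sub]
  have h3 := ((ENNReal.continuous_rpow_const (y := q)).tendsto 0).comp h1
  simp only [Function.comp_def, h2, ENNReal.zero_rpow_of_pos hq0] at h3
  exact h3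

/-- By Jensen's inequality, mollification moves `f` in `L^q` no further than the translations by
points of the support of the kernel do. -/
lemma lintegral_sub_moll_le {f : Cylinder n → E} {q : ℝ} (hq : 1 ≤ q) [CompleteSpace E]
    (hf : LocallyIntegrable f volume)
    {ρ : Cylinder n → ℝ} (hρ : IsKernel ρ) {δ : ℝ≥0∞}
    (hδ : ∀ y, ρ y ≠ 0 → ∫⁻ x, ‖f x - f (x - y)‖ₑ ^ q ≤ δ) :
    ∫⁻ x, ‖f x - moll ρ f x‖ₑ ^ q ≤ δ := by
  have := hρ.isProbabilityMeasure
  obtain ⟨g, hg, hfg⟩ := hf.aestronglyMeasurable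
  have hgl : LocallyIntegrable g volume := hf.congr hfg
  have h0 : ∀ y, ∫⁻ x, ‖f x - f (x - y)‖ₑ ^ q = ∫⁻ x, ‖g x - g (x - y)‖ₑ ^ q := fun y => by
    refine lintegral_congr_ae ?_
    filter_upwards [hfg, (measurePreserving_sub_right volume y).quasiMeasurePreserving.ae_eq_comp
      hfg] with x h1 h2
    simp only [Function.comp_apply] at h2
    rw [h1, h2]
  have h1 : ∫⁻ x, ‖f x - moll ρ f x‖ₑ ^ q = ∫⁻ x, ‖g x - ∫ y, g (x - y) ∂kernelMeasure ρ‖ₑ ^ q := by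
    refine lintegral_congr_ae (hfg.mono fun x hx => ?_)
    simp only
    rw [hx, moll_congr_ae hfg, hρ.moll_eq]
  rw [h1]
  have h2 := lintegral_sub_average_le hg (kernelMeasure ρ) Set.univ
    (fun x => hρ.integrable_sub hgl x) hq
  simp only [Measure.restrict_univ] at h2
  refine h2.trans ?_
  have h3 : ∀ᵐ y ∂kernelMeasure ρ, ∫⁻ x, ‖g x - g (x - y)‖ₑ ^ q ≤ δ := by
    rw [kernelMeasure, ae_withDensity_iff hρ.test.continuous.measurable.ennreal_ofReal]
    refine Eventually.of_forall fun y hy => ?_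
    rw [← h0]
    refine hδ y fun h => hy (by simp [h])
  calc _ ≤ ∫⁻ _, δ ∂kernelMeasure ρ := lintegral_mono_ae h3
    _ = δ := by simp

/-- A sequence of mollifying kernels whose supports shrink to the origin. -/
structure IsMollifier (ρ : ℕ → Cylinder n → ℝ) : Prop where
  kernel : ∀ k, IsKernel (ρ k)
  shrink : ∀ U ∈ 𝓝 (0 : Cylinder n), ∀ᶠ k in atTop, ∀ x, ρ k x ≠ 0 → x ∈ U

lemma exists_isMollifier (n : ℕ) : ∃ ρ : ℕ → Cylinder n → ℝ, IsMollifier ρ := by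
  obtain ⟨U, hU⟩ := (𝓝 (0 : Cylinder n)).exists_antitone_basis
  choose ρ hρ hsub using fun k => exists_isKernel (hU.1.mem_of_mem (i := k) trivial)
  refine ⟨ρ, hρ, fun V hV => ?_⟩
  obtain ⟨k, hk⟩ := hU.mem_iff.1 hV
  filter_upwards [eventually_ge_atTop k] with m hm x hx
  exact hk (hU.2 hm (hsub m x hx))

lemma IsMollifier.comp {ρ : ℕ → Cylinder n → ℝ} (hρ : IsMollifier ρ) {σ : ℕ → ℕ}
    (hσ : Tendsto σ atTop atTop) : IsMollifier (fun k => ρ (σ k)) :=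
  ⟨fun _ => hρ.kernel _, fun U hU => hσ.eventually (hρ.shrink U hU)⟩

/-- Mollifications converge in `L^q`. -/
lemma IsMollifier.tendsto_lintegral {ρ : ℕ → Cylinder n → ℝ} (hρ : IsMollifier ρ)
    [CompleteSpace E] {f : Cylinder n → E} {q : ℝ} (hq : 1 ≤ q)
    (hf : MemLp f (ENNReal.ofReal q) volume) :
    Tendsto (fun k => ∫⁻ x, ‖f x - moll (ρ k) f x‖ₑ ^ q) atTop (𝓝 0) := by
  rw [ENNReal.tendsto_nhds_zero]
  intro δ hδ
  have h1 := (ENNReal.tendsto_nhds_zero.1 (tendsto_lintegral_translate_sub hq hf)) δ hδ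
  have hl : LocallyIntegrable f volume :=
    hf.locallyIntegrable (by simpa using ENNReal.ofReal_le_ofReal hq)
  filter_upwards [hρ.shrink _ h1] with k hk
  exact lintegral_sub_moll_le hq hl (hρ.kernel k) hk

/-- The portion `a ≤ x₁ ≤ b` of the cylinder. -/
def slab (n : ℕ) (a b : ℝ) : Set (Cylinder n) := Prod.fst ⁻¹' Set.Icc a b

lemma measurableSet_slab (a b : ℝ) : MeasurableSet (slab n a b) :=
  measurable_fst measurableSet_Icc

lemma isCompact_slab (a b : ℝ) : IsCompact (slab n a b) := by
  have : slab n a b = Set.Icc a b ×ˢ Set.univ := by ext; simp [slab]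
  rw [this]
  exact isCompact_Icc.prod isCompact_univ

lemma volume_slab (a b : ℝ) : volume (slab n a b) = ENNReal.ofReal (b - a) := by
  have : slab n a b = Set.Icc a b ×ˢ Set.univ := by ext; simp [slab]
  rw [this]
  change ((volume : Measure ℝ).prod (volume : Measure (Torus n))) _ = _
  rw [Measure.prod_prod]
  simp

instance (a b : ℝ) : IsFiniteMeasure ((volume : Measure (Cylinder n)).restrict (slab n a b)) :=
  ⟨by simp [volume_slab]⟩

/-- Mollifications converge in `L^q` locally. -/
lemma IsMollifier.tendsto_setLIntegral_slab {ρ : ℕ → Cylinder n → ℝ} (hρ : IsMollifier ρ)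
    [CompleteSpace E] {f : Cylinder n → E} {q : ℝ} (hq : 1 ≤ q)
    (hf : ∀ a b, MemLp f (ENNReal.ofReal q) (volume.restrict (slab n a b))) (a b : ℝ) :
    Tendsto (fun k => ∫⁻ x in slab n a b, ‖f x - moll (ρ k) f x‖ₑ ^ q) atTop (𝓝 0) := by
  set g := (slab n (a - 1) (b + 1)).indicator f with hg
  have hgL : MemLp g (ENNReal.ofReal q) volume :=
    (memLp_indicator_iff_restrict (measurableSet_slab _ _)).2 (hf _ _)
  have hU : {x : Cylinder n | |x.1| < 1} ∈ 𝓝 (0 : Cylinder n) :=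
    (isOpen_lt (continuous_abs.comp continuous_fst) continuous_const).mem_nhds (by simp)
  refine tendsto_of_tendsto_of_tendsto_of_le_of_le' tendsto_const_nhds
    (hρ.tendsto_lintegral hq hgL) (Eventually.of_forall fun _ => zero_le) ?_
  filter_upwards [hρ.shrink _ hU] with k hk
  refine le_trans (le_of_eq ?_) (setLIntegral_le_lintegral (slab n a b) _)
  refine setLIntegral_congr_fun (measurableSet_slab _ _) fun x hx => ?_
  have h1 : g x = f x := Set.indicator_of_mem
    (show x ∈ slab n (a - 1) (b + 1) from ⟨by linarith [hx.1], by linarith [hx.2]⟩) _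
  have h2 : moll (ρ k) g x = moll (ρ k) f x := by
    refine integral_congr_ae (Eventually.of_forall fun y => ?_)
    by_cases h : ρ k (x - y) = 0
    · simp [h]
    · have h3 : |x.1 - y.1| < 1 := hk _ h
      have h4 : g y = f y := Set.indicator_of_mem
        (show y ∈ slab n (a - 1) (b + 1) from
          ⟨by linarith [hx.1, (abs_lt.1 h3).2], by linarith [hx.2, (abs_lt.1 h3).1]⟩) _
      simp only [h4]
  simp only [h1, h2]

/-! ### Differentiability of mollifications -/

lemma _root_.IsTestFunction.fderiv_proj_eq {φ : Cylinder n → ℝ} (hφ : IsTestFunction φ)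
    (y : Vec (n + 1)) : fderiv ℝ (φ ∘ proj n) y =
      ∑ i, partialDeriv i φ (proj n y) • (EuclideanSpace.proj i : Vec (n + 1) →L[ℝ] ℝ) := by
  refine ContinuousLinearMap.coe_injective
    ((EuclideanSpace.basisFun (Fin (n + 1)) ℝ).toBasis.ext fun j => ?_)
  simp [hφ.partialDeriv_proj, PiLp.single_apply]

/-- The derivative at `y` of `y ↦ ρ(y - a) f(a)` read on the covering space. -/
def mollFDeriv (ρ f : Cylinder n → ℝ) (y : Vec (n + 1)) (a : Cylinder n) : Vec (n + 1) →L[ℝ] ℝ :=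
  ∑ i, (partialDeriv i ρ (proj n y - a) * f a) • (EuclideanSpace.proj i : Vec (n + 1) →L[ℝ] ℝ)

lemma hasFDerivAt_mollFDeriv {ρ : Cylinder n → ℝ} (hρ : IsTestFunction ρ) (f : Cylinder n → ℝ)
    (y : Vec (n + 1)) (a : Cylinder n) :
    HasFDerivAt (fun y => ρ (proj n y - a) * f a) (mollFDeriv ρ f y a) y := by
  obtain ⟨z, rfl⟩ := proj_surjective a
  have h1 : HasFDerivAt (fun y => (ρ ∘ proj n) (y - z)) (fderiv ℝ (ρ ∘ proj n) (y - z)) y :=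
    ((hρ.smooth.differentiable (by simp) (y - z)).hasFDerivAt).comp y
      ((hasFDerivAt_id y).sub_const z)
  have h2 := h1.mul_const (f (proj n z))
  have e1 : (fun y => ρ (proj n y - proj n z) * f (proj n z)) =
      fun y => (ρ ∘ proj n) (y - z) * f (proj n z) := by
    funext y; rw [Function.comp_apply, proj_sub]
  have e2 : mollFDeriv ρ f y (proj n z) = f (proj n z) • fderiv ℝ (ρ ∘ proj n) (y - z) := by
    rw [hρ.fderiv_proj_eq, mollFDeriv, proj_sub, Finset.smul_sum]
    exact Finset.sum_congr rfl fun i _ => by rw [smul_smul, mul_comm]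
  rw [e1, e2]
  exact h2

lemma exists_norm_mollFDeriv_le {ρ : Cylinder n → ℝ} (hρ : IsTestFunction ρ)
    (f : Cylinder n → ℝ) : ∃ C, ∀ y a, ‖mollFDeriv ρ f y a‖ ≤ C * ‖f a‖ := by
  have hb : ∀ i, ∃ C, ∀ x, ‖partialDeriv i ρ x‖ ≤ C := fun i =>
    (hρ.partialDeriv i).compact.exists_bound_of_continuous (hρ.partialDeriv i).continuous
  choose C hC using hb
  refine ⟨∑ i, C i * ‖(EuclideanSpace.proj i : Vec (n + 1) →L[ℝ] ℝ)‖, fun y a => ?_⟩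
  rw [mollFDeriv, Finset.sum_mul]
  refine (norm_sum_le _ _).trans (Finset.sum_le_sum fun i _ => ?_)
  rw [norm_smul, norm_mul, mul_right_comm]
  exact mul_le_mul_of_nonneg_right
    (mul_le_mul_of_nonneg_right (hC i _) (norm_nonneg _)) (norm_nonneg _)

lemma integrable_sum_of_normed {ι F : Type*} [NormedAddCommGroup F] {s : Finset ι}
    {g : ι → Cylinder n → F} (h : ∀ i ∈ s, Integrable (g i) volume) :
    Integrable (fun a => ∑ i ∈ s, g i a) volume :=
  integrable_finsetSum s h

lemma integrable_mollFDeriv {ρ : Cylinder n → ℝ} (hρ : IsTestFunction ρ) {f : Cylinder n → ℝ}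
    (hf : LocallyIntegrable f volume) (y : Vec (n + 1)) :
    Integrable (mollFDeriv ρ f y) volume ∧ ∫ a, mollFDeriv ρ f y a =
      ∑ i, moll (partialDeriv i ρ) f (proj n y) •
        (EuclideanSpace.proj i : Vec (n + 1) →L[ℝ] ℝ) := by
  have hint : ∀ i, Integrable (fun a => partialDeriv i ρ (proj n y - a) * f a) volume :=
    fun i => integrable_moll_integrand (hρ.partialDeriv i).continuous
      (hρ.partialDeriv i).compact hf _
  have hint' : ∀ i ∈ Finset.univ, Integrable (fun a => (partialDeriv i ρ (proj n y - a) * f a) •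
      (EuclideanSpace.proj i : Vec (n + 1) →L[ℝ] ℝ)) volume := fun i _ => (hint i).smul_const _
  unfold mollFDeriv
  refine ⟨integrable_sum_of_normed hint', ?_⟩
  rw [integral_finsetSum Finset.univ hint']
  exact Finset.sum_congr rfl fun i _ => integral_smul_const _ _

lemma mollFDeriv_eq_zero {ρ : Cylinder n → ℝ} (f : Cylinder n → ℝ) {y : Vec (n + 1)}
    {a : Cylinder n} (h : proj n y - a ∉ tsupport ρ) : mollFDeriv ρ f y a = 0 := by
  rw [mollFDeriv]
  refine Finset.sum_eq_zero fun i _ => ?_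
  rw [IsTestFunction.partialDeriv_eq_zero i h, zero_mul, zero_smul]

lemma hasFDerivAt_moll_proj {ρ : Cylinder n → ℝ} (hρ : IsTestFunction ρ) {f : Cylinder n → ℝ}
    (hf : LocallyIntegrable f volume) (y₀ : Vec (n + 1)) :
    HasFDerivAt (fun y => moll ρ f (proj n y))
      (∑ i, moll (partialDeriv i ρ) f (proj n y₀) •
        (EuclideanSpace.proj i : Vec (n + 1) →L[ℝ] ℝ)) y₀ := by
  obtain ⟨K, hK, hKc⟩ : ∃ K : Set (Cylinder n), (∀ y ∈ Metric.ball y₀ 1, ∀ a,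
      proj n y - a ∈ tsupport ρ → a ∈ K) ∧ IsCompact K := by
    refine ⟨(fun p : Vec (n + 1) × Cylinder n => proj n p.1 - p.2) ''
      (Metric.closedBall y₀ 1 ×ˢ tsupport ρ), fun y hy a h =>
        ⟨(y, proj n y - a), ⟨Metric.ball_subset_closedBall hy, h⟩, by simp⟩,
      ((isCompact_closedBall y₀ 1).prod hρ.compact).image
        ((continuous_proj.comp continuous_fst).sub continuous_snd)⟩
  obtain ⟨C₀, hC₀⟩ := exists_norm_mollFDeriv_le hρ f
  have hbound : ∀ a, ∀ y ∈ Metric.ball y₀ 1, ‖mollFDeriv ρ f y a‖ ≤ K.indicator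
      (fun a => C₀ * ‖f a‖) a := by
    intro a y hy
    by_cases ha : a ∈ K
    · rw [Set.indicator_of_mem ha]
      exact hC₀ y a
    · rw [Set.indicator_of_notMem ha, mollFDeriv_eq_zero, norm_zero]
      exact fun h => ha (hK y hy a h)
  have hbint : Integrable (K.indicator (fun a => C₀ * ‖f a‖)) volume := by
    rw [integrable_indicator_iff hKc.measurableSet]
    exact ((hf.integrableOn_isCompact hKc).norm).const_mul _
  have hmain := hasFDerivAt_integral_of_dominated_of_fderiv_le
    (μ := (volume : Measure (Cylinder n)))
    (F := fun y a => ρ (proj n y - a) * f a) (F' := mollFDeriv ρ f) (x₀ := y₀)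
    (s := Metric.ball y₀ 1) (Metric.ball_mem_nhds _ one_pos)
    (Eventually.of_forall fun y =>
      (integrable_moll_integrand hρ.continuous hρ.compact hf _).aestronglyMeasurable)
    (integrable_moll_integrand hρ.continuous hρ.compact hf _)
    (integrable_mollFDeriv hρ hf y₀).1.aestronglyMeasurable (Eventually.of_forall hbound) hbint
    (Eventually.of_forall fun a y _ => hasFDerivAt_mollFDeriv hρ f y a)
  rw [← (integrable_mollFDeriv hρ hf y₀).2]
  exact hmain

lemma continuous_moll {ρ : Cylinder n → ℝ} (hρ : IsTestFunction ρ) {f : Cylinder n → ℝ}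
    (hf : LocallyIntegrable f volume) : Continuous (moll ρ f) := by
  refine isOpenQuotientMap_proj.isQuotientMap.continuous_iff.2 ?_
  exact continuous_iff_continuousAt.2 fun y => (hasFDerivAt_moll_proj hρ hf y).continuousAt

lemma hasPartial_moll {ρ : Cylinder n → ℝ} (hρ : IsTestFunction ρ) {f : Cylinder n → ℝ}
    (hf : LocallyIntegrable f volume) (i : Fin (n + 1)) :
    HasPartial i (moll ρ f) (moll (partialDeriv i ρ) f) := by
  intro x
  obtain ⟨y, rfl⟩ := proj_surjective x
  have h1 := hasFDerivAt_moll_proj hρ hf (y + (0 : ℝ) • EuclideanSpace.single i (1 : ℝ))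
  have h2 : HasDerivAt (fun t : ℝ => y + t • EuclideanSpace.single i (1 : ℝ))
      (EuclideanSpace.single i (1 : ℝ)) 0 := by
    simpa using ((hasDerivAt_id (0 : ℝ)).smul_const (EuclideanSpace.single i (1 : ℝ))).const_add y
  have h3 := h1.comp_hasDerivAt (0 : ℝ) h2
  convert! h3 using 1
  · funext t
    have : EuclideanSpace.single i t = t • EuclideanSpace.single i (1 : ℝ) := by
      ext j; by_cases h : j = i <;> simp [h]
    simp only [Function.comp, dir]
    rw [proj_add, this]
  · simp [PiLp.single_apply]

/-- Weak derivatives commute with mollification. -/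
lemma _root_.IsWeakPartial.moll_partialDeriv {i : Fin (n + 1)} {f g : Cylinder n → ℝ}
    (h : IsWeakPartial i f g) {ρ : Cylinder n → ℝ} (hρ : IsTestFunction ρ) :
    moll (partialDeriv i ρ) f = moll ρ g := by
  funext x
  have h1 := h.integral_eq _ (hρ.comp_const_sub x)
  simp only [hρ.partialDeriv_comp_const_sub, mul_neg, integral_neg, neg_inj] at h1
  simp only [moll, smul_eq_mul]
  rw [show (fun y => partialDeriv i ρ (x - y) * f y) = fun y => f y * partialDeriv i ρ (x - y) from
    funext fun _ => mul_comm _ _, h1]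
  exact integral_congr_ae (Eventually.of_forall fun _ => mul_comm _ _)

lemma _root_.IsWeakPartial.hasPartial_moll {i : Fin (n + 1)} {f g : Cylinder n → ℝ}
    (h : IsWeakPartial i f g) {ρ : Cylinder n → ℝ} (hρ : IsTestFunction ρ) :
    HasPartial i (moll ρ f) (moll ρ g) := by
  rw [← h.moll_partialDeriv hρ]
  exact Cylinder.hasPartial_moll hρ h.locInt_fun i

/-- A locally integrable function whose mollifications all vanish is null. -/
lemma ae_eq_zero_of_moll_eq_zero {f : Cylinder n → ℝ} (hf : LocallyIntegrable f volume)
    (h : ∀ ρ : Cylinder n → ℝ, IsTestFunction ρ → moll ρ f = 0) : f =ᵐ[volume] 0 := by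
  obtain ⟨ρ, hρ⟩ := exists_isMollifier n
  have h1 : ∀ m : ℕ, ∀ᵐ x ∂volume.restrict (slab n (-m) m), f x = 0 := by
    intro m
    have h2 := hρ.tendsto_setLIntegral_slab (f := f) (q := 1) le_rfl (fun a b => by
      rw [ENNReal.ofReal_one, memLp_one_iff_integrable]
      exact hf.integrableOn_isCompact (isCompact_slab a b)) (-m) m
    simp only [h _ (hρ.kernel _).test, Pi.zero_apply, sub_zero, ENNReal.rpow_one] at h2
    have h3 := tendsto_nhds_unique h2 tendsto_const_nhds
    rw [eq_comm, lintegral_eq_zero_iff'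
      (hf.integrableOn_isCompact (isCompact_slab _ _)).aestronglyMeasurable.enorm] at h3
    filter_upwards [h3] with x hx
    simpa using hx
  have h2 : ∀ᵐ x : Cylinder n, ∀ m : ℕ, x ∈ slab n (-m) m → f x = 0 :=
    ae_all_iff.2 fun m => (ae_restrict_iff' (measurableSet_slab _ _)).1 (h1 m)
  filter_upwards [h2] with x hx
  obtain ⟨m, hm⟩ := exists_nat_ge |x.1|
  exact hx m (abs_le.1 hm)

/-- Weak partial derivatives are unique. -/
lemma _root_.IsWeakPartial.ae_eq {i : Fin (n + 1)} {f g g' : Cylinder n → ℝ}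
    (h : IsWeakPartial i f g) (h' : IsWeakPartial i f g') : g =ᵐ[volume] g' := by
  have h1 : LocallyIntegrable (g - g') volume := h.locInt_deriv.sub h'.locInt_deriv
  have h2 := ae_eq_zero_of_moll_eq_zero h1 fun ρ hρ => by
    have h3 : moll ρ g = moll ρ g' := by rw [← h.moll_partialDeriv hρ, h'.moll_partialDeriv hρ]
    funext x
    have h4 := congrFun h3 x
    have i1 := integrable_moll_integrand hρ.continuous hρ.compact h.locInt_deriv x
    have i2 := integrable_moll_integrand hρ.continuous hρ.compact h'.locInt_deriv x
    simp only [moll, Pi.sub_apply, smul_sub] at h4 ⊢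
    rw [integral_sub i1 i2, h4, sub_self]; rfl
  filter_upwards [h2] with x hx
  simpa [sub_eq_zero] using hx

lemma _root_.IsWeakPartial.weakPartial_ae_eq {i : Fin (n + 1)} {f g : Cylinder n → ℝ}
    (h : IsWeakPartial i f g) : weakPartial i f =ᵐ[volume] g := by
  have h0 : ∃ g, IsWeakPartial i f g := ⟨g, h⟩
  rw [weakPartial, dif_pos h0]
  exact h0.choose_spec.ae_eq h

lemma isWeakPartial_weakPartial {i : Fin (n + 1)} {f : Cylinder n → ℝ}
    (h : ∃ g, IsWeakPartial i f g) : IsWeakPartial i f (weakPartial i f) := by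
  rw [weakPartial, dif_pos h]; exact h.choose_spec

lemma moll_apply {ρ : Cylinder n → ℝ} (hρ : IsTestFunction ρ) {m : ℕ} {f : Cylinder n → Vec m}
    (hf : LocallyIntegrable f volume) (x : Cylinder n) (j : Fin m) :
    moll ρ f x j = moll ρ (fun y => f y j) x := by
  have := (EuclideanSpace.proj j : Vec m →L[ℝ] ℝ).integral_comp_comm
    (integrable_moll_integrand hρ.continuous hρ.compact hf x)
  simpa [moll] using this.symm

lemma IsKernel.moll_mem {ρ : Cylinder n → ℝ} (hρ : IsKernel ρ) [CompleteSpace E]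
    {f : Cylinder n → E} (hf : LocallyIntegrable f volume) {S : Set E} (hS : Convex ℝ S)
    (hSc : IsClosed S) (h : ∀ᵐ x, f x ∈ S) (x : Cylinder n) : moll ρ f x ∈ S := by
  have := hρ.isProbabilityMeasure
  rw [hρ.moll_eq]
  refine hS.integral_mem hSc ?_ (hρ.integrable_sub hf x)
  have h1 : ∀ᵐ y : Cylinder n, f (x - y) ∈ S :=
    (quasiMeasurePreserving_sub_left volume x).ae h
  exact (withDensity_absolutelyContinuous _ _).ae_le h1

end Cylinder

/-! ### Limits of nonlinear expressions -/

section Limits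
variable {X : Type*} [MeasurableSpace X] {μ : Measure X}

lemma eLpNorm_two_eq {E : Type*} [NormedAddCommGroup E] (f : X → E) :
    eLpNorm f 2 μ = (∫⁻ x, ‖f x‖ₑ ^ (2 : ℝ) ∂μ) ^ (1 / 2 : ℝ) := by
  rw [eLpNorm_eq_lintegral_rpow_enorm_toReal (by simp) (by simp)]
  simp

lemma tendsto_eLpNorm_two {E : Type*} [NormedAddCommGroup E] {f : X → E} {fk : ℕ → X → E}
    (h : Tendsto (fun k => ∫⁻ x, ‖f x - fk k x‖ₑ ^ (2 : ℝ) ∂μ) atTop (𝓝 0)) :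
    Tendsto (fun k => eLpNorm (fk k - f) 2 μ) atTop (𝓝 0) := by
  have h1 := ((ENNReal.continuous_rpow_const (y := (1 / 2 : ℝ))).tendsto 0).comp h
  rw [ENNReal.zero_rpow_of_pos (by norm_num)] at h1
  refine h1.congr fun k => ?_
  rw [Function.comp_apply, eLpNorm_sub_comm, eLpNorm_two_eq]
  rfl

/-- Products of `L²`-convergent sequences converge in mean. -/
lemma tendsto_integral_mul_of_tendsto_sq {f h : X → ℝ} {fk hk : ℕ → X → ℝ}
    (hf : MemLp f 2 μ) (hh : MemLp h 2 μ) (hfk : ∀ k, MemLp (fk k) 2 μ)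
    (hhk : ∀ k, MemLp (hk k) 2 μ)
    (h1 : Tendsto (fun k => ∫⁻ x, ‖f x - fk k x‖ₑ ^ (2 : ℝ) ∂μ) atTop (𝓝 0))
    (h2 : Tendsto (fun k => ∫⁻ x, ‖h x - hk k x‖ₑ ^ (2 : ℝ) ∂μ) atTop (𝓝 0)) :
    Tendsto (fun k => ∫ x, fk k x * hk k x ∂μ) atTop (𝓝 (∫ x, f x * h x ∂μ)) := by
  have key : ∀ {a b : X → ℝ} (ha : MemLp a 2 μ) (hb : MemLp b 2 μ),
      inner ℝ (ha.toLp a) (hb.toLp b) = ∫ x, a x * b x ∂μ := fun ha hb => by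
    rw [L2.inner_def]
    refine integral_congr_ae ?_
    filter_upwards [ha.coeFn_toLp, hb.coeFn_toLp] with x hx hy
    rw [hx, hy]; simp [mul_comm]
  have t1 : Tendsto (fun k => (hfk k).toLp (fk k)) atTop (𝓝 (hf.toLp f)) :=
    (Lp.tendsto_Lp_iff_tendsto_eLpNorm'' fk hfk f hf).2 (tendsto_eLpNorm_two h1)
  have t2 : Tendsto (fun k => (hhk k).toLp (hk k)) atTop (𝓝 (hh.toLp h)) :=
    (Lp.tendsto_Lp_iff_tendsto_eLpNorm'' hk hhk h hh).2 (tendsto_eLpNorm_two h2)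
  simpa only [key] using Filter.Tendsto.inner (𝕜 := ℝ) t1 t2

/-- Continuity of superposition operators `L^q → L²`: pointwise convergence and the growth bound
`|F(z)|² ≤ K (1 + |z|^q)` on the range give convergence in `L²`. -/
lemma tendsto_lintegral_superposition {E : Type*} [NormedAddCommGroup E] [IsFiniteMeasure μ]
    {u : X → E} {w : ℕ → X → E} {S : Set E} {F : E → ℝ} (hF : Continuous F) {q : ℝ} (hq : 1 ≤ q)
    {K : ℝ} (hK0 : 0 ≤ K) (hK : ∀ z ∈ S, F z ^ 2 ≤ K * (1 + ‖z‖ ^ q))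
    (hu : AEStronglyMeasurable u μ) (hw : ∀ k, AEStronglyMeasurable (w k) μ)
    (huS : ∀ᵐ x ∂μ, u x ∈ S) (hwS : ∀ k, ∀ᵐ x ∂μ, w k x ∈ S)
    (huq : ∫⁻ x, ‖u x‖ₑ ^ q ∂μ ≠ ∞)
    (hae : ∀ᵐ x ∂μ, Tendsto (fun k => w k x) atTop (𝓝 (u x)))
    (hL : Tendsto (fun k => ∫⁻ x, ‖u x - w k x‖ₑ ^ q ∂μ) atTop (𝓝 0)) :
    Tendsto (fun k => ∫⁻ x, ‖F (u x) - F (w k x)‖ₑ ^ (2 : ℝ) ∂μ) atTop (𝓝 0) := by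
  have hq0 : 0 < q := by linarith
  set C : ℝ := 2 * K * (2 + 2 ^ q) with hC
  have hC0 : 0 ≤ C := by positivity
  set a : ℕ → X → ℝ≥0∞ := fun k x => ‖F (u x) - F (w k x)‖ₑ ^ (2 : ℝ) with ha
  set b : ℕ → X → ℝ≥0∞ := fun k x => ENNReal.ofReal C * ‖u x - w k x‖ₑ ^ q with hb
  set G : X → ℝ≥0∞ := fun x => ENNReal.ofReal C * (1 + ‖u x‖ₑ ^ q) with hG
  have hpt : ∀ k, ∀ᵐ x ∂μ, a k x ≤ G x + b k x := by
    intro k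
    filter_upwards [huS, hwS k] with x hx hy
    have e1 : a k x = ENNReal.ofReal ((F (u x) - F (w k x)) ^ 2) := by
      simp only [ha]
      rw [Real.enorm_eq_ofReal_abs, ENNReal.ofReal_rpow_of_nonneg (abs_nonneg _) (by norm_num)]
      norm_num
    have e2 : G x + b k x = ENNReal.ofReal (C * (1 + ‖u x‖ ^ q) + C * ‖u x - w k x‖ ^ q) := by
      simp only [hG, hb]
      rw [ENNReal.ofReal_add (by positivity) (by positivity), ENNReal.ofReal_mul hC0,
        ENNReal.ofReal_mul hC0, ENNReal.ofReal_add zero_le_one (by positivity),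
        ← ENNReal.ofReal_rpow_of_nonneg (norm_nonneg _) hq0.le,
        ← ENNReal.ofReal_rpow_of_nonneg (norm_nonneg _) hq0.le, ofReal_norm, ofReal_norm,
        ENNReal.ofReal_one]
    rw [e1, e2]
    refine ENNReal.ofReal_le_ofReal ?_
    have h1 := hK _ hx
    have h2 := hK _ hy
    have h3 : ‖w k x‖ ^ q ≤ 2 ^ q * (‖u x‖ ^ q + ‖u x - w k x‖ ^ q) := by
      have h4 : ‖w k x‖ ≤ 2 * max ‖u x‖ ‖u x - w k x‖ := by
        have : ‖w k x‖ ≤ ‖u x‖ + ‖u x - w k x‖ := by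
          have := norm_sub_le (u x) (u x - w k x)
          simpa using this
        linarith [le_max_left ‖u x‖ ‖u x - w k x‖, le_max_right ‖u x‖ ‖u x - w k x‖]
      calc ‖w k x‖ ^ q ≤ (2 * max ‖u x‖ ‖u x - w k x‖) ^ q :=
            Real.rpow_le_rpow (norm_nonneg _) h4 hq0.le
        _ = 2 ^ q * (max ‖u x‖ ‖u x - w k x‖) ^ q :=
            Real.mul_rpow (by norm_num) (le_max_of_le_left (norm_nonneg _))
        _ ≤ 2 ^ q * (‖u x‖ ^ q + ‖u x - w k x‖ ^ q) := by
            gcongr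
            have p1 : 0 ≤ ‖u x‖ ^ q := by positivity
            have p2 : 0 ≤ ‖u x - w k x‖ ^ q := by positivity
            rcases max_choice ‖u x‖ ‖u x - w k x‖ with h | h <;> rw [h] <;> linarith
    have p0 : (0 : ℝ) ≤ 2 ^ q := by positivity
    have p1 : 0 ≤ ‖u x‖ ^ q := by positivity
    have p2 : 0 ≤ ‖u x - w k x‖ ^ q := by positivity
    have h5 : (F (u x) - F (w k x)) ^ 2 ≤ 2 * (F (u x) ^ 2 + F (w k x) ^ 2) := by
      nlinarith [sq_nonneg (F (u x) + F (w k x))]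
    have h6 : K * (1 + ‖w k x‖ ^ q) ≤ K * (1 + 2 ^ q * (‖u x‖ ^ q + ‖u x - w k x‖ ^ q)) := by
      gcongr
    have h7 : 0 ≤ K * 2 ^ q := by positivity
    have h8 : 0 ≤ K * ‖u x‖ ^ q := by positivity
    have h9 : 0 ≤ K * ‖u x - w k x‖ ^ q := by positivity
    rw [hC]
    nlinarith
  have ham : ∀ k, AEMeasurable (a k) μ := fun k =>
    ((hF.comp_aestronglyMeasurable hu).sub
      (hF.comp_aestronglyMeasurable (hw k))).enorm.pow_const _
  have hbm : ∀ k, AEMeasurable (b k) μ := fun k =>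
    ((hu.sub (hw k)).enorm.pow_const _).const_mul _
  have hint : ∫⁻ x, G x ∂μ ≠ ∞ := by
    simp only [hG]
    rw [lintegral_const_mul' _ _ ENNReal.ofReal_ne_top, lintegral_add_left measurable_const]
    refine ENNReal.mul_ne_top ENNReal.ofReal_ne_top (ENNReal.add_ne_top.2 ⟨?_, huq⟩)
    simp
  -- the part of the bound on `a k` that depends on `k` is subtracted before dominated convergence
  have h1 : Tendsto (fun k => ∫⁻ x, (a k x - b k x) ∂μ) atTop (𝓝 (∫⁻ _, 0 ∂μ)) := by
    refine tendsto_lintegral_of_dominated_convergence' G (fun k => (ham k).sub (hbm k)) ?_ hint ?_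
    · intro k
      filter_upwards [hpt k] with x hx
      exact tsub_le_iff_right.2 hx
    · filter_upwards [hae] with x hx
      have h2 : Tendsto (fun k => a k x) atTop (𝓝 0) := by
        have h3 : Tendsto (fun k => F (u x) - F (w k x)) atTop (𝓝 0) := by
          have := ((hF.tendsto _).comp hx).const_sub (F (u x))
          simpa using this
        have h4 := ((ENNReal.continuous_rpow_const (y := (2 : ℝ))).tendsto _).comp h3.enorm
        rw [enorm_zero, ENNReal.zero_rpow_of_pos (by norm_num)] at h4
        exact h4
      exact tendsto_of_tendsto_of_tendsto_of_le_of_le tendsto_const_nhds h2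
        (fun _ => zero_le) fun _ => tsub_le_self
  have h2 : Tendsto (fun k => ∫⁻ x, b k x ∂μ) atTop (𝓝 0) := by
    simp only [hb]
    simp_rw [lintegral_const_mul' _ _ ENNReal.ofReal_ne_top]
    have := ENNReal.Tendsto.const_mul hL (a := ENNReal.ofReal C) (Or.inr ENNReal.ofReal_ne_top)
    simpa using this
  have h3 := h1.add h2
  simp only [lintegral_zero, add_zero] at h3
  refine tendsto_of_tendsto_of_tendsto_of_le_of_le tendsto_const_nhds h3
    (fun _ => zero_le) fun k => ?_
  change ∫⁻ x, a k x ∂μ ≤ _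
  rw [← lintegral_add_right' _ (hbm k)]
  exact lintegral_mono fun x => le_tsub_add

/-- A `C¹` map with `|DΦ(z)|² ≤ K (1 + |z|^q)` satisfies an `L¹`-estimate for differences. -/
lemma lintegral_sub_le_of_fderiv_growth {E F : Type*} [NormedAddCommGroup E] [NormedSpace ℝ E]
    [NormedAddCommGroup F] [NormedSpace ℝ F]
    {Φ : E → F} (hΦ : Differentiable ℝ Φ) {S : Set E} (hS : Convex ℝ S) {K q : ℝ} (hK0 : 0 ≤ K)
    (hq : 0 < q) (hK : ∀ z ∈ S, ‖fderiv ℝ Φ z‖ ^ 2 ≤ K * (1 + ‖z‖ ^ q))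
    {v w : X → E} (hv : AEStronglyMeasurable v μ) (hw : AEStronglyMeasurable w μ)
    (hvS : ∀ᵐ x ∂μ, v x ∈ S) (hwS : ∀ᵐ x ∂μ, w x ∈ S) :
    ∫⁻ x, ‖Φ (v x) - Φ (w x)‖ₑ ∂μ ≤ (∫⁻ x, ‖v x - w x‖ₑ ^ (2 : ℝ) ∂μ) ^ (1 / 2 : ℝ) *
      (∫⁻ x, ENNReal.ofReal K * (1 + ‖v x‖ₑ ^ q + ‖w x‖ₑ ^ q) ∂μ) ^ (1 / 2 : ℝ) := by
  set b : X → ℝ≥0∞ := fun x => (ENNReal.ofReal K * (1 + ‖v x‖ₑ ^ q + ‖w x‖ₑ ^ q)) ^ (1 / 2 : ℝ)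
    with hb
  have hpt : ∀ᵐ x ∂μ, ‖Φ (v x) - Φ (w x)‖ₑ ≤ ‖v x - w x‖ₑ * b x := by
    filter_upwards [hvS, hwS] with x hx hy
    set B : ℝ := K * (1 + ‖v x‖ ^ q + ‖w x‖ ^ q) with hB
    have hB0 : 0 ≤ B := by positivity
    have e1 : b x = ENNReal.ofReal (Real.sqrt B) := by
      simp only [hb, hB]
      rw [Real.sqrt_eq_rpow, ← ENNReal.ofReal_rpow_of_nonneg (by positivity) (by norm_num),
        ENNReal.ofReal_mul hK0, ENNReal.ofReal_add (by positivity) (by positivity),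
        ENNReal.ofReal_add (by positivity) (by positivity),
        ← ENNReal.ofReal_rpow_of_nonneg (norm_nonneg _) hq.le,
        ← ENNReal.ofReal_rpow_of_nonneg (norm_nonneg _) hq.le, ofReal_norm, ofReal_norm,
        ENNReal.ofReal_one]
    have h1 : ∀ z ∈ segment ℝ (w x) (v x), ‖fderiv ℝ Φ z‖ ≤ Real.sqrt B := by
      intro z hz
      refine Real.le_sqrt_of_sq_le ((hK z (hS.segment_subset hy hx hz)).trans ?_)
      rw [hB, add_assoc]
      refine mul_le_mul_of_nonneg_left (add_le_add le_rfl ?_) hK0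
      have h2 : ‖z‖ ≤ max ‖w x‖ ‖v x‖ :=
        (convexOn_univ_norm (E := E)).le_on_segment trivial trivial hz
      have p1 : 0 ≤ ‖v x‖ ^ q := by positivity
      have p2 : 0 ≤ ‖w x‖ ^ q := by positivity
      refine (Real.rpow_le_rpow (norm_nonneg _) h2 hq.le).trans ?_
      rcases max_choice ‖w x‖ ‖v x‖ with h | h <;> rw [h] <;> linarith
    have h2 := (convex_segment (w x) (v x)).norm_image_sub_le_of_norm_fderiv_le
      (fun z _ => hΦ z) h1 (left_mem_segment ℝ _ _) (right_mem_segment ℝ _ _)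
    rw [e1, ← ofReal_norm, ← ofReal_norm, ← ENNReal.ofReal_mul (norm_nonneg _)]
    exact ENNReal.ofReal_le_ofReal (h2.trans_eq (mul_comm _ _))
  have hbm : AEMeasurable b μ := by
    refine AEMeasurable.pow_const ?_ _
    exact ((aemeasurable_const.add (hv.enorm.pow_const _)).add (hw.enorm.pow_const _)).const_mul _
  refine (lintegral_mono_ae hpt).trans ?_
  refine (ENNReal.lintegral_mul_le_Lp_mul_Lq μ Real.HolderConjugate.two_two
    (hv.sub hw).enorm hbm).trans (le_of_eq ?_)
  have e2 : ∀ x, b x ^ (2 : ℝ) = ENNReal.ofReal K * (1 + ‖v x‖ₑ ^ q + ‖w x‖ₑ ^ q) := fun x => by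
    simp only [hb]
    rw [← ENNReal.rpow_mul]; norm_num
  simp only [e2]
  rfl

end Limits

/-! ### Cutoff functions in the unbounded variable -/

/-- A `C¹` cutoff `χ`, with derivative `χ'`, supported in `[a, b]`. -/
structure IsCutoff (a b : ℝ) (χ χ' : ℝ → ℝ) : Prop where
  hasDerivAt : ∀ t, HasDerivAt χ (χ' t) t
  continuous_deriv : Continuous χ'
  eq_zero : ∀ t, t ∉ Set.Icc a b → χ t = 0
  deriv_eq_zero : ∀ t, t ∉ Set.Icc a b → χ' t = 0

namespace IsCutoff
variable {n : ℕ} {a b : ℝ} {χ χ' : ℝ → ℝ}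

lemma continuous (h : IsCutoff a b χ χ') : Continuous χ :=
  continuous_iff_continuousAt.2 fun t => (h.hasDerivAt t).continuousAt

lemma hasCompactSupport_mul {c : ℝ → ℝ} (h : ∀ t, t ∉ Set.Icc a b → c t = 0)
    (H : Cylinder n → ℝ) : HasCompactSupport fun x : Cylinder n => c x.1 * H x :=
  HasCompactSupport.intro (isCompact_slab a b) fun x hx => by
    rw [h x.1 hx, zero_mul]

lemma integral_mul_hasPartial (h : IsCutoff a b χ χ') {i : Fin (n + 1)} {H H' : Cylinder n → ℝ}
    (hH : HasPartial i H H') (hc : Continuous H) (hc' : Continuous H') :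
    ∫ x, χ x.1 * H' x = if i = 0 then -∫ x, χ' x.1 * H x else 0 := by
  have h1 : HasPartial i (fun x : Cylinder n => χ x.1 * H x)
      (fun x => (if i = 0 then χ' x.1 * H x else 0) + χ x.1 * H' x) := by
    intro x
    by_cases hi : i = 0
    · have e : ∀ t, (x + dir i t).1 = x.1 + t := fun t => by simp [dir_fst, hi]
      simp only [e, if_pos hi]
      have h2 : HasDerivAt (fun t => χ (x.1 + t)) (χ' x.1) 0 := by
        have := h.hasDerivAt (x.1 + 0)
        rw [add_zero] at this
        exact HasDerivAt.comp_const_add x.1 0 (by simpa using this)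
      have h3 := h2.mul (hH x)
      simp only [dir_zero, add_zero] at h3
      exact h3
    · have e : ∀ t, (x + dir i t).1 = x.1 := fun t => by simp [dir_fst, hi]
      simp only [e, if_neg hi, zero_add]
      exact (hH x).const_mul _
  have c1 : Continuous fun x : Cylinder n => χ x.1 := h.continuous.comp continuous_fst
  have c2 : Continuous fun x : Cylinder n => χ' x.1 := h.continuous_deriv.comp continuous_fst
  have s2 := hasCompactSupport_mul h.deriv_eq_zero H
  have s1 := hasCompactSupport_mul h.eq_zero H'
  have i1 : Integrable (fun x : Cylinder n => χ x.1 * H' x) volume :=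
    (c1.mul hc').integrable_of_hasCompactSupport s1
  by_cases hi : i = 0
  · simp only [if_pos hi] at h1 ⊢
    have h3 := h1.integral_eq_zero (c1.mul hc) ((c2.mul hc).add (c1.mul hc'))
      (hasCompactSupport_mul h.eq_zero H) (s2.add s1)
    have i2 : Integrable (fun x : Cylinder n => χ' x.1 * H x) volume :=
      (c2.mul hc).integrable_of_hasCompactSupport s2
    rw [integral_add i2 i1] at h3
    linarith
  · simp only [if_neg hi, zero_add] at h1 ⊢
    exact h1.integral_eq_zero (c1.mul hc) (c1.mul hc') (hasCompactSupport_mul h.eq_zero H) s1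

end IsCutoff

lemma hasDerivAt_vec {m : ℕ} {f : ℝ → Vec m} {f' : Vec m} {t : ℝ}
    (h : ∀ j, HasDerivAt (fun s => f s j) (f' j) t) : HasDerivAt f f' t :=
  HasFDerivAt.comp_hasDerivAt (f := fun s => (f s).ofLp) t
    (PiLp.hasFDerivAt_toLp (𝕜 := ℝ) 2 (f t).ofLp) (hasDerivAt_pi.2 h)

/-! ### Solenoidal fields and their mollifications -/

/-- `u ∈ H¹_loc` is divergence free with gradient `gᵢⱼ = ∂ᵢ uⱼ` in `L²`. -/
structure IsSolenoidal {n : ℕ} (u : Cylinder n → Vec (n + 1))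
    (g : Fin (n + 1) → Fin (n + 1) → Cylinder n → ℝ) : Prop where
  memLp_slab : ∀ a b, MemLp u 2 (volume.restrict (slab n a b))
  weak : ∀ i j, IsWeakPartial i (fun x => u x j) (g i j)
  memLp_grad : ∀ i j, MemLp (g i j) 2 volume
  div_free : ∀ᵐ x ∂(volume : Measure (Cylinder n)), ∑ i, g i i x = 0

lemma MemHDotOneDiv.isSolenoidal {n : ℕ} {u : Cylinder n → Vec (n + 1)} (h : MemHDotOneDiv u) :
    IsSolenoidal u fun i j => weakPartial i fun x => u x j where
  memLp_slab a b := h.memLp_loc _ (isCompact_slab a b)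
  weak i j := isWeakPartial_weakPartial (h.weak_diff i j)
  memLp_grad := h.memLp_grad
  div_free := h.div_free

lemma Cylinder.locallyIntegrable_of_slab {n : ℕ} {E : Type*} [NormedAddCommGroup E]
    {f : Cylinder n → E} (h : ∀ a b, MemLp f 2 (volume.restrict (slab n a b))) :
    LocallyIntegrable f volume := by
  intro x
  refine ⟨slab n (x.1 - 1) (x.1 + 1), ?_, (h _ _).integrable (by norm_num)⟩
  exact continuous_fst.continuousAt.preimage_mem_nhds (Icc_mem_nhds (by linarith) (by linarith))

lemma Continuous.memLp_slab {n : ℕ} {E : Type*} [NormedAddCommGroup E] [SecondCountableTopology E]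
    {f : Cylinder n → E} (hf : Continuous f) (p : ℝ≥0∞) (a b : ℝ) :
    MemLp f p (volume.restrict (slab n a b)) := by
  obtain ⟨C, hC⟩ := (isCompact_slab (n := n) a b).exists_bound_of_continuousOn hf.continuousOn
  exact MemLp.of_bound hf.aestronglyMeasurable C
    ((ae_restrict_iff' (measurableSet_slab a b)).2 (Eventually.of_forall hC))

namespace IsSolenoidal
variable {n : ℕ} {u : Cylinder n → Vec (n + 1)} {g : Fin (n + 1) → Fin (n + 1) → Cylinder n → ℝ}
  {ρ : Cylinder n → ℝ}

lemma locallyIntegrable (h : IsSolenoidal u g) : LocallyIntegrable u volume :=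
  locallyIntegrable_of_slab h.memLp_slab

lemma hasPartial_moll (h : IsSolenoidal u g) (hρ : IsTestFunction ρ) (i j : Fin (n + 1)) :
    HasPartial i (fun x => moll ρ u x j) (moll ρ (g i j)) := by
  have : (fun x => moll ρ u x j) = moll ρ (fun x => u x j) :=
    funext fun x => moll_apply hρ h.locallyIntegrable x j
  rw [this]
  exact (h.weak i j).hasPartial_moll hρ

lemma continuous_moll_apply (h : IsSolenoidal u g) (hρ : IsTestFunction ρ) (j : Fin (n + 1)) :
    Continuous (fun x => moll ρ u x j) := by
  have : (fun x => moll ρ u x j) = moll ρ (fun x => u x j) :=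
    funext fun x => moll_apply hρ h.locallyIntegrable x j
  rw [this]
  exact Cylinder.continuous_moll hρ (h.weak 0 j).locInt_fun

lemma continuous_moll (h : IsSolenoidal u g) (hρ : IsTestFunction ρ) : Continuous (moll ρ u) :=
  (PiLp.continuous_toLp 2 _).comp (continuous_pi fun j => h.continuous_moll_apply hρ j)

lemma continuous_moll_grad (h : IsSolenoidal u g) (hρ : IsTestFunction ρ) (i j : Fin (n + 1)) :
    Continuous (moll ρ (g i j)) := Cylinder.continuous_moll hρ (h.weak i j).locInt_deriv

lemma sum_moll_diag (h : IsSolenoidal u g) (hρ : IsTestFunction ρ) (x : Cylinder n) :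
    ∑ i, moll ρ (g i i) x = 0 := by
  simp only [moll]
  rw [← integral_finsetSum _ fun i _ => integrable_moll_integrand hρ.continuous hρ.compact
    (h.weak i i).locInt_deriv x]
  refine integral_eq_zero_of_ae (h.div_free.mono fun y hy => ?_)
  simp only [← Finset.smul_sum, hy, smul_zero, Pi.zero_apply]

/-- The second derivatives of a mollified solenoidal field satisfy `∑ᵢ ∂ᵢ ∂ⱼ wᵢ = 0`. -/
lemma sum_moll_partialDeriv (h : IsSolenoidal u g) (hρ : IsTestFunction ρ) (j : Fin (n + 1))
    (x : Cylinder n) : ∑ i, moll (partialDeriv i ρ) (g j i) x = 0 := by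
  rw [← h.sum_moll_diag (hρ.partialDeriv j) x]
  refine Finset.sum_congr rfl fun i _ => ?_
  rw [← (h.weak j i).moll_partialDeriv (hρ.partialDeriv i),
    ← (h.weak i i).moll_partialDeriv (hρ.partialDeriv j), hρ.partialDeriv_comm]

lemma hasPartial_comp (h : IsSolenoidal u g) (hρ : IsTestFunction ρ)
    {Φ : Vec (n + 1) → Vec (n + 1)} (hΦ : ContDiff ℝ 1 Φ) (i k : Fin (n + 1)) :
    HasPartial i (fun x => Φ (moll ρ u x) k)
      (fun x => ∑ j, jac Φ j k (moll ρ u x) * moll ρ (g i j) x) := by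
  intro x
  have h1 : HasDerivAt (fun t => moll ρ u (x + dir i t))
      (WithLp.toLp 2 fun j => moll ρ (g i j) x) 0 :=
    hasDerivAt_vec fun j => h.hasPartial_moll hρ i j x
  have h2 : HasFDerivAt Φ (fderiv ℝ Φ (moll ρ u x)) (moll ρ u (x + dir i 0)) := by
    rw [dir_zero, add_zero]
    exact (hΦ.differentiable one_ne_zero _).hasFDerivAt
  have h3 := (EuclideanSpace.proj k : Vec (n + 1) →L[ℝ] ℝ).hasFDerivAt.comp_hasDerivAt (0 : ℝ)
    (h2.comp_hasDerivAt (0 : ℝ) h1)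
  convert! h3 using 1
  have e : (WithLp.toLp 2 fun j => moll ρ (g i j) x : Vec (n + 1)) =
      ∑ j, moll ρ (g i j) x • EuclideanSpace.single j (1 : ℝ) := by
    ext l; simp [Pi.single_apply]
  rw [e, map_sum]
  simp [jac, mul_comm]

lemma continuous_jac {Φ : Vec (n + 1) → Vec (n + 1)} (hΦ : ContDiff ℝ 1 Φ) (i j : Fin (n + 1)) :
    Continuous (jac Φ i j) := by
  have h1 : Continuous (fun z => fderiv ℝ Φ z (EuclideanSpace.single i 1)) :=
    (hΦ.continuous_fderiv one_ne_zero).clm_apply continuous_const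
  exact (EuclideanSpace.proj j : Vec (n + 1) →L[ℝ] ℝ).continuous.comp h1

end IsSolenoidal

/-! ### The calibration and trace identities -/

/-- The off-diagonal part of the Jacobian. -/
def offDiag {d : ℕ} (Φ : Vec d → Vec d) (i j : Fin d) (z : Vec d) : ℝ :=
  if i = j then 0 else jac Φ i j z

/-- `Φ` is `C¹` with `|DΦ(z)|² ≤ K (1 + |z|^q)`, `q ≥ 2`, on a closed convex set `S`. -/
structure HasGrowthOn {d : ℕ} (Φ : Vec d → Vec d) (S : Set (Vec d)) (K q : ℝ) : Prop where
  contDiff : ContDiff ℝ 1 Φ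
  convex : Convex ℝ S
  isClosed : IsClosed S
  two_le : 2 ≤ q
  nonneg : 0 ≤ K
  bound : ∀ z ∈ S, ‖fderiv ℝ Φ z‖ ^ 2 ≤ K * (1 + ‖z‖ ^ q)

lemma abs_jac_le {d : ℕ} (Φ : Vec d → Vec d) (i j : Fin d) (z : Vec d) :
    |jac Φ i j z| ≤ ‖fderiv ℝ Φ z‖ := by
  have h1 : ‖fderiv ℝ Φ z (EuclideanSpace.single i 1) j‖ ≤
      ‖fderiv ℝ Φ z (EuclideanSpace.single i 1)‖ := PiLp.norm_apply_le _ _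
  have h2 := (fderiv ℝ Φ z).le_opNorm (EuclideanSpace.single i 1)
  simp only [PiLp.norm_single, norm_one, mul_one] at h2
  exact h1.trans h2

lemma abs_offDiag_le {d : ℕ} (Φ : Vec d → Vec d) (i j : Fin d) (z : Vec d) :
    |offDiag Φ i j z| ≤ ‖fderiv ℝ Φ z‖ := by
  unfold offDiag
  split_ifs
  · simp
  · exact abs_jac_le Φ i j z

lemma continuous_offDiag {n : ℕ} {Φ : Vec (n + 1) → Vec (n + 1)} (hΦ : ContDiff ℝ 1 Φ)
    (i j : Fin (n + 1)) : Continuous (offDiag Φ i j) := by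
  unfold offDiag
  split_ifs
  · exact continuous_const
  · exact IsSolenoidal.continuous_jac hΦ i j

lemma HasGrowthOn.offDiag_sq_le {d : ℕ} {Φ : Vec d → Vec d} {S : Set (Vec d)} {K q : ℝ}
    (h : HasGrowthOn Φ S K q) (i j : Fin d) : ∀ z ∈ S, offDiag Φ i j z ^ 2 ≤ K * (1 + ‖z‖ ^ q) := by
  intro z hz
  refine le_trans ?_ (h.bound z hz)
  rw [← sq_abs]
  exact pow_le_pow_left₀ (abs_nonneg _) (abs_offDiag_le Φ i j z) 2

namespace Cylinder

lemma integral_eq_setIntegral_slab {n : ℕ} {a b : ℝ} {c : ℝ → ℝ}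
    (hc : ∀ t, t ∉ Set.Icc a b → c t = 0) (G : Cylinder n → ℝ) :
    ∫ x, c x.1 * G x = ∫ x in slab n a b, c x.1 * G x :=
  (setIntegral_eq_integral_of_forall_compl_eq_zero fun x hx => by rw [hc x.1 hx, zero_mul]).symm

lemma exists_abs_le_of_eq_zero {a b : ℝ} {c : ℝ → ℝ} (hcc : Continuous c)
    (hc : ∀ t, t ∉ Set.Icc a b → c t = 0) : ∃ C, ∀ t, |c t| ≤ C :=
  (HasCompactSupport.intro isCompact_Icc hc).exists_bound_of_continuous hcc

end Cylinder

lemma lintegral_sq_mul_le {X : Type*} [MeasurableSpace X] {μ : Measure X} {c f f' : X → ℝ} {C : ℝ}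
    (hC : ∀ x, |c x| ≤ C) :
    ∫⁻ x, ‖c x * f x - c x * f' x‖ₑ ^ (2 : ℝ) ∂μ ≤
      ENNReal.ofReal C ^ (2 : ℝ) * ∫⁻ x, ‖f x - f' x‖ₑ ^ (2 : ℝ) ∂μ := by
  rw [← lintegral_const_mul' _ _
    (ENNReal.rpow_ne_top_of_nonneg (by norm_num) ENNReal.ofReal_ne_top)]
  refine lintegral_mono fun x => ?_
  rw [← mul_sub, enorm_mul, ENNReal.mul_rpow_of_nonneg _ _ (by norm_num)]
  gcongr
  rw [Real.enorm_eq_ofReal_abs]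
  exact ENNReal.ofReal_le_ofReal (hC x)

lemma tendsto_lintegral_sq_mul {X : Type*} [MeasurableSpace X] {μ : Measure X} {c f : X → ℝ}
    {fk : ℕ → X → ℝ} {C : ℝ} (hC : ∀ x, |c x| ≤ C)
    (h : Tendsto (fun k => ∫⁻ x, ‖f x - fk k x‖ₑ ^ (2 : ℝ) ∂μ) atTop (𝓝 0)) :
    Tendsto (fun k => ∫⁻ x, ‖c x * f x - c x * fk k x‖ₑ ^ (2 : ℝ) ∂μ) atTop (𝓝 0) := by
  have h1 := ENNReal.Tendsto.const_mul h (a := ENNReal.ofReal C ^ (2 : ℝ))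
    (Or.inr (ENNReal.rpow_ne_top_of_nonneg (by norm_num) ENNReal.ofReal_ne_top))
  rw [mul_zero] at h1
  exact tendsto_of_tendsto_of_tendsto_of_le_of_le tendsto_const_nhds h1 (fun _ => zero_le)
    fun k => lintegral_sq_mul_le hC

namespace IsSolenoidal
variable {n : ℕ} {u : Cylinder n → Vec (n + 1)} {g : Fin (n + 1) → Fin (n + 1) → Cylinder n → ℝ}
  {a b : ℝ}

lemma lintegral_rpow_ne_top {E : Type*} [NormedAddCommGroup E] {f : Cylinder n → E}
    {μ : Measure (Cylinder n)} {q : ℝ} (hq : 0 < q) (hf : MemLp f (ENNReal.ofReal q) μ) :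
    ∫⁻ x, ‖f x‖ₑ ^ q ∂μ ≠ ∞ := by
  have h2 := hf.2
  rw [eLpNorm_lt_top_iff_lintegral_rpow_enorm_lt_top (by simpa using hq) ENNReal.ofReal_ne_top,
    ENNReal.toReal_ofReal hq.le] at h2
  exact h2.ne

/-- Along a suitable mollifier, the mollifications converge almost everywhere on a slab. -/
lemma exists_isMollifier_ae (h : IsSolenoidal u g) (a b : ℝ) :
    ∃ ρ : ℕ → Cylinder n → ℝ, IsMollifier ρ ∧
      ∀ᵐ x ∂volume.restrict (slab n a b), Tendsto (fun k => moll (ρ k) u x) atTop (𝓝 (u x)) := by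
  obtain ⟨ρ, hρ⟩ := exists_isMollifier n
  have h1 := hρ.tendsto_setLIntegral_slab (f := u) (q := 2) (by norm_num)
    (fun a b => by simpa using h.memLp_slab a b) a b
  have h2 := tendstoInMeasure_of_tendsto_eLpNorm (p := 2) (by norm_num)
    (fun k => (h.continuous_moll (hρ.kernel k).test).aestronglyMeasurable)
    (h.memLp_slab a b).1 (tendsto_eLpNorm_two h1)
  obtain ⟨σ, hσ, hae⟩ := h2.exists_seq_tendsto_ae
  exact ⟨fun k => ρ (σ k), hρ.comp hσ.tendsto_atTop, hae⟩

lemma tendsto_moll_grad (h : IsSolenoidal u g) {ρ : ℕ → Cylinder n → ℝ} (hρ : IsMollifier ρ)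
    (i j : Fin (n + 1)) (a b : ℝ) :
    Tendsto (fun k => ∫⁻ x in slab n a b, ‖g i j x - moll (ρ k) (g i j) x‖ₑ ^ (2 : ℝ))
      atTop (𝓝 0) :=
  hρ.tendsto_setLIntegral_slab (by norm_num)
    (fun a b => by simpa using (h.memLp_grad i j).restrict (slab n a b)) a b

lemma memLp_superposition {Φ : Vec (n + 1) → ℝ} (hF : Continuous Φ) {S : Set (Vec (n + 1))}
    {K q : ℝ} (hq : 0 < q) (hK : ∀ z ∈ S, Φ z ^ 2 ≤ K * (1 + ‖z‖ ^ q))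
    {μ : Measure (Cylinder n)} [IsFiniteMeasure μ] (huS : ∀ᵐ x ∂μ, u x ∈ S)
    (huq : MemLp u (ENNReal.ofReal q) μ) :
    MemLp (fun x => Φ (u x)) 2 μ := by
  refine (memLp_two_iff_integrable_sq (hF.comp_aestronglyMeasurable huq.1)).2 ?_
  have h1 : Integrable (fun x => K * (1 + ‖u x‖ ^ q)) μ := by
    refine Integrable.const_mul (Integrable.add (integrable_const _) ?_) K
    have := huq.integrable_norm_rpow (by simpa using hq) ENNReal.ofReal_ne_top
    rwa [ENNReal.toReal_ofReal hq.le] at this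
  refine h1.mono' ((hF.comp_aestronglyMeasurable huq.1).pow 2) ?_
  filter_upwards [huS] with x hx
  rw [Real.norm_of_nonneg (sq_nonneg _)]
  exact hK _ hx

/-- The quadratic terms of the calibration identity pass to the limit. -/
lemma tendsto_integral_superposition_mul_grad (h : IsSolenoidal u g) {F : Vec (n + 1) → ℝ}
    (hF : Continuous F) {S : Set (Vec (n + 1))} (hS : Convex ℝ S) (hSc : IsClosed S)
    {K q : ℝ} (hK0 : 0 ≤ K) (hq : 2 ≤ q) (hK : ∀ z ∈ S, F z ^ 2 ≤ K * (1 + ‖z‖ ^ q))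
    (huS : ∀ᵐ x, u x ∈ S)
    (huq : ∀ a b, MemLp u (ENNReal.ofReal q) (volume.restrict (slab n a b)))
    {c : ℝ → ℝ} (hcc : Continuous c) (hc : ∀ t, t ∉ Set.Icc a b → c t = 0)
    {ρ : ℕ → Cylinder n → ℝ} (hρ : IsMollifier ρ)
    (hae : ∀ᵐ x ∂volume.restrict (slab n a b), Tendsto (fun k => moll (ρ k) u x) atTop (𝓝 (u x)))
    (i j : Fin (n + 1)) :
    Tendsto (fun k => ∫ x, c x.1 * (F (moll (ρ k) u x) * moll (ρ k) (g i j) x)) atTop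
      (𝓝 (∫ x, c x.1 * (F (u x) * g i j x))) := by
  obtain ⟨C, hC⟩ := exists_abs_le_of_eq_zero hcc hc
  simp only [integral_eq_setIntegral_slab hc]
  simp only [← mul_assoc]
  have hcm : Continuous fun x : Cylinder n => c x.1 := hcc.comp continuous_fst
  have huS' : ∀ᵐ x ∂volume.restrict (slab n a b), u x ∈ S := ae_restrict_of_ae huS
  have hwc : ∀ k, Continuous (moll (ρ k) u) := fun k => h.continuous_moll (hρ.kernel k).test
  refine tendsto_integral_mul_of_tendsto_sq ?_ ((h.memLp_grad i j).restrict _) ?_ ?_ ?_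
    (h.tendsto_moll_grad hρ i j a b)
  · have h1 := memLp_superposition hF (by linarith) hK huS' (huq a b)
    exact h1.mul (p := ∞) (q := 2) (r := 2)
      (MemLp.of_bound hcm.aestronglyMeasurable C (Eventually.of_forall fun x => hC x.1))
  · exact fun k => (hcm.mul (hF.comp (hwc k))).memLp_slab 2 a b
  · exact fun k => (h.continuous_moll_grad (hρ.kernel k).test i j).memLp_slab 2 a b
  · refine tendsto_lintegral_sq_mul (fun x => hC x.1) ?_
    refine tendsto_lintegral_superposition hF (by linarith) hK0 hK (huq a b).1
      (fun k => (hwc k).aestronglyMeasurable) huS'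
      (fun k => Eventually.of_forall fun x =>
        (hρ.kernel k).moll_mem h.locallyIntegrable hS hSc huS x) ?_ hae
      (hρ.tendsto_setLIntegral_slab (by linarith) huq a b)
    exact lintegral_rpow_ne_top (by linarith) (huq a b)

/-- The flux term of the calibration identity passes to the limit. -/
lemma tendsto_integral_flux (h : IsSolenoidal u g) {Φ : Vec (n + 1) → Vec (n + 1)}
    {S : Set (Vec (n + 1))} {K q : ℝ} (hΦ : HasGrowthOn Φ S K q)
    (huS : ∀ᵐ x, u x ∈ S)
    (huq : ∀ a b, MemLp u (ENNReal.ofReal q) (volume.restrict (slab n a b)))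
    {c : ℝ → ℝ} (hcc : Continuous c) (hc : ∀ t, t ∉ Set.Icc a b → c t = 0)
    {ρ : ℕ → Cylinder n → ℝ} (hρ : IsMollifier ρ) (j : Fin (n + 1)) :
    Tendsto (fun k => ∫ x, c x.1 * Φ (moll (ρ k) u x) j) atTop
      (𝓝 (∫ x, c x.1 * Φ (u x) j)) := by
  obtain ⟨C, hC⟩ := exists_abs_le_of_eq_zero hcc hc
  have hq2 := hΦ.two_le
  have hq0 : 0 < q := by linarith
  simp only [integral_eq_setIntegral_slab hc]
  have hcm : Continuous fun x : Cylinder n => c x.1 := hcc.comp continuous_fst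
  have huS' : ∀ᵐ x ∂volume.restrict (slab n a b), u x ∈ S := ae_restrict_of_ae huS
  have hwc : ∀ k, Continuous (moll (ρ k) u) := fun k => h.continuous_moll (hρ.kernel k).test
  have hΦc := hΦ.contDiff.continuous
  have hΦj : Continuous fun z => Φ z j :=
    (EuclideanSpace.proj j : Vec (n + 1) →L[ℝ] ℝ).continuous.comp hΦc
  -- the `L¹`-estimate for differences of `Φ`
  have hest : ∀ k, ∫⁻ x in slab n a b, ‖Φ (moll (ρ k) u x) - Φ (u x)‖ₑ ≤ _ := fun k =>
    lintegral_sub_le_of_fderiv_growth (hΦ.contDiff.differentiable one_ne_zero) hΦ.convex hΦ.nonneg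
      hq0 hΦ.bound (hwc k).aestronglyMeasurable (huq a b).1
      (Eventually.of_forall fun x =>
        (hρ.kernel k).moll_mem h.locallyIntegrable hΦ.convex hΦ.isClosed huS x) huS'
  have hLq := hρ.tendsto_setLIntegral_slab (by linarith) huq a b
  have hL2 := hρ.tendsto_setLIntegral_slab (f := u) (q := 2) (by norm_num)
    (fun a b => by simpa using h.memLp_slab a b) a b
  set B : ℕ → ℝ≥0∞ := fun k => ENNReal.ofReal K * (volume (slab n a b) +
    2 ^ (q - 1) * (∫⁻ x in slab n a b, ‖u x‖ₑ ^ q) +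
    2 ^ (q - 1) * (∫⁻ x in slab n a b, ‖u x - moll (ρ k) u x‖ₑ ^ q) +
    ∫⁻ x in slab n a b, ‖u x‖ₑ ^ q) with hB
  have hBle : ∀ k, ∫⁻ x in slab n a b, ENNReal.ofReal K *
      (1 + ‖moll (ρ k) u x‖ₑ ^ q + ‖u x‖ₑ ^ q) ≤ B k := by
    intro k
    have m1 := (huq a b).1.enorm.pow_const q
    have m2 : AEMeasurable (fun x => ‖u x - moll (ρ k) u x‖ₑ ^ q) (volume.restrict (slab n a b)) :=
      (((huq a b).1.sub (hwc k).aestronglyMeasurable).enorm.pow_const q)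
    have htwo : (2 : ℝ≥0∞) ^ (q - 1) ≠ ∞ := ENNReal.rpow_ne_top_of_nonneg (by linarith) (by simp)
    rw [lintegral_const_mul' _ _ ENNReal.ofReal_ne_top, hB]
    simp only
    refine mul_le_mul_right ?_ _
    have e : volume (slab n a b) +
        2 ^ (q - 1) * (∫⁻ x in slab n a b, ‖u x‖ₑ ^ q) +
        2 ^ (q - 1) * (∫⁻ x in slab n a b, ‖u x - moll (ρ k) u x‖ₑ ^ q) +
        ∫⁻ x in slab n a b, ‖u x‖ₑ ^ q = ∫⁻ x in slab n a b, (1 + 2 ^ (q - 1) * ‖u x‖ₑ ^ q +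
          2 ^ (q - 1) * ‖u x - moll (ρ k) u x‖ₑ ^ q + ‖u x‖ₑ ^ q) := by
      rw [lintegral_add_right' _ m1, lintegral_add_right' _ (m2.const_mul _),
        lintegral_add_right' _ (m1.const_mul _), lintegral_const_mul' _ _ htwo,
        lintegral_const_mul' _ _ htwo]
      simp
    rw [e]
    refine lintegral_mono fun x => ?_
    have h3 : ‖moll (ρ k) u x‖ₑ ≤ ‖u x‖ₑ + ‖u x - moll (ρ k) u x‖ₑ := by
      have := enorm_sub_le (a := u x) (b := u x - moll (ρ k) u x)
      simpa using this
    have h4 := (ENNReal.rpow_le_rpow h3 hq0.le).trans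
      (ENNReal.rpow_add_le_mul_rpow_add_rpow _ _ (by linarith : 1 ≤ q))
    rw [mul_add] at h4
    calc 1 + ‖moll (ρ k) u x‖ₑ ^ q + ‖u x‖ₑ ^ q ≤ 1 + (2 ^ (q - 1) * ‖u x‖ₑ ^ q +
          2 ^ (q - 1) * ‖u x - moll (ρ k) u x‖ₑ ^ q) + ‖u x‖ₑ ^ q := by gcongr
      _ = _ := by ring
  have hBt : Tendsto B atTop (𝓝 (ENNReal.ofReal K * (volume (slab n a b) +
      2 ^ (q - 1) * (∫⁻ x in slab n a b, ‖u x‖ₑ ^ q) + 2 ^ (q - 1) * 0 +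
      ∫⁻ x in slab n a b, ‖u x‖ₑ ^ q))) := by
    refine ENNReal.Tendsto.const_mul ?_ (Or.inr ENNReal.ofReal_ne_top)
    refine Tendsto.add (Tendsto.add tendsto_const_nhds ?_) tendsto_const_nhds
    exact ENNReal.Tendsto.const_mul hLq
      (Or.inr (ENNReal.rpow_ne_top_of_nonneg (by linarith) (by simp)))
  have hfin : ENNReal.ofReal K * (volume (slab n a b) +
      2 ^ (q - 1) * (∫⁻ x in slab n a b, ‖u x‖ₑ ^ q) + 2 ^ (q - 1) * 0 +
      ∫⁻ x in slab n a b, ‖u x‖ₑ ^ q) ≠ ∞ := by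
    have h5 := lintegral_rpow_ne_top hq0 (huq a b)
    refine ENNReal.mul_ne_top ENNReal.ofReal_ne_top ?_
    rw [mul_zero, add_zero]
    refine ENNReal.add_ne_top.2 ⟨ENNReal.add_ne_top.2 ⟨by simp [volume_slab], ?_⟩, h5⟩
    exact ENNReal.mul_ne_top (ENNReal.rpow_ne_top_of_nonneg (by linarith) (by simp)) h5
  have hlim : Tendsto (fun k => ∫⁻ x in slab n a b, ‖Φ (moll (ρ k) u x) - Φ (u x)‖ₑ)
      atTop (𝓝 0) := by
    have t1 := ((ENNReal.continuous_rpow_const (y := (1 / 2 : ℝ))).tendsto 0).comp hL2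
    rw [ENNReal.zero_rpow_of_pos (by norm_num)] at t1
    have t2 := ((ENNReal.continuous_rpow_const (y := (1 / 2 : ℝ))).tendsto _).comp hBt
    have t3 := ENNReal.Tendsto.mul t1 (Or.inr (ENNReal.rpow_ne_top_of_nonneg (by norm_num) hfin)) t2
      (Or.inr (by simp))
    rw [zero_mul] at t3
    refine tendsto_of_tendsto_of_tendsto_of_le_of_le tendsto_const_nhds t3 (fun _ => zero_le)
      fun k => (hest k).trans ?_
    have e : ∀ x, ‖moll (ρ k) u x - u x‖ₑ = ‖u x - moll (ρ k) u x‖ₑ := fun x => by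
      rw [← enorm_neg, neg_sub]
    simp only [e, Function.comp_apply]
    gcongr
    exact hBle k
  refine tendsto_integral_of_L1 (fun x : Cylinder n => c x.1 * Φ (u x) j)
    (hcm.aestronglyMeasurable.mul (hΦj.comp_aestronglyMeasurable (huq a b).1))
    (Eventually.of_forall fun k => ?_) ?_
  · exact memLp_one_iff_integrable.1 ((hcm.mul (hΦj.comp (hwc k))).memLp_slab 1 a b)
  · have t4 := ENNReal.Tendsto.const_mul hlim (a := ENNReal.ofReal C) (Or.inr ENNReal.ofReal_ne_top)
    rw [mul_zero] at t4
    refine tendsto_of_tendsto_of_tendsto_of_le_of_le tendsto_const_nhds t4 (fun _ => zero_le)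
      fun k => ?_
    dsimp only
    rw [← lintegral_const_mul' _ _ ENNReal.ofReal_ne_top]
    refine lintegral_mono fun x => ?_
    rw [← mul_sub, enorm_mul]
    refine mul_le_mul' ?_ ?_
    · rw [Real.enorm_eq_ofReal_abs]
      exact ENNReal.ofReal_le_ofReal (hC x.1)
    · rw [← ofReal_norm, ← ofReal_norm]
      exact ENNReal.ofReal_le_ofReal (PiLp.norm_apply_le (Φ (moll (ρ k) u x) - Φ (u x)) j)

end IsSolenoidal

lemma IsCutoff.integral_sum {n : ℕ} {a b : ℝ} {c : ℝ → ℝ} (hcc : Continuous c)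
    (hc : ∀ t, t ∉ Set.Icc a b → c t = 0) {ι : Type*} (s : Finset ι) {H : ι → Cylinder n → ℝ}
    (hH : ∀ i ∈ s, Continuous (H i)) :
    ∫ x, c x.1 * ∑ i ∈ s, H i x = ∑ i ∈ s, ∫ x, c x.1 * H i x := by
  simp only [Finset.mul_sum]
  refine integral_finsetSum s fun i hi => ?_
  exact ((hcc.comp continuous_fst).mul (hH i hi)).integrable_of_hasCompactSupport
    (IsCutoff.hasCompactSupport_mul hc (H i))

/-- The scalar diagonal of `∇Φ` does not contribute to `∇·Φ(w)` when `w` is divergence free. -/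
lemma sum_jac_mul_eq_sum_offDiag_mul {d : ℕ} {Φ : Vec d → Vec d} {z : Vec d}
    (hsymm : ∀ i j, jac Φ i j z = jac Φ j i z) (hdiag : ∀ i j, jac Φ i i z = jac Φ j j z)
    {W : Fin d → Fin d → ℝ} (hW : ∑ i, W i i = 0) :
    ∑ i, ∑ j, jac Φ j i z * W i j = ∑ i, ∑ j, offDiag Φ i j z * W i j := by
  rw [← sub_eq_zero, ← Finset.sum_sub_distrib]
  have h1 : ∀ i, ∑ j, jac Φ j i z * W i j - ∑ j, offDiag Φ i j z * W i j = jac Φ i i z * W i i := by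
    intro i
    rw [← Finset.sum_sub_distrib, Finset.sum_eq_single i]
    · simp [offDiag]
    · intro j _ hj
      simp [offDiag, hj.symm, hsymm i j]
    · simp
  simp only [h1]
  rcases Nat.eq_zero_or_pos d with rfl | hd
  · simp
  · have h2 : ∀ i, jac Φ i i z * W i i = jac Φ ⟨0, hd⟩ ⟨0, hd⟩ z * W i i := fun i => by
      rw [hdiag i]
    simp only [h2]
    rw [← Finset.mul_sum, hW, mul_zero]

namespace IsSolenoidal
variable {n : ℕ} {u : Cylinder n → Vec (n + 1)} {g : Fin (n + 1) → Fin (n + 1) → Cylinder n → ℝ}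
  {a b : ℝ} {χ χ' : ℝ → ℝ} {Φ : Vec (n + 1) → Vec (n + 1)} {S : Set (Vec (n + 1))} {K q : ℝ}

/-- The calibration identity `∫ χ ∇·Φ(u) = -∫ χ' Φ₁(u)`, in which only the off-diagonal part of
`∇Φ` enters because `u` is divergence free and the diagonal of `∇Φ` is scalar. -/
lemma calibration_identity (h : IsSolenoidal u g) (hΦ : HasGrowthOn Φ S K q)
    (hsymm : ∀ z i j, jac Φ i j z = jac Φ j i z) (hdiag : ∀ z i j, jac Φ i i z = jac Φ j j z)
    (huS : ∀ᵐ x, u x ∈ S)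
    (huq : ∀ a b, MemLp u (ENNReal.ofReal q) (volume.restrict (slab n a b)))
    (hχ : IsCutoff a b χ χ') :
    ∑ i, ∑ j, ∫ x, χ x.1 * (offDiag Φ i j (u x) * g i j x) = -∫ x, χ' x.1 * Φ (u x) 0 := by
  obtain ⟨ρ, hρ, hae⟩ := h.exists_isMollifier_ae a b
  have t1 := tendsto_finsetSum (Finset.univ : Finset (Fin (n + 1))) fun i _ =>
    tendsto_finsetSum (Finset.univ : Finset (Fin (n + 1))) fun j _ =>
      h.tendsto_integral_superposition_mul_grad (continuous_offDiag hΦ.contDiff i j) hΦ.convex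
        hΦ.isClosed hΦ.nonneg hΦ.two_le (hΦ.offDiag_sq_le i j) huS huq hχ.continuous hχ.eq_zero hρ
        hae i j
  have t2 := (h.tendsto_integral_flux hΦ huS huq hχ.continuous_deriv hχ.deriv_eq_zero hρ 0).neg
  refine tendsto_nhds_unique (t1.congr fun k => ?_) t2
  have hk := (hρ.kernel k).test
  have hw := h.continuous_moll hk
  have hj : ∀ i j, Continuous fun x => jac Φ j i (moll (ρ k) u x) * moll (ρ k) (g i j) x :=
    fun i j => ((continuous_jac hΦ.contDiff j i).comp hw).mul (h.continuous_moll_grad hk i j)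
  have ho : ∀ i j, Continuous fun x => offDiag Φ i j (moll (ρ k) u x) * moll (ρ k) (g i j) x :=
    fun i j => ((continuous_offDiag hΦ.contDiff i j).comp hw).mul (h.continuous_moll_grad hk i j)
  have e1 : ∑ i, ∑ j, ∫ x, χ x.1 * (offDiag Φ i j (moll (ρ k) u x) * moll (ρ k) (g i j) x) =
      ∫ x, χ x.1 * ∑ i, ∑ j, offDiag Φ i j (moll (ρ k) u x) * moll (ρ k) (g i j) x := by
    rw [IsCutoff.integral_sum hχ.continuous hχ.eq_zero _
      fun i _ => continuous_finsetSum _ fun j _ => ho i j]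
    exact Finset.sum_congr rfl fun i _ =>
      (IsCutoff.integral_sum hχ.continuous hχ.eq_zero _ fun j _ => ho i j).symm
  have e2 : ∀ x, ∑ i, ∑ j, offDiag Φ i j (moll (ρ k) u x) * moll (ρ k) (g i j) x =
      ∑ i, ∑ j, jac Φ j i (moll (ρ k) u x) * moll (ρ k) (g i j) x := fun x =>
    (sum_jac_mul_eq_sum_offDiag_mul (hsymm _) (hdiag _) (h.sum_moll_diag hk x)).symm
  simp only [e1, e2]
  rw [IsCutoff.integral_sum hχ.continuous hχ.eq_zero _
      fun i _ => continuous_finsetSum _ fun j _ => hj i j]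
  have e3 : ∀ i : Fin (n + 1), ∫ x, χ x.1 * ∑ j, jac Φ j i (moll (ρ k) u x) * moll (ρ k) (g i j) x =
      if i = 0 then -∫ x, χ' x.1 * Φ (moll (ρ k) u x) i else 0 := fun i =>
    hχ.integral_mul_hasPartial (h.hasPartial_comp hk hΦ.contDiff i i)
      ((EuclideanSpace.proj i : Vec (n + 1) →L[ℝ] ℝ).continuous.comp
        (hΦ.contDiff.continuous.comp hw))
      (continuous_finsetSum _ fun j _ => hj i j)
  simp only [e3, Finset.sum_ite_eq', Finset.mem_univ, if_true]

/-- When `∂₁ u₁ = 0`, the chain rule for `Φ₁(u)` in the direction `x₁` only involves off-diagonal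
entries of `∇Φ`. -/
lemma first_component_identity (h : IsSolenoidal u g) (hΦ : HasGrowthOn Φ S K q)
    (hsymm : ∀ z i j, jac Φ i j z = jac Φ j i z) (huS : ∀ᵐ x, u x ∈ S)
    (huq : ∀ a b, MemLp u (ENNReal.ofReal q) (volume.restrict (slab n a b)))
    (hχ : IsCutoff a b χ χ') (h0 : g 0 0 =ᵐ[volume] 0) :
    ∑ j, ∫ x, χ x.1 * (offDiag Φ 0 j (u x) * g 0 j x) = -∫ x, χ' x.1 * Φ (u x) 0 := by
  obtain ⟨ρ, hρ, hae⟩ := h.exists_isMollifier_ae a b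
  have t1 := tendsto_finsetSum (Finset.univ : Finset (Fin (n + 1))) fun j _ =>
      h.tendsto_integral_superposition_mul_grad (continuous_offDiag hΦ.contDiff 0 j) hΦ.convex
        hΦ.isClosed hΦ.nonneg hΦ.two_le (hΦ.offDiag_sq_le 0 j) huS huq hχ.continuous hχ.eq_zero hρ
        hae 0 j
  have t2 := (h.tendsto_integral_flux hΦ huS huq hχ.continuous_deriv hχ.deriv_eq_zero hρ 0).neg
  refine tendsto_nhds_unique (t1.congr fun k => ?_) t2
  have hk := (hρ.kernel k).test
  have hw := h.continuous_moll hk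
  have hj : ∀ j, Continuous fun x => jac Φ j 0 (moll (ρ k) u x) * moll (ρ k) (g 0 j) x :=
    fun j => ((continuous_jac hΦ.contDiff j 0).comp hw).mul (h.continuous_moll_grad hk 0 j)
  have ho : ∀ j, Continuous fun x => offDiag Φ 0 j (moll (ρ k) u x) * moll (ρ k) (g 0 j) x :=
    fun j => ((continuous_offDiag hΦ.contDiff 0 j).comp hw).mul (h.continuous_moll_grad hk 0 j)
  have hz : moll (ρ k) (g 0 0) = 0 := by
    rw [moll_congr_ae h0]; funext x; simp [moll]
  rw [← IsCutoff.integral_sum hχ.continuous hχ.eq_zero _ fun j _ => ho j]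
  have e2 : ∀ x, ∑ j, offDiag Φ 0 j (moll (ρ k) u x) * moll (ρ k) (g 0 j) x =
      ∑ j, jac Φ j 0 (moll (ρ k) u x) * moll (ρ k) (g 0 j) x := fun x => by
    refine Finset.sum_congr rfl fun j _ => ?_
    by_cases hj : 0 = j
    · subst hj; simp [hz]
    · rw [offDiag, if_neg hj, hsymm]
  simp only [e2]
  have := hχ.integral_mul_hasPartial (h.hasPartial_comp hk hΦ.contDiff 0 0)
    ((EuclideanSpace.proj 0 : Vec (n + 1) →L[ℝ] ℝ).continuous.comp (hΦ.contDiff.continuous.comp hw))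
    (continuous_finsetSum _ fun j _ => hj j)
  simpa using this

/-- The null-Lagrangian identity `∫ χ tr((∇u)²) = -∫ χ' ∑ⱼ uⱼ ∂ⱼ u₁`. -/
lemma trace_identity (h : IsSolenoidal u g) (hχ : IsCutoff a b χ χ') :
    ∑ j, ∑ i, ∫ x, χ x.1 * (g i j x * g j i x) = -∑ j, ∫ x, χ' x.1 * (u x j * g j 0 x) := by
  obtain ⟨ρ, hρ⟩ := exists_isMollifier n
  obtain ⟨C, hC⟩ := exists_abs_le_of_eq_zero hχ.continuous hχ.eq_zero
  obtain ⟨C', hC'⟩ := exists_abs_le_of_eq_zero hχ.continuous_deriv hχ.deriv_eq_zero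
  have hcm : Continuous fun x : Cylinder n => χ x.1 := hχ.continuous.comp continuous_fst
  have hcm' : Continuous fun x : Cylinder n => χ' x.1 := hχ.continuous_deriv.comp continuous_fst
  have mul_memLp : ∀ {c f : Cylinder n → ℝ} {C : ℝ}, Continuous c → (∀ x, |c x| ≤ C) →
      MemLp f 2 (volume.restrict (slab n a b)) →
      MemLp (fun x => c x * f x) 2 (volume.restrict (slab n a b)) := fun {c f C} hc hC hf =>
    hf.mul (p := ∞) (q := 2) (r := 2)
      (MemLp.of_bound hc.aestronglyMeasurable C (Eventually.of_forall hC))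
  have t1 : ∀ i j, Tendsto (fun k => ∫ x, χ x.1 * (moll (ρ k) (g i j) x * moll (ρ k) (g j i) x))
      atTop (𝓝 (∫ x, χ x.1 * (g i j x * g j i x))) := by
    intro i j
    simp only [integral_eq_setIntegral_slab hχ.eq_zero]
    simp only [← mul_assoc]
    refine tendsto_integral_mul_of_tendsto_sq (mul_memLp hcm (fun x => hC x.1)
      ((h.memLp_grad i j).restrict _)) ((h.memLp_grad j i).restrict _) ?_ ?_
      (tendsto_lintegral_sq_mul (fun x => hC x.1) (h.tendsto_moll_grad hρ i j a b))
      (h.tendsto_moll_grad hρ j i a b)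
    · exact fun k => (hcm.mul (h.continuous_moll_grad (hρ.kernel k).test i j)).memLp_slab 2 a b
    · exact fun k => (h.continuous_moll_grad (hρ.kernel k).test j i).memLp_slab 2 a b
  have t2 : ∀ j, Tendsto (fun k => ∫ x, χ' x.1 * (moll (ρ k) u x j * moll (ρ k) (g j 0) x))
      atTop (𝓝 (∫ x, χ' x.1 * (u x j * g j 0 x))) := by
    intro j
    simp only [integral_eq_setIntegral_slab hχ.deriv_eq_zero]
    simp only [← mul_assoc]
    have hu : ∀ a b, MemLp (fun x => u x j) 2 (volume.restrict (slab n a b)) := fun a b =>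
      (EuclideanSpace.proj j : Vec (n + 1) →L[ℝ] ℝ).comp_memLp' (h.memLp_slab a b)
    refine tendsto_integral_mul_of_tendsto_sq (mul_memLp hcm' (fun x => hC' x.1) (hu a b))
      ((h.memLp_grad j 0).restrict _) ?_ ?_
      (tendsto_lintegral_sq_mul (fun x => hC' x.1) ?_) (h.tendsto_moll_grad hρ j 0 a b)
    · exact fun k => (hcm'.mul (h.continuous_moll_apply (hρ.kernel k).test j)).memLp_slab 2 a b
    · exact fun k => (h.continuous_moll_grad (hρ.kernel k).test j 0).memLp_slab 2 a b
    · have := hρ.tendsto_setLIntegral_slab (f := fun x => u x j) (q := 2) (by norm_num)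
        (fun a b => by simpa using hu a b) a b
      refine this.congr fun k => ?_
      simp only [moll_apply (hρ.kernel k).test h.locallyIntegrable]
  have t1' := tendsto_finsetSum (Finset.univ : Finset (Fin (n + 1))) fun j _ =>
    tendsto_finsetSum (Finset.univ : Finset (Fin (n + 1))) fun i _ => t1 i j
  have t2' := (tendsto_finsetSum (Finset.univ : Finset (Fin (n + 1))) fun j _ => t2 j).neg
  refine tendsto_nhds_unique (t1'.congr fun k => ?_) t2'
  have hk := (hρ.kernel k).test
  have cW := h.continuous_moll_grad hk
  have cw := h.continuous_moll_apply hk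
  have cD : ∀ i j, Continuous (moll (partialDeriv i (ρ k)) (g j i)) := fun i j =>
    h.continuous_moll_grad (hk.partialDeriv i) j i
  rw [← Finset.sum_neg_distrib]
  refine Finset.sum_congr rfl fun j _ => ?_
  -- `∂ᵢ (wⱼ ∂ⱼ wᵢ) = ∂ᵢ wⱼ ∂ⱼ wᵢ + wⱼ ∂ᵢ ∂ⱼ wᵢ`, and the last terms add up to zero
  have hP : ∀ i, HasPartial i (fun x => moll (ρ k) u x j * moll (ρ k) (g j i) x)
      (fun x => moll (ρ k) (g i j) x * moll (ρ k) (g j i) x +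
        moll (ρ k) u x j * moll (partialDeriv i (ρ k)) (g j i) x) := by
    intro i x
    have h1 := (h.hasPartial_moll hk i j x).mul
      (Cylinder.hasPartial_moll hk (h.weak j i).locInt_deriv i x)
    simp only [dir_zero, add_zero] at h1
    exact h1
  have e1 : ∀ i, ∫ x, χ x.1 * (moll (ρ k) (g i j) x * moll (ρ k) (g j i) x +
        moll (ρ k) u x j * moll (partialDeriv i (ρ k)) (g j i) x) =
      if i = 0 then -∫ x, χ' x.1 * (moll (ρ k) u x j * moll (ρ k) (g j i) x) else 0 := fun i =>
    hχ.integral_mul_hasPartial (hP i) ((cw j).mul (cW j i))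
      (((cW i j).mul (cW j i)).add ((cw j).mul (cD i j)))
  have e2 : ∑ i, ∫ x, χ x.1 * (moll (ρ k) (g i j) x * moll (ρ k) (g j i) x) =
      ∑ i, ∫ x, χ x.1 * (moll (ρ k) (g i j) x * moll (ρ k) (g j i) x +
        moll (ρ k) u x j * moll (partialDeriv i (ρ k)) (g j i) x) := by
    have cA : ∀ i, Continuous fun x => moll (ρ k) (g i j) x * moll (ρ k) (g j i) x :=
      fun i => (cW i j).mul (cW j i)
    have cB : ∀ i, Continuous fun x => moll (ρ k) (g i j) x * moll (ρ k) (g j i) x +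
        moll (ρ k) u x j * moll (partialDeriv i (ρ k)) (g j i) x :=
      fun i => (cA i).add ((cw j).mul (cD i j))
    rw [← IsCutoff.integral_sum hχ.continuous hχ.eq_zero _ fun i _ => cA i,
      ← IsCutoff.integral_sum hχ.continuous hχ.eq_zero _ fun i _ => cB i]
    refine integral_congr_ae (Eventually.of_forall fun x => ?_)
    simp only
    rw [Finset.sum_add_distrib, ← Finset.mul_sum, h.sum_moll_partialDeriv hk j x, mul_zero,
      add_zero]
  rw [e2]
  simp only [e1, Finset.sum_ite_eq', Finset.mem_univ, if_true]

end IsSolenoidal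

/-! ### Exhausting the cylinder -/

section Exhaustion

lemma smoothTransition_hasDerivAt (t : ℝ) :
    HasDerivAt Real.smoothTransition (deriv Real.smoothTransition t) t :=
  ((Real.smoothTransition.contDiff (n := 1)).differentiable one_ne_zero t).hasDerivAt

lemma continuous_deriv_smoothTransition : Continuous (deriv Real.smoothTransition) :=
  (Real.smoothTransition.contDiff (n := 1)).continuous_deriv (by simp)

lemma deriv_smoothTransition_eq_zero {t : ℝ} (ht : t ∉ Set.Icc (0 : ℝ) 1) :
    deriv Real.smoothTransition t = 0 := by
  rw [Set.mem_Icc, not_and_or, not_le, not_le] at ht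
  rcases ht with h | h
  · have : Real.smoothTransition =ᶠ[𝓝 t] fun _ => 0 := by
      filter_upwards [Iio_mem_nhds h] with s hs
      exact Real.smoothTransition.zero_of_nonpos (le_of_lt hs)
    rw [this.deriv_eq]; simp
  · have : Real.smoothTransition =ᶠ[𝓝 t] fun _ => 1 := by
      filter_upwards [Ioi_mem_nhds h] with s hs
      exact Real.smoothTransition.one_of_one_le (le_of_lt hs)
    rw [this.deriv_eq]; simp

lemma integral_deriv_smoothTransition : ∫ t, deriv Real.smoothTransition t = 1 := by
  have h1 : Tendsto Real.smoothTransition atBot (𝓝 0) :=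
    tendsto_const_nhds.congr' (by
      filter_upwards [eventually_le_atBot (0 : ℝ)] with t ht
      rw [Real.smoothTransition.zero_of_nonpos ht])
  have h2 : Tendsto Real.smoothTransition atTop (𝓝 1) :=
    tendsto_const_nhds.congr' (by
      filter_upwards [eventually_ge_atTop (1 : ℝ)] with t ht
      rw [Real.smoothTransition.one_of_one_le ht])
  have h3 := integral_of_hasDerivAt_of_tendsto smoothTransition_hasDerivAt
    (continuous_deriv_smoothTransition.integrable_of_hasCompactSupport
      (HasCompactSupport.intro isCompact_Icc fun _ => deriv_smoothTransition_eq_zero)) h1 h2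
  simpa using h3

/-- The plateau function equal to `1` on `[-R, R]` and to `0` off `[-R - 1, R + 1]`. -/
def plateau (R t : ℝ) : ℝ := Real.smoothTransition (t + R + 1) - Real.smoothTransition (t - R)

/-- The derivative of `plateau`. -/
def plateauDeriv (R t : ℝ) : ℝ :=
  deriv Real.smoothTransition (t - (-R - 1)) - deriv Real.smoothTransition (t - R)

lemma isCutoff_plateau {R : ℝ} (hR : 0 ≤ R) :
    IsCutoff (-R - 1) (R + 1) (plateau R) (plateauDeriv R) where
  hasDerivAt t := by
    have h1 := (smoothTransition_hasDerivAt (t - R)).comp_sub_const t R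
    have h2 := (smoothTransition_hasDerivAt (t - (-R - 1))).comp_sub_const t (-R - 1)
    have e : plateau R = fun s => Real.smoothTransition (s - (-R - 1)) -
        Real.smoothTransition (s - R) := by
      funext s; unfold plateau; congr 2; ring
    rw [e]
    exact h2.sub h1
  continuous_deriv := by
    have := continuous_deriv_smoothTransition
    unfold plateauDeriv
    fun_prop
  eq_zero t ht := by
    rw [Set.mem_Icc, not_and_or, not_le, not_le] at ht
    unfold plateau
    rcases ht with h | h
    · rw [Real.smoothTransition.zero_of_nonpos (by linarith),
        Real.smoothTransition.zero_of_nonpos (by linarith), sub_zero]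
    · rw [Real.smoothTransition.one_of_one_le (by linarith),
        Real.smoothTransition.one_of_one_le (by linarith), sub_self]
  deriv_eq_zero t ht := by
    have h1 : t - (-R - 1) ∉ Set.Icc (0 : ℝ) 1 := fun h =>
      ht ⟨by linarith [h.1], by linarith [h.2]⟩
    have h2 : t - R ∉ Set.Icc (0 : ℝ) 1 := fun h => ht ⟨by linarith [h.1], by linarith [h.2]⟩
    rw [plateauDeriv, deriv_smoothTransition_eq_zero h1, deriv_smoothTransition_eq_zero h2,
      sub_zero]

lemma abs_plateau_le (R t : ℝ) : |plateau R t| ≤ 1 := by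
  unfold plateau
  have h1 := Real.smoothTransition.nonneg (t + R + 1)
  have h2 := Real.smoothTransition.le_one (t + R + 1)
  have h3 := Real.smoothTransition.nonneg (t - R)
  have h4 := Real.smoothTransition.le_one (t - R)
  exact abs_le.2 ⟨by linarith, by linarith⟩

lemma plateau_eq_one {R t : ℝ} (h : |t| ≤ R) : plateau R t = 1 := by
  have := abs_le.1 h
  unfold plateau
  rw [Real.smoothTransition.one_of_one_le (by linarith),
    Real.smoothTransition.zero_of_nonpos (by linarith), sub_zero]

end Exhaustion

namespace Cylinder
variable {n : ℕ}

lemma tendsto_integral_plateau_mul {f : Cylinder n → ℝ} (hf : Integrable f volume) :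
    Tendsto (fun k : ℕ => ∫ x, plateau k x.1 * f x) atTop (𝓝 (∫ x, f x)) := by
  refine tendsto_integral_of_dominated_convergence (fun x => ‖f x‖) (fun k => ?_) hf.norm ?_ ?_
  · have : Continuous fun x : Cylinder n => plateau k x.1 :=
      (isCutoff_plateau (Nat.cast_nonneg k)).continuous.comp continuous_fst
    exact this.aestronglyMeasurable.mul hf.1
  · refine fun k => Eventually.of_forall fun x => ?_
    rw [norm_mul]
    exact mul_le_of_le_one_left (norm_nonneg _) (abs_plateau_le _ _)
  · refine Eventually.of_forall fun x => tendsto_const_nhds.congr' ?_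
    obtain ⟨m, hm⟩ := exists_nat_ge |x.1|
    filter_upwards [eventually_ge_atTop m] with k hk
    rw [plateau_eq_one (hm.trans (by exact_mod_cast hk)), one_mul]

lemma integral_comp_fst {f : ℝ → ℝ} (hf : Continuous f) :
    ∫ x : Cylinder n, f x.1 = ∫ t, f t := by
  have h1 : MeasurePreserving (Prod.fst : Cylinder n → ℝ) volume volume :=
    measurePreserving_fst (μ := (volume : Measure ℝ)) (ν := (volume : Measure (Torus n)))
  rw [← h1.map_eq, integral_map h1.measurable.aemeasurable hf.aestronglyMeasurable]

lemma integral_deriv_smoothTransition_fst (s : ℝ) :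
    ∫ x : Cylinder n, deriv Real.smoothTransition (x.1 - s) = 1 := by
  rw [integral_comp_fst (f := fun t => deriv Real.smoothTransition (t - s))
    (continuous_deriv_smoothTransition.comp (continuous_sub_right s)),
    integral_sub_right_eq_self (deriv Real.smoothTransition) s, integral_deriv_smoothTransition]

/-- The mass of an integrable function escapes from slabs going to infinity. -/
lemma tendsto_setLIntegral_slab_zero {f : Cylinder n → ℝ≥0∞} (hf : ∫⁻ x, f x ≠ ∞)
    (hfm : AEMeasurable f volume) {s : ℕ → ℝ} (hs : Tendsto (fun k => |s k|) atTop atTop) :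
    Tendsto (fun k => ∫⁻ x in slab n (s k) (s k + 1), f x) atTop (𝓝 0) := by
  have h1 : Tendsto (fun k => ∫⁻ x, (slab n (s k) (s k + 1)).indicator f x) atTop
      (𝓝 (∫⁻ _ : Cylinder n, 0)) := by
    refine tendsto_lintegral_of_dominated_convergence' f
      (fun k => hfm.indicator (measurableSet_slab _ _))
      (fun k => Eventually.of_forall fun x => Set.indicator_le_self _ _ _) hf
      (Eventually.of_forall fun x => tendsto_const_nhds.congr' ?_)
    filter_upwards [hs.eventually_gt_atTop (|x.1| + 1)] with k hk
    refine (Set.indicator_of_notMem (fun hx => ?_) _).symm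
    have h2 : s k ≤ x.1 := hx.1
    have h3 : x.1 ≤ s k + 1 := hx.2
    have h4 : |s k| ≤ |x.1| + 1 := by
      rw [abs_le]
      constructor <;> linarith [neg_abs_le x.1, le_abs_self x.1]
    linarith
  simpa [lintegral_indicator (measurableSet_slab _ _)] using h1

/-- A square-integrable function on the cylinder that does not depend on `x₁` vanishes. -/
lemma lintegral_slab_eq_zero_of_invariant {F : Cylinder n → ℝ} (hF : Continuous F)
    (hinv : ∀ x t, F (x + dir 0 t) = F x) (hfin : ∫⁻ x, ‖F x‖ₑ ^ (2 : ℝ) ≠ ∞) : F = 0 := by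
  have h1 : ∀ k : ℕ, ∫⁻ x in slab n k (k + 1), ‖F x‖ₑ ^ (2 : ℝ) =
      ∫⁻ x in slab n 0 1, ‖F x‖ₑ ^ (2 : ℝ) := by
    intro k
    rw [← lintegral_indicator (measurableSet_slab _ _),
      ← lintegral_indicator (measurableSet_slab _ _),
      ← lintegral_add_right_eq_self _ (dir 0 (k : ℝ))]
    refine lintegral_congr fun x => ?_
    have e : (x + dir 0 (k : ℝ) ∈ slab n k (k + 1)) ↔ x ∈ slab n 0 1 := by
      have e1 : (x + dir 0 (k : ℝ)).1 = x.1 + k := by rw [Prod.fst_add, dir_first_fst]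
      change (x + dir 0 (k : ℝ)).1 ∈ Set.Icc (k : ℝ) (k + 1) ↔ x.1 ∈ Set.Icc (0 : ℝ) 1
      rw [e1, Set.mem_Icc, Set.mem_Icc]
      constructor <;> rintro ⟨_, _⟩ <;> constructor <;> linarith
    by_cases hx : x ∈ slab n 0 1
    · rw [Set.indicator_of_mem hx, Set.indicator_of_mem (e.2 hx), hinv]
    · rw [Set.indicator_of_notMem hx, Set.indicator_of_notMem (fun h => hx (e.1 h))]
  have h2 := tendsto_setLIntegral_slab_zero (n := n) hfin
    (hF.enorm.measurable.pow_const _).aemeasurable (s := fun k => (k : ℝ))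
    (by simpa using tendsto_natCast_atTop_atTop)
  simp only [h1] at h2
  have h3 := tendsto_nhds_unique h2 tendsto_const_nhds
  rw [eq_comm, lintegral_eq_zero_iff (hF.enorm.measurable.pow_const _)] at h3
  have h4 : ∀ᵐ x ∂volume.restrict (slab n 0 1), F x = 0 := by
    filter_upwards [h3] with x hx
    have hx' : ‖F x‖ₑ ^ (2 : ℝ) = 0 := hx
    simpa using hx'
  -- continuity upgrades the conclusion on the open slab, and invariance spreads it
  have h5 : ∀ x : Cylinder n, x.1 ∈ Set.Ioo (0 : ℝ) 1 → F x = 0 := by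
    have ho : IsOpen (Prod.fst ⁻¹' Set.Ioo (0 : ℝ) 1 : Set (Cylinder n)) :=
      isOpen_Ioo.preimage continuous_fst
    have h6 : F =ᵐ[volume.restrict (Prod.fst ⁻¹' Set.Ioo (0 : ℝ) 1)] fun _ => (0 : ℝ) :=
      ae_restrict_of_ae_restrict_of_subset
        (fun x (hx : x.1 ∈ Set.Ioo (0 : ℝ) 1) =>
          show x.1 ∈ Set.Icc (0 : ℝ) 1 from Set.Ioo_subset_Icc_self hx) h4
    intro x hx
    exact Measure.eqOn_open_of_ae_eq h6 ho hF.continuousOn continuousOn_const hx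
  funext x
  rw [← hinv x (1 / 2 - x.1)]
  refine h5 _ ?_
  rw [Prod.fst_add, dir_first_fst]
  constructor <;> norm_num

lemma setLIntegral_slab_le {f : Cylinder n → ℝ≥0∞} {M : ℝ≥0∞}
    (hM : ∀ s, ∫⁻ x in slab n s (s + 1), f x ≤ M) (a : ℝ) (N : ℕ) :
    ∫⁻ x in slab n a (a + N), f x ≤ (N + 1) * M := by
  induction N with
  | zero =>
    refine (lintegral_mono_set fun x hx => ?_).trans ((hM a).trans (by simp))
    exact ⟨hx.1, by have := hx.2; simp at this; linarith⟩
  | succ N ih =>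
    have h1 : slab n a (a + (N + 1 : ℕ)) ⊆ slab n a (a + N) ∪ slab n (a + N) (a + N + 1) := by
      intro x hx
      rcases le_total x.1 (a + N) with h | h
      · exact Or.inl ⟨hx.1, h⟩
      · refine Or.inr ⟨h, ?_⟩
        have := hx.2
        push_cast at this
        linarith
    calc ∫⁻ x in slab n a (a + (N + 1 : ℕ)), f x
        ≤ ∫⁻ x in slab n a (a + N) ∪ slab n (a + N) (a + N + 1), f x := lintegral_mono_set h1
      _ ≤ (∫⁻ x in slab n a (a + N), f x) + ∫⁻ x in slab n (a + N) (a + N + 1), f x :=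
          lintegral_union_le _ _ _
      _ ≤ (N + 1) * M + M := add_le_add ih (hM _)
      _ = _ := by push_cast; ring

lemma memLp_slab_of_le {E : Type*} [NormedAddCommGroup E] {f : Cylinder n → E} {q : ℝ}
    (hq : 0 < q) {M : ℝ≥0∞} (hMt : M ≠ ∞) (hf : AEStronglyMeasurable f volume)
    (hM : ∀ s, ∫⁻ x in slab n s (s + 1), ‖f x‖ₑ ^ q ≤ M) (a b : ℝ) :
    MemLp f (ENNReal.ofReal q) (volume.restrict (slab n a b)) := by
  refine ⟨hf.restrict, ?_⟩
  rw [eLpNorm_lt_top_iff_lintegral_rpow_enorm_lt_top (by simpa using hq) ENNReal.ofReal_ne_top,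
    ENNReal.toReal_ofReal hq.le]
  obtain ⟨N, hN⟩ := exists_nat_ge (b - a)
  refine lt_of_le_of_lt (lintegral_mono_set fun x hx => ?_) ((setLIntegral_slab_le hM a N).trans_lt
    (ENNReal.mul_lt_top (by simp) hMt.lt_top))
  exact ⟨hx.1, by linarith [hx.2]⟩

end Cylinder

/-! ### Fluxes at infinity -/

lemma exists_abs_deriv_smoothTransition_le :
    ∃ C, ∀ t, |deriv Real.smoothTransition t| ≤ C :=
  exists_abs_le_of_eq_zero continuous_deriv_smoothTransition
    fun _ => deriv_smoothTransition_eq_zero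

/-- Behaviour of a solenoidal field at infinity: `L^q`-bounds on slabs of unit width, uniform in
the position, and convergence to `um`, `up` in `L²` of such slabs. -/
structure HasLimits {n : ℕ} (u : Cylinder n → Vec (n + 1)) (q : ℝ) (M : ℝ≥0∞)
    (um up : Vec (n + 1)) : Prop where
  ne_top : M ≠ ∞
  bound : ∀ s, ∫⁻ x in slab n s (s + 1), ‖u x‖ₑ ^ q ≤ M
  tendsto_top : Tendsto (fun k : ℕ => ∫⁻ x in slab n k (k + 1), ‖u x - up‖ₑ ^ (2 : ℝ)) atTop (𝓝 0)
  tendsto_bot : Tendsto (fun k : ℕ => ∫⁻ x in slab n (-k - 1) (-k - 1 + 1), ‖u x - um‖ₑ ^ (2 : ℝ))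
    atTop (𝓝 0)

lemma integral_shift_eq_setIntegral {n : ℕ} (s : ℝ) (G : Cylinder n → ℝ) :
    ∫ x, deriv Real.smoothTransition (x.1 - s) * G x =
      ∫ x in slab n s (s + 1), deriv Real.smoothTransition (x.1 - s) * G x :=
  integral_eq_setIntegral_slab (c := fun t => deriv Real.smoothTransition (t - s)) (fun t ht =>
    deriv_smoothTransition_eq_zero fun h => ht ⟨by linarith [h.1], by linarith [h.2]⟩) G

namespace IsSolenoidal
variable {n : ℕ} {u : Cylinder n → Vec (n + 1)} {g : Fin (n + 1) → Fin (n + 1) → Cylinder n → ℝ}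
  {a b : ℝ} {Φ : Vec (n + 1) → Vec (n + 1)} {S : Set (Vec (n + 1))} {K q : ℝ}
  {um up : Vec (n + 1)} {M : ℝ≥0∞}

/-- The flux through slabs on which `u` tends to `c` in `L²` tends to `Φ₁(c)`: the growth of `∇Φ` and
the `L^q`-bounds control the difference in mean. -/
lemma tendsto_flux_shift (h : IsSolenoidal u g) (hΦ : HasGrowthOn Φ S K q)
    (huS : ∀ᵐ x, u x ∈ S) (hMt : M ≠ ∞) (hM : ∀ s, ∫⁻ x in slab n s (s + 1), ‖u x‖ₑ ^ q ≤ M)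
    {c : Vec (n + 1)} (hc : c ∈ S) {s : ℕ → ℝ}
    (hs : Tendsto (fun k => ∫⁻ x in slab n (s k) (s k + 1), ‖u x - c‖ₑ ^ (2 : ℝ)) atTop (𝓝 0)) :
    (∀ k, Integrable (fun x => deriv Real.smoothTransition (x.1 - s k) * Φ (u x) 0) volume) ∧
    Tendsto (fun k => ∫ x, deriv Real.smoothTransition (x.1 - s k) * Φ (u x) 0) atTop
      (𝓝 (Φ c 0)) := by
  obtain ⟨C, hC⟩ := exists_abs_deriv_smoothTransition_le
  have hq0 : 0 < q := by linarith [hΦ.two_le]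
  have hum : AEStronglyMeasurable u volume := h.locallyIntegrable.aestronglyMeasurable
  have huq := memLp_slab_of_le hq0 hMt hum hM
  have hΦ0 : Continuous fun z => Φ z 0 :=
    (EuclideanSpace.proj 0 : Vec (n + 1) →L[ℝ] ℝ).continuous.comp hΦ.contDiff.continuous
  have hηc : ∀ k, Continuous fun x : Cylinder n => deriv Real.smoothTransition (x.1 - s k) :=
    fun k => continuous_deriv_smoothTransition.comp (continuous_fst.sub continuous_const)
  set B : ℝ≥0∞ := ENNReal.ofReal K * (1 + M + ‖c‖ₑ ^ q) with hB
  have hBt : B ≠ ∞ := by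
    refine ENNReal.mul_ne_top ENNReal.ofReal_ne_top (ENNReal.add_ne_top.2 ⟨?_, by simp [hq0.le]⟩)
    exact ENNReal.add_ne_top.2 ⟨by simp, hMt⟩
  have hest : ∀ k, ∫⁻ x in slab n (s k) (s k + 1), ‖Φ (u x) - Φ c‖ₑ ≤
      (∫⁻ x in slab n (s k) (s k + 1), ‖u x - c‖ₑ ^ (2 : ℝ)) ^ (1 / 2 : ℝ) * B ^ (1 / 2 : ℝ) := by
    intro k
    refine (lintegral_sub_le_of_fderiv_growth (hΦ.contDiff.differentiable one_ne_zero) hΦ.convex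
      hΦ.nonneg hq0 hΦ.bound hum.restrict aestronglyMeasurable_const (ae_restrict_of_ae huS)
      (Eventually.of_forall fun _ => hc)).trans ?_
    gcongr
    rw [lintegral_const_mul' _ _ ENNReal.ofReal_ne_top, lintegral_add_right _ measurable_const,
      lintegral_add_left measurable_const]
    have e : volume (slab n (s k) (s k + 1)) = 1 := by rw [volume_slab]; simp
    simp only [lintegral_const, Measure.restrict_apply_univ, e, mul_one, hB]
    gcongr
    exact hM _
  have hint2 : ∀ k, Integrable
      (fun x => deriv Real.smoothTransition (x.1 - s k) * (Φ (u x) 0 - Φ c 0))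
      (volume.restrict (slab n (s k) (s k + 1))) ∧
      ‖∫ x in slab n (s k) (s k + 1),
        deriv Real.smoothTransition (x.1 - s k) * (Φ (u x) 0 - Φ c 0)‖ₑ ≤
      ENNReal.ofReal C * ∫⁻ x in slab n (s k) (s k + 1), ‖Φ (u x) - Φ c‖ₑ := by
    intro k
    have e1 : ∫⁻ x in slab n (s k) (s k + 1),
        ‖deriv Real.smoothTransition (x.1 - s k) * (Φ (u x) 0 - Φ c 0)‖ₑ ≤
        ENNReal.ofReal C * ∫⁻ x in slab n (s k) (s k + 1), ‖Φ (u x) - Φ c‖ₑ := by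
      rw [← lintegral_const_mul' _ _ ENNReal.ofReal_ne_top]
      refine lintegral_mono fun x => ?_
      rw [enorm_mul]
      refine mul_le_mul' ?_ ?_
      · rw [Real.enorm_eq_ofReal_abs]
        exact ENNReal.ofReal_le_ofReal (hC _)
      · rw [← ofReal_norm, ← ofReal_norm]
        exact ENNReal.ofReal_le_ofReal (PiLp.norm_apply_le (Φ (u x) - Φ c) 0)
    refine ⟨⟨?_, ?_⟩, (enorm_integral_le_lintegral_enorm _).trans e1⟩
    · exact (hηc k).aestronglyMeasurable.mul
        ((hΦ0.comp_aestronglyMeasurable hum.restrict).sub aestronglyMeasurable_const)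
    · refine lt_of_le_of_lt (e1.trans (mul_le_mul' le_rfl (hest k))) ?_
      refine ENNReal.mul_lt_top ENNReal.ofReal_lt_top (ENNReal.mul_lt_top ?_ ?_)
      · have h1 : MemLp (fun x => u x - c) 2 (volume.restrict (slab n (s k) (s k + 1))) :=
          (h.memLp_slab _ _).sub (memLp_const c)
        have h2 := lintegral_rpow_ne_top (q := 2) (by norm_num) (by simpa using h1)
        exact (ENNReal.rpow_ne_top_of_nonneg (by norm_num) h2).lt_top
      · exact (ENNReal.rpow_ne_top_of_nonneg (by norm_num) hBt).lt_top
  have hηint : ∀ k, Integrable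
      (fun x : Cylinder n => deriv Real.smoothTransition (x.1 - s k) * Φ c 0)
      (volume.restrict (slab n (s k) (s k + 1))) := fun k =>
    memLp_one_iff_integrable.1 (((hηc k).mul continuous_const).memLp_slab 1 _ _)
  have hsplit : ∀ k x, deriv Real.smoothTransition (x.1 - s k) * Φ (u x) 0 =
      deriv Real.smoothTransition (x.1 - s k) * (Φ (u x) 0 - Φ c 0) +
        deriv Real.smoothTransition (x.1 - s k) * Φ c 0 := fun k x => by ring
  constructor
  · intro k
    have h1 : IntegrableOn (fun x => deriv Real.smoothTransition (x.1 - s k) * Φ (u x) 0)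
        (slab n (s k) (s k + 1)) volume := by
      refine ((hint2 k).1.add (hηint k)).congr (Eventually.of_forall fun x => ?_)
      exact (hsplit k x).symm
    rw [← integrable_indicator_iff (measurableSet_slab _ _)] at h1
    refine h1.congr (Eventually.of_forall fun x => ?_)
    by_cases hx : x ∈ slab n (s k) (s k + 1)
    · exact Set.indicator_of_mem hx _
    · rw [Set.indicator_of_notMem hx]
      have h0 : deriv Real.smoothTransition (x.1 - s k) = 0 :=
        deriv_smoothTransition_eq_zero fun h => hx ⟨by linarith [h.1], by linarith [h.2]⟩
      simp only [h0, zero_mul]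
  · have h1 : ∀ k, ∫ x, deriv Real.smoothTransition (x.1 - s k) * Φ (u x) 0 =
        (∫ x in slab n (s k) (s k + 1),
          deriv Real.smoothTransition (x.1 - s k) * (Φ (u x) 0 - Φ c 0)) + Φ c 0 := by
      intro k
      rw [integral_shift_eq_setIntegral, integral_congr_ae (Eventually.of_forall (hsplit k)),
        integral_add (hint2 k).1 (hηint k), integral_mul_const]
      have e := integral_shift_eq_setIntegral (s k) (fun _ : Cylinder n => (1 : ℝ))
      simp only [mul_one] at e
      rw [← e, integral_deriv_smoothTransition_fst, one_mul]
    simp only [h1]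
    have h2 : Tendsto (fun k => ∫ x in slab n (s k) (s k + 1),
        deriv Real.smoothTransition (x.1 - s k) * (Φ (u x) 0 - Φ c 0)) atTop (𝓝 0) := by
      rw [tendsto_zero_iff_norm_tendsto_zero]
      have t1 := ((ENNReal.continuous_rpow_const (y := (1 / 2 : ℝ))).tendsto 0).comp hs
      rw [ENNReal.zero_rpow_of_pos (by norm_num)] at t1
      have t2 := ENNReal.Tendsto.mul_const t1 (b := B ^ (1 / 2 : ℝ))
        (Or.inr (ENNReal.rpow_ne_top_of_nonneg (by norm_num) hBt))
      have t3 := ENNReal.Tendsto.const_mul t2 (a := ENNReal.ofReal C) (Or.inr ENNReal.ofReal_ne_top)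
      rw [zero_mul, mul_zero] at t3
      have t4 : Tendsto (fun k => ‖∫ x in slab n (s k) (s k + 1),
          deriv Real.smoothTransition (x.1 - s k) * (Φ (u x) 0 - Φ c 0)‖ₑ) atTop (𝓝 0) :=
        tendsto_of_tendsto_of_tendsto_of_le_of_le tendsto_const_nhds t3 (fun _ => zero_le)
          fun k => (hint2 k).2.trans (mul_le_mul' le_rfl (hest k))
      have t5 := (ENNReal.tendsto_toReal ENNReal.zero_ne_top).comp t4
      simpa [Function.comp_def] using t5
    simpa using h2.add_const (Φ c 0)

lemma abs_intCast_tendsto : Tendsto (fun k : ℕ => |(k : ℝ)|) atTop atTop := by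
  simpa using tendsto_natCast_atTop_atTop

lemma abs_neg_sub_one_tendsto : Tendsto (fun k : ℕ => |(-(k : ℝ) - 1)|) atTop atTop := by
  refine tendsto_atTop_mono (fun k => ?_) tendsto_natCast_atTop_atTop
  rw [abs_of_nonpos (by linarith [(Nat.cast_nonneg k : (0 : ℝ) ≤ k)])]
  linarith

/-- The flux through the ends of the cylinder converges to `Φ₁(u⁺) - Φ₁(u⁻)`. -/
lemma tendsto_flux (h : IsSolenoidal u g) (hΦ : HasGrowthOn Φ S K q)
    (huS : ∀ᵐ x, u x ∈ S) (hl : HasLimits u q M um up) (hum : um ∈ S) (hup : up ∈ S) :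
    Tendsto (fun k : ℕ => -∫ x, plateauDeriv k x.1 * Φ (u x) 0) atTop
      (𝓝 (Φ up 0 - Φ um 0)) := by
  obtain ⟨i1, t1⟩ := h.tendsto_flux_shift hΦ huS hl.ne_top hl.bound hup hl.tendsto_top
  obtain ⟨i2, t2⟩ := h.tendsto_flux_shift hΦ huS hl.ne_top hl.bound hum hl.tendsto_bot
  refine (t1.sub t2).congr fun k => ?_
  rw [← integral_sub (i1 k) (i2 k), ← integral_neg]
  refine integral_congr_ae (Eventually.of_forall fun x => ?_)
  simp only [plateauDeriv]
  ring

/-- The boundary terms of the null-Lagrangian identity vanish at infinity. -/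
lemma tendsto_trace_flux (h : IsSolenoidal u g) (hq : 2 ≤ q) (hl : HasLimits u q M um up)
    (j : Fin (n + 1)) :
    Tendsto (fun k : ℕ => ∫ x, plateauDeriv k x.1 * (u x j * g j 0 x)) atTop (𝓝 0) := by
  obtain ⟨C, hC⟩ := exists_abs_deriv_smoothTransition_le
  have huj : ∀ a b, MemLp (fun x => u x j) 2 (volume.restrict (slab n a b)) := fun a b =>
    (EuclideanSpace.proj j : Vec (n + 1) →L[ℝ] ℝ).comp_memLp' (h.memLp_slab a b)
  have hηc : ∀ s : ℝ, Continuous fun x : Cylinder n => deriv Real.smoothTransition (x.1 - s) :=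
    fun k => continuous_deriv_smoothTransition.comp (continuous_fst.sub continuous_const)
  have hint : ∀ s : ℝ, Integrable
      (fun x => deriv Real.smoothTransition (x.1 - s) * (u x j * g j 0 x))
      volume := by
    intro s
    have h1 : IntegrableOn (fun x => deriv Real.smoothTransition (x.1 - s) * (u x j * g j 0 x))
        (slab n s (s + 1)) volume := by
      refine Integrable.bdd_mul (c := C) ?_ (hηc s).aestronglyMeasurable
        (Eventually.of_forall fun x => hC _)
      exact (huj s (s + 1)).integrable_mul ((h.memLp_grad j 0).restrict _)
    rw [← integrable_indicator_iff (measurableSet_slab _ _)] at h1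
    refine h1.congr (Eventually.of_forall fun x => ?_)
    by_cases hx : x ∈ slab n s (s + 1)
    · exact Set.indicator_of_mem hx _
    · rw [Set.indicator_of_notMem hx]
      have h0 : deriv Real.smoothTransition (x.1 - s) = 0 :=
        deriv_smoothTransition_eq_zero fun h => hx ⟨by linarith [h.1], by linarith [h.2]⟩
      simp only [h0, zero_mul]
  have key : ∀ s : ℕ → ℝ, Tendsto (fun k => |s k|) atTop atTop →
      Tendsto (fun k => ∫ x, deriv Real.smoothTransition (x.1 - s k) * (u x j * g j 0 x))
        atTop (𝓝 0) := by
    intro s hs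
    have hb : ∀ k, ‖∫ x, deriv Real.smoothTransition (x.1 - s k) * (u x j * g j 0 x)‖ₑ ≤
        ENNReal.ofReal C * ((1 + M) ^ (1 / 2 : ℝ) *
          (∫⁻ x in slab n (s k) (s k + 1), ‖g j 0 x‖ₑ ^ (2 : ℝ)) ^ (1 / 2 : ℝ)) := by
      intro k
      rw [integral_shift_eq_setIntegral]
      refine (enorm_integral_le_lintegral_enorm _).trans ?_
      calc ∫⁻ x in slab n (s k) (s k + 1),
            ‖deriv Real.smoothTransition (x.1 - s k) * (u x j * g j 0 x)‖ₑ
          ≤ ∫⁻ x in slab n (s k) (s k + 1), ENNReal.ofReal C * (‖u x j‖ₑ * ‖g j 0 x‖ₑ) := by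
            refine lintegral_mono fun x => ?_
            rw [enorm_mul, enorm_mul]
            refine mul_le_mul' ?_ le_rfl
            rw [Real.enorm_eq_ofReal_abs]
            exact ENNReal.ofReal_le_ofReal (hC _)
        _ = ENNReal.ofReal C * ∫⁻ x in slab n (s k) (s k + 1), ‖u x j‖ₑ * ‖g j 0 x‖ₑ :=
            lintegral_const_mul' _ _ ENNReal.ofReal_ne_top
        _ ≤ _ := by
            refine mul_le_mul' le_rfl ((ENNReal.lintegral_mul_le_Lp_mul_Lq _
              Real.HolderConjugate.two_two (huj _ _).1.enorm
              (h.memLp_grad j 0).1.restrict.enorm).trans ?_)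
            refine mul_le_mul' (ENNReal.rpow_le_rpow ?_ (by norm_num)) le_rfl
            calc ∫⁻ x in slab n (s k) (s k + 1), ‖u x j‖ₑ ^ (2 : ℝ)
                ≤ ∫⁻ x in slab n (s k) (s k + 1), (1 + ‖u x‖ₑ ^ q) := by
                  refine lintegral_mono fun x => ?_
                  have e1 : ‖u x j‖ₑ ≤ ‖u x‖ₑ := by
                    rw [← ofReal_norm, ← ofReal_norm]
                    exact ENNReal.ofReal_le_ofReal (PiLp.norm_apply_le (u x) j)
                  refine (ENNReal.rpow_le_rpow e1 (by norm_num)).trans ?_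
                  rcases le_total ‖u x‖ₑ 1 with h1 | h1
                  · exact (ENNReal.rpow_le_one h1 (by norm_num)).trans le_self_add
                  · exact (ENNReal.rpow_le_rpow_of_exponent_le h1 hq).trans le_add_self
              _ ≤ 1 + M := by
                  rw [lintegral_add_left measurable_const]
                  refine add_le_add ?_ (hl.bound _)
                  simp [volume_slab]
    have hfin : ∫⁻ x, ‖g j 0 x‖ₑ ^ (2 : ℝ) ≠ ∞ :=
      lintegral_rpow_ne_top (by norm_num) (by simpa using h.memLp_grad j 0)
    have t0 := tendsto_setLIntegral_slab_zero hfin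
      ((h.memLp_grad j 0).1.enorm.pow_const _) hs
    have t1 := ((ENNReal.continuous_rpow_const (y := (1 / 2 : ℝ))).tendsto 0).comp t0
    rw [ENNReal.zero_rpow_of_pos (by norm_num)] at t1
    have t2 := ENNReal.Tendsto.const_mul t1 (a := (1 + M) ^ (1 / 2 : ℝ))
      (Or.inr (ENNReal.rpow_ne_top_of_nonneg (by norm_num) (by simp [hl.ne_top])))
    have t3 := ENNReal.Tendsto.const_mul t2 (a := ENNReal.ofReal C) (Or.inr ENNReal.ofReal_ne_top)
    rw [mul_zero, mul_zero] at t3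
    have t4 := tendsto_of_tendsto_of_tendsto_of_le_of_le tendsto_const_nhds t3
      (fun _ => zero_le) hb
    rw [tendsto_zero_iff_norm_tendsto_zero]
    have t5 := (ENNReal.tendsto_toReal ENNReal.zero_ne_top).comp t4
    simpa [Function.comp_def] using t5
  have h1 := (key _ abs_neg_sub_one_tendsto).sub (key _ abs_intCast_tendsto)
  rw [sub_zero] at h1
  refine h1.congr fun k => ?_
  rw [← integral_sub (hint _) (hint _)]
  refine integral_congr_ae (Eventually.of_forall fun x => ?_)
  simp only [plateauDeriv]
  ring

end IsSolenoidal

/-! ### Rigidity of calibrated fields -/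

/-- Completing the square: twice the gap between energy and calibration is a sum of squares. -/
lemma sum_sq_eq_of_symm {ι : Type*} [Fintype ι] {A : ι → ι → ℝ} (W : ι → ι → ℝ)
    (hA : ∀ i j, A i j = A j i) :
    (1 / 4) * ∑ i, ∑ j, (W i j + W j i - A i j) ^ 2 =
      (1 / 2) * ∑ i, ∑ j, W i j ^ 2 + (1 / 4) * ∑ i, ∑ j, A i j ^ 2 - ∑ i, ∑ j, A i j * W i j +
        (1 / 2) * ∑ j, ∑ i, W i j * W j i := by
  have e1 : ∑ i, ∑ j, W j i ^ 2 = ∑ i, ∑ j, W i j ^ 2 := Finset.sum_comm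
  have e2 : ∑ i, ∑ j, A i j * W j i = ∑ i, ∑ j, A i j * W i j := by
    rw [Finset.sum_comm]
    simp only [fun i j => hA j i]
  have e3 : ∑ j, ∑ i, W i j * W j i = ∑ i, ∑ j, W i j * W j i := Finset.sum_comm
  have e4 : ∑ i, ∑ j, (W i j + W j i - A i j) ^ 2 = ∑ i, ∑ j, W i j ^ 2 + ∑ i, ∑ j, W j i ^ 2 +
      ∑ i, ∑ j, A i j ^ 2 + 2 * ∑ i, ∑ j, W i j * W j i - 2 * ∑ i, ∑ j, A i j * W i j -
      2 * ∑ i, ∑ j, A i j * W j i := by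
    simp only [Finset.mul_sum, ← Finset.sum_add_distrib, ← Finset.sum_sub_distrib]
    refine Finset.sum_congr rfl fun i _ => Finset.sum_congr rfl fun j _ => by ring
  rw [e4, e1, e2, e3]
  ring

lemma sum_sum_eq_two_mul_sum_Ioi {d : ℕ} {B : Fin d → Fin d → ℝ} (hB : ∀ i j, B i j = B j i)
    (h0 : ∀ i, B i i = 0) : ∑ i, ∑ j, B i j = 2 * ∑ i, ∑ j ∈ Finset.Ioi i, B i j := by
  have h1 : ∀ i, ∑ j, B i j =
      ∑ j, (if i < j then B i j else 0) + ∑ j, if j < i then B i j else 0 := by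
    intro i
    rw [← Finset.sum_add_distrib]
    refine Finset.sum_congr rfl fun j _ => ?_
    rcases lt_trichotomy i j with h | h | h
    · simp [h, h.not_gt]
    · subst h; simp [h0]
    · simp [h, h.not_gt]
  have h2 : ∀ i, ∑ j, (if i < j then B i j else 0) = ∑ j ∈ Finset.Ioi i, B i j := by
    intro i
    rw [← Finset.sum_filter]
    refine Finset.sum_congr ?_ fun _ _ => rfl
    ext j; simp
  simp only [h1, Finset.sum_add_distrib]
  have h3 : ∑ i, ∑ j, (if j < i then B i j else 0) = ∑ i, ∑ j, if i < j then B i j else 0 := by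
    rw [Finset.sum_comm]
    simp only [fun i j => hB j i]
  rw [h3]
  simp only [h2]
  ring

lemma offDiag_symm {d : ℕ} {Φ : Vec d → Vec d} (hsymm : ∀ z i j, jac Φ i j z = jac Φ j i z)
    (z : Vec d) (i j : Fin d) : offDiag Φ i j z = offDiag Φ j i z := by
  unfold offDiag
  by_cases h : i = j
  · simp [h]
  · rw [if_neg h, if_neg (Ne.symm h), hsymm]

lemma potential_eq_sum_offDiag {d : ℕ} {Φ : Vec d → Vec d}
    (hsymm : ∀ z i j, jac Φ i j z = jac Φ j i z) (z : Vec d) :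
    potential Φ z = (1 / 4) * ∑ i, ∑ j, offDiag Φ i j z ^ 2 := by
  rw [sum_sum_eq_two_mul_sum_Ioi (B := fun i j => offDiag Φ i j z ^ 2)
    (fun i j => by rw [offDiag_symm hsymm]) (fun i => by simp [offDiag]), potential, ← mul_assoc]
  norm_num
  refine Finset.sum_congr rfl fun i _ => Finset.sum_congr rfl fun j hj => ?_
  rw [offDiag, if_neg (Finset.mem_Ioi.1 hj).ne]

lemma potential_nonneg {d : ℕ} (Φ : Vec d → Vec d) (z : Vec d) : 0 ≤ potential Φ z := by
  unfold potential; positivity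

lemma continuous_potential {n : ℕ} {Φ : Vec (n + 1) → Vec (n + 1)} (hΦ : ContDiff ℝ 1 Φ) :
    Continuous (potential Φ) :=
  continuous_const.mul (continuous_finsetSum _ fun i _ => continuous_finsetSum _ fun j _ =>
    (IsSolenoidal.continuous_jac hΦ i j).pow 2)

namespace IsSolenoidal
variable {n : ℕ} {u : Cylinder n → Vec (n + 1)} {g : Fin (n + 1) → Fin (n + 1) → Cylinder n → ℝ}
  {Φ : Vec (n + 1) → Vec (n + 1)} {S : Set (Vec (n + 1))} {K q : ℝ}
  {um up : Vec (n + 1)} {M : ℝ≥0∞}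

/-- If `∂₁ u₁ = 0`, then `u₁` is constant: its derivatives do not depend on `x₁` and are square
integrable. -/
lemma grad_first_eq_zero (h : IsSolenoidal u g) (h0 : g 0 0 =ᵐ[volume] 0) (j : Fin (n + 1)) :
    g j 0 =ᵐ[volume] 0 := by
  obtain ⟨ρ, hρ⟩ := exists_isMollifier n
  have hg := h.memLp_grad j 0
  have t := hρ.tendsto_lintegral (f := g j 0) (q := 2) (by norm_num) (by simpa using hg)
  have hfin : ∫⁻ x, ‖g j 0 x‖ₑ ^ (2 : ℝ) ≠ ∞ :=
    lintegral_rpow_ne_top (by norm_num) (by simpa using hg)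
  have hz : ∀ᶠ k in atTop, moll (ρ k) (g j 0) = 0 := by
    filter_upwards [t.eventually_lt_const ENNReal.zero_lt_top] with k hk
    have hk' := (hρ.kernel k).test
    refine lintegral_slab_eq_zero_of_invariant (h.continuous_moll_grad hk' j 0) ?_ ?_
    · intro x s
      have hd : moll (partialDeriv 0 (ρ k)) (g j 0) = 0 := by
        rw [← (h.weak j 0).moll_partialDeriv (hk'.partialDeriv 0), hk'.partialDeriv_comm,
          (h.weak 0 0).moll_partialDeriv (hk'.partialDeriv j), moll_congr_ae h0]
        funext x; simp [moll]
      have := (Cylinder.hasPartial_moll hk' (h.weak j 0).locInt_deriv 0).sub_eq_integral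
        (h.continuous_moll_grad (hk'.partialDeriv 0) j 0) x s
      rw [hd] at this
      simpa [sub_eq_zero] using this
    · have h1 : ∫⁻ x, ‖moll (ρ k) (g j 0) x‖ₑ ^ (2 : ℝ) ≤
          ∫⁻ x, 2 * (‖g j 0 x‖ₑ ^ (2 : ℝ) + ‖g j 0 x - moll (ρ k) (g j 0) x‖ₑ ^ (2 : ℝ)) := by
        refine lintegral_mono fun x => ?_
        have e : moll (ρ k) (g j 0) x = g j 0 x - (g j 0 x - moll (ρ k) (g j 0) x) := by ring
        have e1 : ‖moll (ρ k) (g j 0) x‖ₑ ≤ ‖g j 0 x‖ₑ + ‖g j 0 x - moll (ρ k) (g j 0) x‖ₑ := by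
          conv_lhs => rw [e]
          exact enorm_sub_le
        refine (ENNReal.rpow_le_rpow e1 (by norm_num)).trans ?_
        refine (ENNReal.rpow_add_le_mul_rpow_add_rpow _ _ (by norm_num : (1 : ℝ) ≤ 2)).trans ?_
        norm_num
      refine ne_top_of_le_ne_top ?_ h1
      rw [lintegral_const_mul' _ _ (by simp), lintegral_add_left' (hg.1.enorm.pow_const _)]
      exact ENNReal.mul_ne_top (by simp) (ENNReal.add_ne_top.2 ⟨hfin, hk.ne⟩)
  have t' : Tendsto (fun _ : ℕ => ∫⁻ x, ‖g j 0 x‖ₑ ^ (2 : ℝ)) atTop (𝓝 0) := by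
    refine t.congr' (hz.mono fun k hk => ?_)
    simp [hk]
  have h3 := tendsto_nhds_unique t' tendsto_const_nhds
  rw [eq_comm, lintegral_eq_zero_iff' (hg.1.enorm.pow_const _)] at h3
  filter_upwards [h3] with x hx
  have hx' : ‖g j 0 x‖ₑ ^ (2 : ℝ) = 0 := hx
  simpa using hx'

/-- A solenoidal field joining `um` to `up` whose energy does not exceed the flux
`Φ₁(u⁺) - Φ₁(u⁻)` of the calibration has vanishing derivatives in the directions of the torus. -/
theorem grad_succ_eq_zero (h : IsSolenoidal u g) (hΦ : HasGrowthOn Φ S K q)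
    (hsymm : ∀ z i j, jac Φ i j z = jac Φ j i z) (hdiag : ∀ z i j, jac Φ i i z = jac Φ j j z)
    (huS : ∀ᵐ x, u x ∈ S) (hl : HasLimits u q M um up) (hum : um ∈ S) (hup : up ∈ S)
    (hD : 0 ≤ Φ up 0 - Φ um 0)
    (hE : ∫⁻ x, ENNReal.ofReal ((1 / 2) * (∑ i, ∑ j, g i j x ^ 2) + potential Φ (u x)) ≤
      ENNReal.ofReal (Φ up 0 - Φ um 0)) (k : Fin n) (j : Fin (n + 1)) :
    g k.succ j =ᵐ[volume] 0 := by
  have hq0 : 0 < q := by linarith [hΦ.two_le]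
  have humeas : AEStronglyMeasurable u volume := h.locallyIntegrable.aestronglyMeasurable
  have huq := memLp_slab_of_le hq0 hl.ne_top humeas hl.bound
  set e : Cylinder n → ℝ := fun x => (1 / 2) * (∑ i, ∑ j, g i j x ^ 2) + potential Φ (u x) with he
  have he0 : ∀ x, 0 ≤ e x := fun x => add_nonneg (by positivity) (potential_nonneg Φ _)
  have hPm : AEStronglyMeasurable (fun x => potential Φ (u x)) volume :=
    (continuous_potential hΦ.contDiff).comp_aestronglyMeasurable humeas
  have hgsq : ∀ i j, Integrable (fun x => g i j x ^ 2) volume := fun i j =>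
    (h.memLp_grad i j).integrable_sq
  have hgsum : Integrable (fun x => (1 / 2) * (∑ i, ∑ j, g i j x ^ 2)) volume :=
    (integrable_finsetSum _ fun i _ => integrable_finsetSum _ fun j _ => hgsq i j).const_mul _
  have hem : AEStronglyMeasurable e volume := hgsum.1.add hPm
  have heint : Integrable e volume := by
    refine ⟨hem, (hasFiniteIntegral_iff_ofReal (Eventually.of_forall he0)).2 ?_⟩
    exact hE.trans_lt ENNReal.ofReal_lt_top
  have heD : ∫ x, e x ≤ Φ up 0 - Φ um 0 := by
    rw [← ofReal_integral_eq_lintegral_ofReal heint (Eventually.of_forall he0)] at hE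
    exact (ENNReal.ofReal_le_ofReal_iff hD).1 hE
  have hPint : Integrable (fun x => potential Φ (u x)) volume := by
    refine (heint.sub hgsum).congr (Eventually.of_forall fun x => ?_)
    simp [he]
  have hAsym : ∀ x i j, offDiag Φ i j (u x) = offDiag Φ j i (u x) := fun x => offDiag_symm hsymm _
  have hA : ∀ i j, MemLp (fun x => offDiag Φ i j (u x)) 2 volume := by
    intro i j
    have hm : AEStronglyMeasurable (fun x => offDiag Φ i j (u x)) volume :=
      (continuous_offDiag hΦ.contDiff i j).comp_aestronglyMeasurable humeas
    rw [memLp_two_iff_integrable_sq hm]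
    refine (hPint.const_mul 4).mono' (hm.pow 2) (Eventually.of_forall fun x => ?_)
    rw [Real.norm_of_nonneg (sq_nonneg _), potential_eq_sum_offDiag hsymm]
    have h1 : offDiag Φ i j (u x) ^ 2 ≤ ∑ i, ∑ j, offDiag Φ i j (u x) ^ 2 :=
      (Finset.single_le_sum (f := fun j => offDiag Φ i j (u x) ^ 2) (fun _ _ => sq_nonneg _)
        (Finset.mem_univ j)).trans
      (Finset.single_le_sum (f := fun i => ∑ j, offDiag Φ i j (u x) ^ 2)
        (fun _ _ => Finset.sum_nonneg fun _ _ => sq_nonneg _) (Finset.mem_univ i))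
    linarith
  have hAg : ∀ i j, Integrable (fun x => offDiag Φ i j (u x) * g i j x) volume := fun i j =>
    (hA i j).integrable_mul (h.memLp_grad i j)
  have hgg : ∀ i j, Integrable (fun x => g i j x * g j i x) volume := fun i j =>
    (h.memLp_grad i j).integrable_mul (h.memLp_grad j i)
  have hcut : ∀ k : ℕ, IsCutoff (-(k : ℝ) - 1) (k + 1) (plateau k) (plateauDeriv k) :=
    fun k => isCutoff_plateau (Nat.cast_nonneg k)
  have hflux := h.tendsto_flux hΦ huS hl hum hup
  -- let the cutoff exhaust the cylinder
  have hI1 : ∑ i, ∑ j, ∫ x, offDiag Φ i j (u x) * g i j x = Φ up 0 - Φ um 0 :=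
    tendsto_nhds_unique
      ((tendsto_finsetSum _ fun i _ => tendsto_finsetSum _ fun j _ =>
        tendsto_integral_plateau_mul (hAg i j)).congr fun k =>
          h.calibration_identity hΦ hsymm hdiag huS huq (hcut k)) hflux
  have hI2 : ∑ j, ∑ i, ∫ x, g i j x * g j i x = 0 := by
    refine tendsto_nhds_unique
      ((tendsto_finsetSum _ fun j _ => tendsto_finsetSum _ fun i _ =>
        tendsto_integral_plateau_mul (hgg i j)).congr fun k => h.trace_identity (hcut k)) ?_
    simpa using (tendsto_finsetSum (Finset.univ : Finset (Fin (n + 1))) fun j _ =>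
      h.tendsto_trace_flux hΦ.two_le hl j).neg
  -- completing the square
  have hsq : ∀ x, (1 / 4) * ∑ i, ∑ j, (g i j x + g j i x - offDiag Φ i j (u x)) ^ 2 =
      e x - ∑ i, ∑ j, offDiag Φ i j (u x) * g i j x + (1 / 2) * ∑ j, ∑ i, g i j x * g j i x := by
    intro x
    rw [sum_sq_eq_of_symm (fun i j => g i j x) (hAsym x), he]
    simp only [potential_eq_sum_offDiag hsymm]
  have hintAg : Integrable (fun x => ∑ i, ∑ j, offDiag Φ i j (u x) * g i j x) volume :=
    integrable_finsetSum _ fun i _ => integrable_finsetSum _ fun j _ => hAg i j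
  have hintgg : Integrable (fun x => (1 / 2) * ∑ j, ∑ i, g i j x * g j i x) volume :=
    (integrable_finsetSum _ fun j _ => integrable_finsetSum _ fun i _ => hgg i j).const_mul _
  have hI3 : ∫ x, (e x - ∑ i, ∑ j, offDiag Φ i j (u x) * g i j x +
      (1 / 2) * ∑ j, ∑ i, g i j x * g j i x) ≤ 0 := by
    have i1 : Integrable (fun x => e x - ∑ i, ∑ j, offDiag Φ i j (u x) * g i j x) volume :=
      heint.sub hintAg
    rw [integral_add i1 hintgg, integral_sub heint hintAg, integral_const_mul,
      integral_finsetSum _ fun i _ => integrable_finsetSum _ fun j _ => hAg i j,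
      integral_finsetSum _ fun j _ => integrable_finsetSum _ fun i _ => hgg i j]
    simp only [integral_finsetSum _ fun j _ => hAg _ j, integral_finsetSum _ fun i _ => hgg i _]
    rw [hI1, hI2]
    linarith
  have hzero : ∀ᵐ x, e x - ∑ i, ∑ j, offDiag Φ i j (u x) * g i j x +
      (1 / 2) * ∑ j, ∑ i, g i j x * g j i x = 0 := by
    have h0 : ∀ x, 0 ≤ e x - ∑ i, ∑ j, offDiag Φ i j (u x) * g i j x +
        (1 / 2) * ∑ j, ∑ i, g i j x * g j i x := fun x => by rw [← hsq]; positivity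
    have h1 := (integral_eq_zero_iff_of_nonneg h0 ((heint.sub hintAg).add hintgg)).1
      (le_antisymm hI3 (integral_nonneg h0))
    exact h1
  have hrel : ∀ᵐ x, ∀ i j, g i j x + g j i x = offDiag Φ i j (u x) := by
    filter_upwards [hzero] with x hx i j
    rw [← hsq] at hx
    have h1 : ∑ i, ∑ j, (g i j x + g j i x - offDiag Φ i j (u x)) ^ 2 = 0 := by linarith
    rw [Finset.sum_eq_zero_iff_of_nonneg fun _ _ => Finset.sum_nonneg fun _ _ => sq_nonneg _] at h1
    have h2 := h1 i (Finset.mem_univ i)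
    rw [Finset.sum_eq_zero_iff_of_nonneg fun _ _ => sq_nonneg _] at h2
    have h3 := pow_eq_zero_iff (two_ne_zero) |>.1 (h2 j (Finset.mem_univ j))
    linarith
  -- the diagonal of `offDiag` vanishes
  have h00 : g 0 0 =ᵐ[volume] 0 := by
    filter_upwards [hrel] with x hx
    have := hx 0 0
    simp only [offDiag, if_true] at this
    simp only [Pi.zero_apply]
    linarith
  have hj0 : ∀ᵐ x, ∀ j, g j 0 x = 0 :=
    ae_all_iff.2 fun j => h.grad_first_eq_zero h00 j
  have hI4 : ∑ j, ∫ x, offDiag Φ 0 j (u x) * g 0 j x = Φ up 0 - Φ um 0 :=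
    tendsto_nhds_unique
      ((tendsto_finsetSum _ fun j _ => tendsto_integral_plateau_mul (hAg 0 j)).congr fun k =>
          h.first_component_identity hΦ hsymm huS huq (hcut k) h00) hflux
  -- the energy density of the derivatives along the torus is bounded by the remaining gap
  have hlow : ∀ᵐ x, (1 / 2) * g k.succ j x ^ 2 ≤ e x - ∑ j, offDiag Φ 0 j (u x) * g 0 j x := by
    filter_upwards [hrel, hj0] with x hx hx0
    have h1 : ∀ j, offDiag Φ 0 j (u x) = g 0 j x := fun j => by rw [← hx 0 j, hx0 j, add_zero]
    have h2 : ∑ i, ∑ j, g i j x ^ 2 =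
        ∑ j, g 0 j x ^ 2 + ∑ i : Fin n, ∑ j, g i.succ j x ^ 2 := Fin.sum_univ_succ _
    have h3 : g k.succ j x ^ 2 ≤ ∑ i : Fin n, ∑ j, g i.succ j x ^ 2 :=
      (Finset.single_le_sum (f := fun j => g k.succ j x ^ 2) (fun _ _ => sq_nonneg _)
        (Finset.mem_univ j)).trans
      (Finset.single_le_sum (f := fun i : Fin n => ∑ j, g i.succ j x ^ 2)
        (fun _ _ => Finset.sum_nonneg fun _ _ => sq_nonneg _) (Finset.mem_univ k))
    have h4 : 2 * ∑ j, g 0 j x ^ 2 ≤ ∑ i, ∑ j, offDiag Φ i j (u x) ^ 2 := by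
      have e1 : ∑ i, ∑ j, offDiag Φ i j (u x) ^ 2 =
          ∑ j, offDiag Φ 0 j (u x) ^ 2 + ∑ i : Fin n, ∑ j, offDiag Φ i.succ j (u x) ^ 2 :=
        Fin.sum_univ_succ _
      have e2 : ∑ j, g 0 j x ^ 2 = g 0 0 x ^ 2 + ∑ i : Fin n, g 0 i.succ x ^ 2 :=
        Fin.sum_univ_succ _
      have e3 : ∑ j, offDiag Φ 0 j (u x) ^ 2 = ∑ j, g 0 j x ^ 2 :=
        Finset.sum_congr rfl fun j _ => by rw [h1]
      have e4 : ∑ i : Fin n, g 0 i.succ x ^ 2 ≤ ∑ i : Fin n, ∑ j, offDiag Φ i.succ j (u x) ^ 2 := by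
        refine Finset.sum_le_sum fun i _ => ?_
        rw [← h1, hAsym]
        exact Finset.single_le_sum (f := fun j => offDiag Φ i.succ j (u x) ^ 2)
          (fun _ _ => sq_nonneg _) (Finset.mem_univ 0)
      rw [hx0 0] at e2
      linarith
    have h5 : ∑ j, offDiag Φ 0 j (u x) * g 0 j x = ∑ j, g 0 j x ^ 2 :=
      Finset.sum_congr rfl fun j _ => by rw [h1]; ring
    simp only [he]
    rw [potential_eq_sum_offDiag hsymm, h5, h2]
    linarith
  have hI5 : ∫ x, (1 / 2) * g k.succ j x ^ 2 ≤ 0 := by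
    have hi : Integrable (fun x => ∑ j, offDiag Φ 0 j (u x) * g 0 j x) volume :=
      integrable_finsetSum _ fun j _ => hAg 0 j
    refine (integral_mono_ae ((hgsq _ _).const_mul _) (heint.sub hi) hlow).trans ?_
    simp only [Pi.sub_apply]
    rw [integral_sub heint hi, integral_finsetSum _ fun j _ => hAg 0 j, hI4]
    linarith
  have h0 : ∀ x, 0 ≤ (1 / 2) * g k.succ j x ^ 2 := fun x => by positivity
  have h1 := (integral_eq_zero_iff_of_nonneg h0 ((hgsq _ _).const_mul _)).1
    (le_antisymm hI5 (integral_nonneg h0))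
  filter_upwards [h1] with x hx
  simpa using hx

end IsSolenoidal

/-! ### The Poincaré inequality on the torus slices -/

lemma enorm_add_sq_le {E : Type*} [NormedAddCommGroup E] (a b : E) :
    ‖a + b‖ₑ ^ (2 : ℝ) ≤ 2 * (‖a‖ₑ ^ (2 : ℝ) + ‖b‖ₑ ^ (2 : ℝ)) := by
  refine (ENNReal.rpow_le_rpow (enorm_add_le a b) (by norm_num)).trans ?_
  refine (ENNReal.rpow_add_le_mul_rpow_add_rpow _ _ (by norm_num : (1 : ℝ) ≤ 2)).trans ?_
  norm_num

lemma lintegral_enorm_add_sq_le {X E : Type*} [MeasurableSpace X] [NormedAddCommGroup E]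
    {μ : Measure X} {f g : X → E} (hf : AEStronglyMeasurable f μ) :
    ∫⁻ x, ‖f x + g x‖ₑ ^ (2 : ℝ) ∂μ ≤
      2 * ((∫⁻ x, ‖f x‖ₑ ^ (2 : ℝ) ∂μ) + ∫⁻ x, ‖g x‖ₑ ^ (2 : ℝ) ∂μ) := by
  rw [← lintegral_add_left' (hf.enorm.pow_const _), ← lintegral_const_mul' _ _ (by simp)]
  exact lintegral_mono fun x => enorm_add_sq_le _ _

lemma enorm_vec_sq {m : ℕ} (v : Vec m) : ‖v‖ₑ ^ (2 : ℝ) = ∑ j, ‖v j‖ₑ ^ (2 : ℝ) := by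
  have h : ∀ {F : Type} [NormedAddCommGroup F] (w : F),
      ‖w‖ₑ ^ (2 : ℝ) = ENNReal.ofReal (‖w‖ ^ 2) := fun w => by
    rw [← ofReal_norm, ENNReal.ofReal_rpow_of_nonneg (norm_nonneg _) (by norm_num), Real.rpow_two]
  rw [h, EuclideanSpace.norm_sq_eq, ENNReal.ofReal_sum_of_nonneg fun _ _ => sq_nonneg _]
  simp only [h]

instance torus_isNegInvariant (n : ℕ) : (volume : Measure (Torus n)).IsNegInvariant :=
  have : (volume : Measure (Torus n)).Regular :=
    Measure.Regular.of_sigmaCompactSpace_of_isLocallyFiniteMeasure _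
  inferInstance

namespace Cylinder
variable {n : ℕ}

lemma measurePreserving_slab_add (a b : ℝ) {p : Cylinder n} (hp : p.1 = 0) :
    MeasurePreserving (fun x => x + p) (volume.restrict (slab n a b))
      (volume.restrict (slab n a b)) := by
  have h := (measurePreserving_add_right volume p).restrict_preimage
    (measurableSet_slab (n := n) a b)
  have e : (fun x => x + p) ⁻¹' slab n a b = slab n a b := by
    ext x; simp [slab, hp]
  rwa [e] at h

lemma setLIntegral_slab_comp_add (a b : ℝ) {p : Cylinder n} (hp : p.1 = 0)
    (F : Cylinder n → ℝ≥0∞) :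
    ∫⁻ x in slab n a b, F (x + p) = ∫⁻ x in slab n a b, F x :=
  (measurePreserving_slab_add a b hp).lintegral_comp_emb
    (Homeomorph.addRight p).measurableEmbedding F

/-- Translating a smooth function along a circle of the torus costs at most its derivative. -/
lemma HasPartial.setLIntegral_translate_le {k : Fin n} {F F' : Cylinder n → ℝ}
    (h : HasPartial k.succ F F') (hF' : Continuous F') (a b : ℝ) {s : ℝ}
    (hs : s ∈ Set.Icc (0 : ℝ) 1) :
    ∫⁻ x in slab n a b, ‖F (x + dir k.succ s) - F x‖ₑ ^ (2 : ℝ) ≤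
      ∫⁻ x in slab n a b, ‖F' x‖ₑ ^ (2 : ℝ) := by
  set ν : Measure ℝ := volume.restrict (Set.Ioc 0 1) with hν
  have hνp : IsProbabilityMeasure ν := ⟨by simp [hν]⟩
  have hc : Continuous fun p : Cylinder n × ℝ => F' (p.1 + dir k.succ p.2) :=
    hF'.comp (continuous_fst.add ((continuous_dir _).comp continuous_snd))
  have h1 : ∀ x, ‖F (x + dir k.succ s) - F x‖ₑ ^ (2 : ℝ) ≤
      ∫⁻ t, ‖F' (x + dir k.succ t)‖ₑ ^ (2 : ℝ) ∂ν := by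
    intro x
    have hcx : Continuous fun t => F' (x + dir k.succ t) :=
      hF'.comp (continuous_const.add (continuous_dir _))
    have e : ∫ t in (0 : ℝ)..s, F' (x + dir k.succ t) =
        ∫ t, (Set.Ioc 0 s).indicator (fun t => F' (x + dir k.succ t)) t ∂ν := by
      rw [intervalIntegral.integral_of_le hs.1, hν, setIntegral_indicator measurableSet_Ioc,
        Set.Ioc_inter_Ioc]
      simp [hs.2]
    rw [h.sub_eq_integral hF', e]
    refine (enorm_integral_rpow_le ν
      (hcx.aestronglyMeasurable.indicator measurableSet_Ioc) (by norm_num)).trans ?_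
    refine lintegral_mono fun t => ENNReal.rpow_le_rpow ?_ (by norm_num)
    exact enorm_indicator_le_enorm_self _ _
  calc ∫⁻ x in slab n a b, ‖F (x + dir k.succ s) - F x‖ₑ ^ (2 : ℝ)
      ≤ ∫⁻ x in slab n a b, (∫⁻ t, ‖F' (x + dir k.succ t)‖ₑ ^ (2 : ℝ) ∂ν) := lintegral_mono h1
    _ = ∫⁻ t, (∫⁻ x in slab n a b, ‖F' (x + dir k.succ t)‖ₑ ^ (2 : ℝ)) ∂ν :=
        lintegral_lintegral_swap (hc.enorm.measurable.pow_const _).aemeasurable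
    _ = ∫⁻ _, (∫⁻ x in slab n a b, ‖F' x‖ₑ ^ (2 : ℝ)) ∂ν :=
        lintegral_congr fun t => setLIntegral_slab_comp_add a b (dir_succ_fst k t)
          (fun x => ‖F' x‖ₑ ^ (2 : ℝ))
    _ = _ := by simp

/-- The translation estimate `HasPartial.setLIntegral_translate_le` for weak derivatives. The
constant `8` is not sharp: it comes from splitting off the errors of mollification by
`|a + b|² ≤ 2 (|a|² + |b|²)`. -/
lemma setLIntegral_slab_translate_le {k : Fin n} {f G : Cylinder n → ℝ}
    (h : IsWeakPartial k.succ f G) (hf : ∀ a b, MemLp f 2 (volume.restrict (slab n a b)))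
    (hG : ∀ a b, MemLp G 2 (volume.restrict (slab n a b))) (a b : ℝ) {s : ℝ}
    (hs : s ∈ Set.Icc (0 : ℝ) 1) :
    ∫⁻ x in slab n a b, ‖f (x + dir k.succ s) - f x‖ₑ ^ (2 : ℝ) ≤
      8 * ∫⁻ x in slab n a b, ‖G x‖ₑ ^ (2 : ℝ) := by
  obtain ⟨ρ, hρ⟩ := exists_isMollifier n
  have t1 := hρ.tendsto_setLIntegral_slab (f := f) (q := 2) (by norm_num)
    (fun a b => by simpa using hf a b) a b
  have t2 := hρ.tendsto_setLIntegral_slab (f := G) (q := 2) (by norm_num)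
    (fun a b => by simpa using hG a b) a b
  set I := ∫⁻ x in slab n a b, ‖G x‖ₑ ^ (2 : ℝ)
  have hb : ∀ m, ∫⁻ x in slab n a b, ‖f (x + dir k.succ s) - f x‖ₑ ^ (2 : ℝ) ≤
      8 * (∫⁻ x in slab n a b, ‖f x - moll (ρ m) f x‖ₑ ^ (2 : ℝ)) +
      4 * (2 * (I + ∫⁻ x in slab n a b, ‖G x - moll (ρ m) G x‖ₑ ^ (2 : ℝ))) := by
    intro m
    have hm := (hρ.kernel m).test
    have cw : Continuous (moll (ρ m) f) := Cylinder.continuous_moll hm h.locInt_fun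
    have cG : Continuous (moll (ρ m) G) := Cylinder.continuous_moll hm h.locInt_deriv
    have mr : AEStronglyMeasurable (fun x => f x - moll (ρ m) f x) (volume.restrict (slab n a b)) :=
      (hf a b).1.sub cw.aestronglyMeasurable
    have mr' : AEStronglyMeasurable
        (fun x => f (x + dir k.succ s) - moll (ρ m) f (x + dir k.succ s))
        (volume.restrict (slab n a b)) :=
      mr.comp_measurePreserving (measurePreserving_slab_add a b (dir_succ_fst k s))
    have e : ∀ x, f (x + dir k.succ s) - f x =
        ((f (x + dir k.succ s) - moll (ρ m) f (x + dir k.succ s)) + -(f x - moll (ρ m) f x)) +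
          (moll (ρ m) f (x + dir k.succ s) - moll (ρ m) f x) := fun x => by ring
    simp only [e]
    refine (lintegral_enorm_add_sq_le (mr'.add mr.neg)).trans ?_
    have b1 := lintegral_enorm_add_sq_le (μ := volume.restrict (slab n a b))
      (g := fun x => -(f x - moll (ρ m) f x)) mr'
    have b2 := (h.hasPartial_moll hm).setLIntegral_translate_le cG a b hs
    have b3 := lintegral_enorm_add_sq_le (μ := volume.restrict (slab n a b)) (f := G)
      (g := fun x => -(G x - moll (ρ m) G x)) (hG a b).1
    have b4 := setLIntegral_slab_comp_add a b (dir_succ_fst k s)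
      (fun x => ‖f x - moll (ρ m) f x‖ₑ ^ (2 : ℝ))
    simp only [enorm_neg] at b1 b3
    rw [b4] at b1
    have e3 : ∀ x, G x + -(G x - moll (ρ m) G x) = moll (ρ m) G x := fun x => by ring
    simp only [e3] at b3
    refine (mul_le_mul' le_rfl (add_le_add b1 (b2.trans b3))).trans ?_
    set A := ∫⁻ x in slab n a b, ‖f x - moll (ρ m) f x‖ₑ ^ (2 : ℝ)
    set B := 2 * (I + ∫⁻ x in slab n a b, ‖G x - moll (ρ m) G x‖ₑ ^ (2 : ℝ))
    calc 2 * (2 * (A + A) + B) = 8 * A + 2 * B := by ring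
      _ ≤ 8 * A + 4 * B := by gcongr; norm_num
  have t3 := (ENNReal.Tendsto.const_mul t1 (a := 8) (Or.inr (by simp))).add
    (ENNReal.Tendsto.const_mul (ENNReal.Tendsto.const_mul (t2.const_add I) (a := 2)
      (Or.inr (by simp))) (a := 4) (Or.inr (by simp)))
  have := ge_of_tendsto' t3 hb
  refine this.trans (le_of_eq ?_)
  rw [mul_zero, zero_add, add_zero, ← mul_assoc]
  norm_num

/-- Squared distance between a function and its translate on a slab. -/
def slabShift {E : Type*} [NormedAddCommGroup E] (a b : ℝ) (f : Cylinder n → E) (p : Cylinder n) :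
    ℝ≥0∞ := ∫⁻ x in slab n a b, ‖f x - f (x - p)‖ₑ ^ (2 : ℝ)

lemma slabShift_add_le {E : Type*} [NormedAddCommGroup E] {a b : ℝ} {f : Cylinder n → E}
    (hf : AEStronglyMeasurable f (volume.restrict (slab n a b))) {p p' : Cylinder n}
    (hp : p.1 = 0) :
    slabShift a b f (p + p') ≤ 2 * (slabShift a b f p + slabShift a b f p') := by
  have e : ∀ x, f x - f (x - (p + p')) = (f x - f (x - p)) + (f (x - p) - f (x - p - p')) := by
    intro x; rw [sub_add_sub_cancel, sub_sub]
  have hneg : (-p).1 = 0 := by simp [hp]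
  have hm : AEStronglyMeasurable (fun x => f (x - p)) (volume.restrict (slab n a b)) := by
    simpa [sub_eq_add_neg, Function.comp_def] using
      hf.comp_measurePreserving (measurePreserving_slab_add a b hneg)
  have e2 := setLIntegral_slab_comp_add a b hneg (fun x => ‖f x - f (x - p')‖ₑ ^ (2 : ℝ))
  simp only [← sub_eq_add_neg] at e2
  unfold slabShift
  rw [← e2]
  simp only [e]
  exact lintegral_enorm_add_sq_le (hf.sub hm)

lemma slabShift_sum_le {E ι : Type*} [NormedAddCommGroup E] {a b : ℝ} {f : Cylinder n → E}
    (hf : AEStronglyMeasurable f (volume.restrict (slab n a b))) (s : Finset ι)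
    {p : ι → Cylinder n} (hp : ∀ i, (p i).1 = 0) :
    slabShift a b f (∑ i ∈ s, p i) ≤ 2 ^ s.card * ∑ i ∈ s, slabShift a b f (p i) := by
  classical
  induction s using Finset.induction_on with
  | empty => simp [slabShift]
  | insert i s hi ih =>
    rw [Finset.sum_insert hi, Finset.sum_insert hi, Finset.card_insert_of_notMem hi]
    refine (slabShift_add_le hf (hp i)).trans ?_
    rw [pow_succ', mul_assoc]
    refine mul_le_mul' le_rfl ?_
    rw [mul_add]
    refine add_le_add ?_ ih
    exact le_mul_of_one_le_left' (one_le_pow₀ (by norm_num))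

/-- Every translation of the torus is a composition of `n` translations along coordinate circles. -/
lemma slice_eq_sum_dir (y : Torus n) : ∃ s : Fin n → ℝ, (∀ k, s k ∈ Set.Icc (0 : ℝ) 1) ∧
    ((0, y) : Cylinder n) = ∑ k, dir k.succ (s k) := by
  have h : ∀ k, ∃ s : ℝ, s ∈ Set.Icc (0 : ℝ) 1 ∧ ((s : ℝ) : UnitAddCircle) = y k := by
    intro k
    obtain ⟨s, hs⟩ := (AddCircle.equivIco (1 : ℝ) 0).symm.surjective (y k)
    refine ⟨s, ⟨s.2.1, ?_⟩, hs⟩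
    have := s.2.2
    linarith
  choose s hs hy using h
  refine ⟨s, hs, ?_⟩
  have e : ∀ k : Fin n, dir k.succ (s k) = ((0, Pi.single k (y k)) : Cylinder n) := by
    intro k
    refine Prod.ext (by simp) ?_
    funext l
    by_cases hl : l = k
    · subst hl; simp [dir, proj, hy]
    · simp [dir, proj, hl]
  simp only [e]
  refine Prod.ext (by simp [Prod.fst_sum]) ?_
  rw [Prod.snd_sum]
  exact (Finset.univ_sum_single y).symm

end Cylinder

namespace IsSolenoidal
variable {n : ℕ} {u : Cylinder n → Vec (n + 1)} {g : Fin (n + 1) → Fin (n + 1) → Cylinder n → ℝ}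

lemma slabShift_le (h : IsSolenoidal u g) (a b : ℝ) (y : Torus n) :
    slabShift a b u (0, y) ≤ 2 ^ n * ∑ k : Fin n, ∑ j,
      8 * ∫⁻ x in slab n a b, ‖g k.succ j x‖ₑ ^ (2 : ℝ) := by
  obtain ⟨s, hs, hy⟩ := slice_eq_sum_dir y
  rw [hy]
  refine (slabShift_sum_le (h.memLp_slab a b).1 Finset.univ fun k => dir_succ_fst k (s k)).trans ?_
  rw [Finset.card_univ, Fintype.card_fin]
  refine mul_le_mul' le_rfl (Finset.sum_le_sum fun k _ => ?_)
  have huj : ∀ j a b, MemLp (fun x => u x j) 2 (volume.restrict (slab n a b)) := fun j a b =>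
    (EuclideanSpace.proj j : Vec (n + 1) →L[ℝ] ℝ).comp_memLp' (h.memLp_slab a b)
  have hd : (dir k.succ (s k) : Cylinder n).1 = 0 := dir_succ_fst _ _
  have e1 : slabShift a b u (dir k.succ (s k)) =
      ∑ j, ∫⁻ x in slab n a b, ‖u (x + dir k.succ (s k)) j - u x j‖ₑ ^ (2 : ℝ) := by
    rw [slabShift, ← setLIntegral_slab_comp_add a b hd]
    simp only [add_sub_cancel_right, enorm_vec_sq, PiLp.sub_apply]
    refine lintegral_finsetSum' _ fun j _ => ?_
    exact (((huj j a b).1.comp_measurePreserving (measurePreserving_slab_add a b hd)).sub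
      (huj j a b).1).enorm.pow_const _
  rw [e1]
  exact Finset.sum_le_sum fun j _ => setLIntegral_slab_translate_le (h.weak k.succ j)
    (huj j) (fun a b => (h.memLp_grad _ _).restrict _) a b (hs k)

/-- The Poincaré inequality on slices: the distance to the average over the torus is controlled by
the derivatives along the torus. -/
lemma lintegral_sub_average_le (h : IsSolenoidal u g) (a b : ℝ) :
    ∫⁻ x in slab n a b, ‖u x - average u x.1‖ₑ ^ (2 : ℝ) ≤ 2 ^ n * ∑ k : Fin n, ∑ j,
      8 * ∫⁻ x in slab n a b, ‖g k.succ j x‖ₑ ^ (2 : ℝ) := by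
  set C := 2 ^ n * ∑ k : Fin n, ∑ j, 8 * ∫⁻ x in slab n a b, ‖g k.succ j x‖ₑ ^ (2 : ℝ)
  set μ := (volume : Measure ℝ).restrict (Set.Icc a b) with hμ
  have hprod : (volume : Measure (Cylinder n)).restrict (slab n a b) =
      μ.prod (volume : Measure (Torus n)) := by
    have : slab n a b = Set.Icc a b ×ˢ (Set.univ : Set (Torus n)) := by
      ext x; simp [slab]
    rw [this, Measure.volume_eq_prod, hμ, ← Measure.prod_restrict, Measure.restrict_univ]
  have hint : Integrable u (μ.prod (volume : Measure (Torus n))) := by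
    rw [← hprod]; exact (h.memLp_slab a b).integrable (by norm_num)
  obtain ⟨v, hv, huv⟩ := hint.1
  have hslice : ∀ᵐ t ∂μ, ∀ᵐ y : Torus n, u (t, y) = v (t, y) :=
    Measure.ae_ae_of_ae_prod huv
  have hslint : ∀ᵐ t ∂μ, Integrable (fun y : Torus n => u (t, y)) volume := hint.prod_right_ae
  have hm : StronglyMeasurable fun p : (ℝ × Torus n) × Torus n => v p.1 - v (p.1.1, p.1.2 - p.2) :=
    (hv.comp_measurable measurable_fst).sub (hv.comp_measurable
      ((measurable_fst.comp measurable_fst).prodMk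
        ((measurable_snd.comp measurable_fst).sub measurable_snd)))
  rw [hprod]
  have huv' : ∀ᵐ x ∂μ.prod (volume : Measure (Torus n)), ‖u x - average u x.1‖ₑ ^ (2 : ℝ) ≤
      ∫⁻ y : Torus n, ‖v x - v (x.1, x.2 - y)‖ₑ ^ (2 : ℝ) := by
    have h1 : ∀ᵐ x ∂μ.prod (volume : Measure (Torus n)),
        (∀ᵐ y : Torus n, u (x.1, y) = v (x.1, y)) ∧
          Integrable (fun y : Torus n => u (x.1, y)) volume :=
      Measure.quasiMeasurePreserving_fst.ae (hslice.and hslint)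
    filter_upwards [h1, huv] with x hx hxx
    have e1 : average u x.1 = ∫ y : Torus n, v (x.1, x.2 - y) := by
      rw [_root_.average, integral_congr_ae hx.1,
        ← integral_sub_left_eq_self (fun y => v (x.1, y)) volume x.2]
    have hi : Integrable (fun y : Torus n => v (x.1, x.2 - y)) volume :=
      ((hx.2.congr hx.1).comp_sub_left x.2)
    rw [e1, hxx]
    have e2 : v x - ∫ y : Torus n, v (x.1, x.2 - y) = ∫ y : Torus n, (v x - v (x.1, x.2 - y)) := by
      rw [integral_sub (integrable_const _) hi]; simp
    rw [e2]
    exact enorm_integral_rpow_le _ ((integrable_const _).sub hi).1 (by norm_num)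
  refine (lintegral_mono_ae huv').trans ?_
  rw [lintegral_lintegral_swap (hm.enorm.pow_const _).aemeasurable]
  refine (lintegral_mono (g := fun _ => C) fun y => ?_).trans (by simp)
  rw [← hprod] at huv ⊢
  refine le_trans (le_of_eq ?_) (h.slabShift_le a b y)
  have hp : (-(0, y) : Cylinder n).1 = 0 := by simp
  have h2 := (measurePreserving_slab_add a b hp).quasiMeasurePreserving.ae huv
  refine lintegral_congr_ae ?_
  filter_upwards [huv, h2] with x hx hx2
  have e3 : x + -(0, y) = (x.1, x.2 - y) := by
    ext <;> simp [sub_eq_add_neg]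
  rw [e3] at hx2
  have e4 : x - (0, y) = (x.1, x.2 - y) := by rw [← e3, sub_eq_add_neg]
  rw [e4, hx, hx2]

lemma ae_eq_average (h : IsSolenoidal u g) (h0 : ∀ (k : Fin n) j, g k.succ j =ᵐ[volume] 0) :
    ∀ᵐ x, u x = average u x.1 := by
  have h1 : ∀ m : ℕ, ∀ᵐ x ∂volume.restrict (slab n (-m) m), u x = average u x.1 := by
    intro m
    have h2 : ∫⁻ x in slab n (-m) m, ‖u x - average u x.1‖ₑ ^ (2 : ℝ) = 0 := by
      refine le_antisymm ((h.lintegral_sub_average_le _ _).trans (le_of_eq ?_)) zero_le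
      have e : ∀ (k : Fin n) j, ∫⁻ x in slab n (-m) m, ‖g k.succ j x‖ₑ ^ (2 : ℝ) = 0 := by
        intro k j
        rw [lintegral_congr_ae (g := fun _ => 0)]
        · simp
        · filter_upwards [ae_restrict_of_ae (h0 k j)] with x hx
          rw [hx]; simp
      simp only [e, mul_zero, Finset.sum_const_zero]
    have hav : AEStronglyMeasurable (fun x : Cylinder n => average u x.1) volume := by
      have := (h.locallyIntegrable.aestronglyMeasurable : AEStronglyMeasurable u
        ((volume : Measure ℝ).prod (volume : Measure (Torus n)))).integral_prod_right'
      exact this.comp_quasiMeasurePreserving Measure.quasiMeasurePreserving_fst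
    have hm : AEStronglyMeasurable (fun x => u x - _root_.average u x.1)
        (volume.restrict (slab n (-m) m)) := (h.memLp_slab _ _).1.sub hav.restrict
    rw [lintegral_eq_zero_iff' (hm.enorm.pow_const _)] at h2
    filter_upwards [h2] with x hx
    have hx' : ‖u x - average u x.1‖ₑ ^ (2 : ℝ) = 0 := hx
    simpa [sub_eq_zero] using hx'
  have h2 : ∀ᵐ x : Cylinder n, ∀ m : ℕ, x ∈ slab n (-m) m → u x = average u x.1 :=
    ae_all_iff.2 fun m => (ae_restrict_iff' (measurableSet_slab _ _)).1 (h1 m)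
  filter_upwards [h2] with x hx
  obtain ⟨m, hm⟩ := exists_nat_ge |x.1|
  exact hx m (abs_le.1 hm)

/-- A field satisfying the boundary condition has these limits in the sense of slabs. -/
lemma hasLimits_two (h : IsSolenoidal u g) {um up : Vec (n + 1)}
    (hb : BoundaryCondition um up u) : ∃ M, HasLimits u 2 M um up := by
  obtain ⟨m, hmc, hmu, hbot, htop⟩ := hb
  have hmu' : ∀ᵐ x : Cylinder n, average u x.1 = m x.1 :=
    Measure.quasiMeasurePreserving_fst.ae hmu
  set I : ℝ → ℝ≥0∞ := fun s => 2 ^ n * ∑ k : Fin n, ∑ j,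
      8 * ∫⁻ x in slab n s (s + 1), ‖g k.succ j x‖ₑ ^ (2 : ℝ) with hI
  have hgf : ∀ i j, ∫⁻ x, ‖g i j x‖ₑ ^ (2 : ℝ) ≠ ∞ := fun i j =>
    lintegral_rpow_ne_top (by norm_num) (by simpa using h.memLp_grad i j)
  have hum : AEStronglyMeasurable u volume := h.locallyIntegrable.aestronglyMeasurable
  have hmm : Continuous fun x : Cylinder n => m x.1 := hmc.comp continuous_fst
  have hP : ∀ s, ∫⁻ x in slab n s (s + 1), ‖u x - m x.1‖ₑ ^ (2 : ℝ) ≤ I s := by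
    intro s
    refine le_trans (le_of_eq (lintegral_congr_ae ?_)) (h.lintegral_sub_average_le s (s + 1))
    filter_upwards [ae_restrict_of_ae hmu'] with x hx
    rw [hx]
  have hvol : ∀ s : ℝ, volume (slab n s (s + 1)) = 1 := fun s => by rw [volume_slab]; simp
  have hest : ∀ (c : Vec (n + 1)) (s : ℝ) (δ : ℝ≥0∞), (∀ t ∈ Set.Icc s (s + 1), ‖m t - c‖ₑ ≤ δ) →
      ∫⁻ x in slab n s (s + 1), ‖u x - c‖ₑ ^ (2 : ℝ) ≤ 2 * (I s + δ ^ (2 : ℝ)) := by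
    intro c s δ hδ
    have e : ∀ x : Cylinder n, u x - c = (u x - m x.1) + (m x.1 - c) := fun x => by abel
    simp only [e]
    refine (lintegral_enorm_add_sq_le (hum.sub hmm.aestronglyMeasurable).restrict).trans ?_
    refine mul_le_mul' le_rfl (add_le_add (hP s) ?_)
    calc ∫⁻ x in slab n s (s + 1), ‖m x.1 - c‖ₑ ^ (2 : ℝ)
        ≤ ∫⁻ _ in slab n s (s + 1), δ ^ (2 : ℝ) :=
          setLIntegral_mono measurable_const fun x hx =>
            ENNReal.rpow_le_rpow (hδ x.1 hx) (by norm_num)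
      _ = δ ^ (2 : ℝ) := by simp [hvol]
  have hI0 : ∀ {s : ℕ → ℝ}, Tendsto (fun k => |s k|) atTop atTop →
      Tendsto (fun k => I (s k)) atTop (𝓝 0) := by
    intro s hs
    have := ENNReal.Tendsto.const_mul (a := 2 ^ n) (tendsto_finsetSum (Finset.univ : Finset (Fin n))
      fun k _ => tendsto_finsetSum (Finset.univ : Finset (Fin (n + 1))) fun j _ =>
        ENNReal.Tendsto.const_mul (a := 8) (tendsto_setLIntegral_slab_zero (hgf k.succ j)
          ((h.memLp_grad k.succ j).1.enorm.pow_const _) hs) (Or.inr (by simp)))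
      (Or.inr (by simp))
    simp only [mul_zero, Finset.sum_const_zero] at this
    exact this
  -- the mean value is bounded
  obtain ⟨B, hB⟩ : ∃ B : ℝ, ∀ t, ‖m t‖ ≤ B := by
    obtain ⟨t1, ht1⟩ := (htop.norm.eventually_lt_const (lt_add_one ‖up‖)).exists_forall_of_atTop
    obtain ⟨t0, ht0⟩ := (hbot.norm.eventually_lt_const (lt_add_one ‖um‖)).exists_forall_of_atBot
    obtain ⟨C, hC⟩ := isCompact_Icc (a := t0) (b := t1) |>.exists_bound_of_continuousOn
      hmc.continuousOn
    refine ⟨max C (max (‖um‖ + 1) (‖up‖ + 1)), fun t => ?_⟩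
    rcases le_total t t0 with h0 | h0
    · exact (ht0 t h0).le.trans ((le_max_left _ _).trans (le_max_right _ _))
    · rcases le_total t1 t with h1 | h1
      · exact (ht1 t h1).le.trans ((le_max_right _ _).trans (le_max_right _ _))
      · exact (hC t ⟨h0, h1⟩).trans (le_max_left _ _)
  have hconv : ∀ {c : Vec (n + 1)} {s : ℕ → ℝ} {l : Filter ℝ}, Tendsto m l (𝓝 c) →
      Tendsto (fun k => |s k|) atTop atTop →
      (∀ V ∈ l, ∀ᶠ k in atTop, Set.Icc (s k) (s k + 1) ⊆ V) →
      Tendsto (fun k => ∫⁻ x in slab n (s k) (s k + 1), ‖u x - c‖ₑ ^ (2 : ℝ)) atTop (𝓝 0) := by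
    intro c s l hml hs hV
    have t0 : Tendsto (fun δ : ℝ≥0∞ => 2 * (0 + δ ^ (2 : ℝ))) (𝓝 0) (𝓝 0) := by
      have := ENNReal.Tendsto.const_mul
        (((ENNReal.continuous_rpow_const (y := (2 : ℝ))).tendsto 0).const_add 0) (a := 2)
        (Or.inr (by simp))
      rwa [ENNReal.zero_rpow_of_pos (by norm_num), add_zero, mul_zero] at this
    rw [ENNReal.tendsto_nhds_zero]
    intro ε hε
    -- choose the tolerance for the mean value, then let the gradient term vanish
    have h1 : ∀ᶠ δ in 𝓝 (0 : ℝ≥0∞), 2 * (0 + δ ^ (2 : ℝ)) < ε := t0.eventually_lt_const hε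
    obtain ⟨δ, hδ, hδ0⟩ : ∃ δ : ℝ≥0∞, 2 * (0 + δ ^ (2 : ℝ)) < ε ∧ 0 < δ := by
      have hne : (𝓝[>] (0 : ℝ≥0∞)).NeBot := ENNReal.nhdsGT_zero_neBot
      exact Filter.Eventually.exists (f := 𝓝[>] (0 : ℝ≥0∞))
        ((h1.filter_mono nhdsWithin_le_nhds).and self_mem_nhdsWithin)
    have h2 : ∀ᶠ t in l, ‖m t - c‖ₑ ≤ δ := by
      have h3 : Tendsto (fun t => ‖m t - c‖ₑ) l (𝓝 0) := by
        have := ((hml.sub_const c).enorm)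
        simpa using this
      exact (h3.eventually_lt_const hδ0).mono fun _ h => h.le
    have t2 := ENNReal.Tendsto.const_mul ((hI0 hs).add_const (δ ^ (2 : ℝ))) (a := 2)
      (Or.inr (by simp))
    filter_upwards [hV _ h2, t2.eventually_lt_const hδ] with k hk hk2
    exact (hest c (s k) δ fun t ht => hk ht).trans hk2.le
  refine ⟨2 * (2 ^ n * (∑ k : Fin n, ∑ j, 8 * ∫⁻ x, ‖g k.succ j x‖ₑ ^ (2 : ℝ)) +
    ENNReal.ofReal B ^ (2 : ℝ)), ⟨?_, fun s => ?_, ?_, ?_⟩⟩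
  · refine ENNReal.mul_ne_top (by simp) (ENNReal.add_ne_top.2 ⟨ENNReal.mul_ne_top (by simp) ?_,
      ENNReal.rpow_ne_top_of_nonneg (by norm_num) ENNReal.ofReal_ne_top⟩)
    exact ENNReal.sum_ne_top.2 fun k _ => ENNReal.sum_ne_top.2 fun j _ =>
      ENNReal.mul_ne_top (by simp) (hgf _ _)
  · have h1 := hest 0 s (ENNReal.ofReal B) fun t _ => by
      rw [sub_zero, ← ofReal_norm]; exact ENNReal.ofReal_le_ofReal (hB t)
    simp only [sub_zero] at h1
    refine h1.trans (mul_le_mul' le_rfl (add_le_add ?_ le_rfl))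
    refine mul_le_mul' le_rfl (Finset.sum_le_sum fun k _ => Finset.sum_le_sum fun j _ =>
      mul_le_mul' le_rfl (setLIntegral_le_lintegral _ _))
  · refine hconv htop abs_intCast_tendsto fun V hV => ?_
    obtain ⟨T, hT⟩ := mem_atTop_sets.1 hV
    filter_upwards [tendsto_natCast_atTop_atTop.eventually_ge_atTop T] with k hk t ht
    exact hT t (hk.trans ht.1)
  · refine hconv hbot abs_neg_sub_one_tendsto fun V hV => ?_
    obtain ⟨T, hT⟩ := mem_atBot_sets.1 hV
    filter_upwards [tendsto_natCast_atTop_atTop.eventually_ge_atTop (-T)] with k hk t ht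
    exact hT t (by linarith [ht.2])

end IsSolenoidal

/-! ### The Sobolev inequality on slabs -/

namespace Cylinder
variable {n : ℕ}

/-- The cell `∏ (vₖ, vₖ + 1]` of the covering of the torus by `ℝⁿ`. -/
def cell (v : Fin n → ℝ) : Set (Fin n → ℝ) := Set.univ.pi fun k => Set.Ioc (v k) (v k + 1)

lemma measurableSet_cell (v : Fin n → ℝ) : MeasurableSet (cell v) :=
  MeasurableSet.univ_pi fun _ => measurableSet_Ioc

/-- Each fundamental cell covers the cylinder exactly once. -/
lemma measurePreserving_cover (v : Fin n → ℝ) :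
    MeasurePreserving (cover n) (volume.restrict (Set.univ ×ˢ cell v)) volume := by
  have h1 : MeasurePreserving (fun (y : Fin n → ℝ) k => ((y k : ℝ) : UnitAddCircle))
      (volume.restrict (cell v)) volume := by
    have := measurePreserving_pi (fun k : Fin n => (volume : Measure ℝ).restrict
      (Set.Ioc (v k) (v k + 1))) (fun _ : Fin n => (volume : Measure UnitAddCircle))
      (fun k => UnitAddCircle.measurePreserving_mk (v k))
    rwa [← Measure.restrict_pi_pi] at this
  have h2 := (MeasurePreserving.id (volume : Measure ℝ)).prod h1
  rw [Measure.volume_eq_prod, ← Measure.prod_restrict, Measure.restrict_univ]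
  exact h2

lemma setLIntegral_cover (v : Fin n → ℝ) (a b : ℝ) {G : Cylinder n → ℝ≥0∞} (hG : Measurable G) :
    ∫⁻ p in Set.Icc a b ×ˢ cell v, G (cover n p) = ∫⁻ x in slab n a b, G x := by
  have h1 := (measurePreserving_cover v).restrict_preimage (measurableSet_slab (n := n) a b)
  have e : (volume.restrict (Set.univ ×ˢ cell v)).restrict (cover n ⁻¹' slab n a b) =
      volume.restrict (Set.Icc a b ×ˢ cell v) := by
    rw [Measure.restrict_restrict ((measurePreserving_cover v).measurable (measurableSet_slab a b))]
    congr 1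
    ext p
    simp [slab, cover]
  rw [e] at h1
  exact h1.lintegral_comp hG

lemma exists_mem_cell {t : ℝ} (ht : t ∈ Set.Ioc (-2 : ℝ) 3) :
    ∃ k : Fin 5, t ∈ Set.Ioc ((k : ℝ) - 2) ((k : ℝ) - 2 + 1) := by
  have h0 : 0 < ⌈t + 2⌉ := Int.ceil_pos.2 (by linarith [ht.1])
  have h5 : ⌈t + 2⌉ ≤ 5 := Int.ceil_le.2 (by push_cast; linarith [ht.2])
  refine ⟨⟨(⌈t + 2⌉ - 1).toNat, by omega⟩, ?_⟩
  have e : (((⌈t + 2⌉ - 1).toNat : ℕ) : ℝ) = (⌈t + 2⌉ : ℝ) - 1 := by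
    have : (((⌈t + 2⌉ - 1).toNat : ℕ) : ℤ) = ⌈t + 2⌉ - 1 := Int.toNat_of_nonneg (by omega)
    exact_mod_cast congrArg (Int.cast : ℤ → ℝ) this
  rw [e]
  constructor <;> linarith [Int.le_ceil (t + 2), Int.ceil_lt_add_one (t + 2)]

/-- The cube `(-2, 3]ⁿ` covers each point of the torus `5ⁿ` times. -/
lemma setLIntegral_cover_le (a b : ℝ) {G : Cylinder n → ℝ≥0∞} (hG : Measurable G) :
    ∫⁻ p in Set.Icc a b ×ˢ (Set.univ.pi fun _ : Fin n => Set.Ioc (-2 : ℝ) 3), G (cover n p) ≤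
      5 ^ n * ∫⁻ x in slab n a b, G x := by
  have hsub : Set.Icc a b ×ˢ (Set.univ.pi fun _ : Fin n => Set.Ioc (-2 : ℝ) 3) ⊆
      ⋃ v : Fin n → Fin 5, Set.Icc a b ×ˢ cell fun k => ((v k : ℕ) : ℝ) - 2 := by
    rintro p ⟨hp1, hp2⟩
    choose v hv using fun k => exists_mem_cell (hp2 k trivial)
    exact Set.mem_iUnion.2 ⟨v, hp1, fun k _ => hv k⟩
  refine (lintegral_mono_set hsub).trans ((lintegral_iUnion_le _ _).trans (le_of_eq ?_))
  rw [tsum_fintype]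
  simp only [setLIntegral_cover _ a b hG, Finset.sum_const, Finset.card_univ, Fintype.card_pi,
    Fintype.card_fin, Finset.prod_const, nsmul_eq_mul]
  push_cast
  rfl

instance prod_pi_isAddHaarMeasure (n : ℕ) :
    (volume : Measure (ℝ × (Fin n → ℝ))).IsAddHaarMeasure :=
  inferInstanceAs ((volume : Measure ℝ).prod (volume : Measure (Fin n → ℝ))).IsAddHaarMeasure

/-- The critical Sobolev inequality on slabs of unit width, for `C¹` functions. -/
lemma exists_sobolev_const (hn : 2 ≤ n) : ∃ C : ℝ≥0, ∀ (w : Cylinder n → ℝ)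
    (W : Fin (n + 1) → Cylinder n → ℝ), Continuous w → (∀ i, Continuous (W i)) →
    (∀ y, HasFDerivAt (fun y => w (proj n y))
      (∑ i, W i (proj n y) • (EuclideanSpace.proj i : Vec (n + 1) →L[ℝ] ℝ)) y) → ∀ s : ℝ,
    (∫⁻ x in slab n s (s + 1), ‖w x‖ₑ ^ (2 * (n + 1) / (n - 1) : ℝ)) ≤
      (C * (∫⁻ x in slab n (s - 2) (s + 3), (‖w x‖ₑ ^ (2 : ℝ) + ∑ i, ‖W i x‖ₑ ^ (2 : ℝ))) ^
        (1 / 2 : ℝ)) ^ (2 * (n + 1) / (n - 1) : ℝ) := by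
  have hn' : (2 : ℝ) ≤ n := by exact_mod_cast hn
  set q : ℝ := 2 * (n + 1) / (n - 1) with hq
  have hq0 : 0 < q := by rw [hq]; apply div_pos <;> linarith
  let η : ContDiffBump (0 : (ℝ × (Fin n → ℝ))) := ⟨1, 2, one_pos, one_lt_two⟩
  have hη : ContDiff ℝ 1 (η : (ℝ × (Fin n → ℝ)) → ℝ) := η.contDiff
  obtain ⟨D, hD⟩ : ∃ D, ∀ p, ‖fderiv ℝ (η : (ℝ × (Fin n → ℝ)) → ℝ) p‖ ≤ D :=
    (η.hasCompactSupport.fderiv (𝕜 := ℝ)).exists_bound_of_continuous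
      (hη.continuous_fderiv one_ne_zero)
  have hD0 : 0 ≤ D := (norm_nonneg _).trans (hD 0)
  set L : (ℝ × (Fin n → ℝ)) →L[ℝ] Vec (n + 1) :=
    ((splitEquiv n).symm : (ℝ × (Fin n → ℝ)) →L[ℝ] Vec (n + 1)) with hL
  set A : ℝ := (D + ‖L‖) with hA
  have hA0 : 0 ≤ A := add_nonneg hD0 (norm_nonneg _)
  set B : ℝ≥0∞ := ENNReal.ofReal A ^ (2 : ℝ) * (2 * (n + 1) * 5 ^ n) with hB
  have hBt : B ≠ ∞ := by
    refine ENNReal.mul_ne_top (ENNReal.rpow_ne_top_of_nonneg (by norm_num) ENNReal.ofReal_ne_top) ?_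
    exact ENNReal.mul_ne_top (ENNReal.mul_ne_top (by simp) (by simp)) (by simp)
  refine ⟨SNormLESNormFDerivOfEqConst ℝ (volume : Measure (ℝ × (Fin n → ℝ))) 2 *
    (B ^ (1 / 2 : ℝ)).toNNReal, fun w W hw hW hdw s => ?_⟩
  set c : (ℝ × (Fin n → ℝ)) := (s + 1 / 2, fun _ => 1 / 2) with hc
  set ω : (ℝ × (Fin n → ℝ)) → ℝ := fun p => w (cover n p) with hω
  have hcc : Continuous (cover n) := by
    have : cover n = fun p => proj n ((splitEquiv n).symm p) := funext fun p => cover_eq_proj p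
    rw [this]; exact continuous_proj.comp (splitEquiv n).symm.continuous
  set ω' : (ℝ × (Fin n → ℝ)) → (ℝ × (Fin n → ℝ)) →L[ℝ] ℝ := fun p =>
    (∑ i, W i (cover n p) • (EuclideanSpace.proj i : Vec (n + 1) →L[ℝ] ℝ)).comp L with hω'
  have hdω : ∀ p, HasFDerivAt ω (ω' p) p := by
    intro p
    have h1 := (hdw ((splitEquiv n).symm p)).comp p (L.hasFDerivAt (x := p))
    simp only [← cover_eq_proj] at h1
    have e : (fun y => w (proj n y)) ∘ L = ω := by
      funext p; simp only [Function.comp, hω, cover_eq_proj]; rfl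
    exact e ▸ h1
  have hω'c : Continuous ω' := by
    refine Continuous.clm_comp ?_ continuous_const
    exact continuous_finsetSum _ fun i _ => ((hW i).comp hcc).smul continuous_const
  have hωC : ContDiff ℝ 1 ω := contDiff_one_iff_hasFDerivAt.2 ⟨ω', hω'c, hdω⟩
  set ζ : (ℝ × (Fin n → ℝ)) → ℝ := fun p => η (p - c) with hζ
  have hζC : ContDiff ℝ 1 ζ := hη.comp (contDiff_id.sub contDiff_const)
  have hζd : ∀ p, HasFDerivAt ζ (fderiv ℝ (η : (ℝ × (Fin n → ℝ)) → ℝ) (p - c)) p := fun p => by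
    have h1 := ((hη.differentiable one_ne_zero) (p - c)).hasFDerivAt
    have h2 := h1.comp p ((hasFDerivAt_id p).sub_const c)
    exact h2
  have hζs : HasCompactSupport ζ :=
    η.hasCompactSupport.comp_homeomorph (Homeomorph.subRight c)
  set F : (ℝ × (Fin n → ℝ)) → ℝ := fun p => ζ p * ω p with hF
  have hFC : ContDiff ℝ 1 F := hζC.mul hωC
  have hFs : HasCompactSupport F := hζs.mul_right
  have hFd : ∀ p, fderiv ℝ F p =
      ζ p • ω' p + ω p • fderiv ℝ (η : (ℝ × (Fin n → ℝ)) → ℝ) (p - c) := fun p =>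
    ((hζd p).mul (hdω p)).fderiv
  have hsob := eLpNorm_le_eLpNorm_fderiv_of_eq (μ := (volume : Measure (ℝ × (Fin n → ℝ))))
    hFC hFs (p := 2) (p' := q.toNNReal) (by norm_num) (by simp) (by
      rw [Real.coe_toNNReal _ hq0.le]
      have : (Module.finrank ℝ (ℝ × (Fin n → ℝ)) : ℝ) = n + 1 := by simp; ring
      rw [this, hq]
      have h1 : (n : ℝ) + 1 ≠ 0 := by linarith
      have h2 : (n : ℝ) - 1 ≠ 0 := by linarith
      push_cast
      field_simp
      ring)
  -- the cutoff equals one on the fundamental cell and is supported in finitely many of them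
  have hone : ∀ p ∈ Set.Icc s (s + 1) ×ˢ cell (fun _ : Fin n => (0 : ℝ)), F p = w (cover n p) := by
    rintro p ⟨hp1, hp2⟩
    have h1 : ζ p = 1 := by
      refine η.one_of_mem_closedBall ?_
      rw [mem_closedBall_zero_iff]
      change ‖p - c‖ ≤ 1
      refine max_le ?_ ((pi_norm_le_iff_of_nonneg zero_le_one).2 fun k => ?_)
      · change |p.1 - (s + 1 / 2)| ≤ 1
        rw [abs_le]
        constructor <;> linarith [hp1.1, hp1.2]
      · have h : p.2 k ∈ Set.Ioc (0 : ℝ) (0 + 1) := hp2 k trivial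
        change |p.2 k - 1 / 2| ≤ 1
        rw [abs_le]
        constructor <;> linarith [h.1, h.2]
    rw [hF]
    simp only [h1, one_mul, hω]
  set Q : Set (ℝ × (Fin n → ℝ)) :=
    Set.Icc (s - 2) (s + 3) ×ˢ (Set.univ.pi fun _ : Fin n => Set.Ioc (-2 : ℝ) 3) with hQ
  have hzero : ∀ p, p ∉ Q → fderiv ℝ F p = 0 := by
    intro p hp
    have h1 : 2 < ‖p - c‖ := by
      by_contra! hle
      refine hp ⟨?_, fun k _ => ?_⟩
      · have : |p.1 - (s + 1 / 2)| ≤ 2 := (norm_fst_le (p - c)).trans hle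
        rw [abs_le] at this
        constructor <;> linarith [this.1, this.2]
      · have : |p.2 k - 1 / 2| ≤ 2 :=
          ((norm_le_pi_norm (p - c).2 k).trans (norm_snd_le (p - c))).trans hle
        rw [abs_le] at this
        constructor <;> linarith [this.1, this.2]
    have h2 : F =ᶠ[𝓝 p] fun _ => 0 := by
      have h3 : ∀ᶠ p' in 𝓝 p, 2 < ‖p' - c‖ :=
        (isOpen_lt continuous_const (by fun_prop)).mem_nhds h1
      filter_upwards [h3] with p' hp'
      have : ζ p' = 0 := η.zero_of_le_dist (by
        rw [dist_zero_right]; exact hp'.le)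
      simp only [hF, this, zero_mul]
    rw [h2.fderiv_eq]
    simp
  have hbd : ∀ p, ‖fderiv ℝ F p‖ₑ ≤
      ENNReal.ofReal A * (‖w (cover n p)‖ₑ + ∑ i, ‖W i (cover n p)‖ₑ) := by
    intro p
    have h1 : ‖fderiv ℝ F p‖ ≤ A * (‖w (cover n p)‖ + ∑ i, ‖W i (cover n p)‖) := by
      rw [hFd]
      have hsum : ‖∑ i, W i (cover n p) • (EuclideanSpace.proj i : Vec (n + 1) →L[ℝ] ℝ)‖ ≤
          ∑ i, ‖W i (cover n p)‖ := by
        refine norm_sum_le_of_le _ fun i _ => ?_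
        rw [norm_smul]
        refine mul_le_of_le_one_right (norm_nonneg _) ?_
        refine ContinuousLinearMap.opNorm_le_bound _ zero_le_one fun v => ?_
        rw [one_mul]
        exact PiLp.norm_apply_le v i
      have h2 : ‖ω' p‖ ≤ (∑ i, ‖W i (cover n p)‖) * ‖L‖ :=
        (ContinuousLinearMap.opNorm_comp_le _ _).trans
          (mul_le_mul_of_nonneg_right hsum (norm_nonneg _))
      have h3 : ‖ζ p‖ ≤ 1 := by
        rw [Real.norm_of_nonneg (η.nonneg' _)]; exact η.le_one
      have h0 : 0 ≤ ∑ i, ‖W i (cover n p)‖ := Finset.sum_nonneg fun _ _ => norm_nonneg _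
      calc ‖ζ p • ω' p + ω p • fderiv ℝ (η : (ℝ × (Fin n → ℝ)) → ℝ) (p - c)‖
          ≤ ‖ζ p‖ * ‖ω' p‖ + ‖ω p‖ * ‖fderiv ℝ (η : (ℝ × (Fin n → ℝ)) → ℝ) (p - c)‖ := by
            refine (norm_add_le _ _).trans ?_
            rw [norm_smul, norm_smul]
        _ ≤ 1 * ((∑ i, ‖W i (cover n p)‖) * ‖L‖) + ‖w (cover n p)‖ * D := by
            gcongr
            exact hD _
        _ ≤ _ := by
            rw [hA]
            nlinarith [mul_nonneg h0 hD0, mul_nonneg (norm_nonneg (w (cover n p))) (norm_nonneg L)]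
    have h2 := ENNReal.ofReal_le_ofReal h1
    rw [ENNReal.ofReal_mul hA0, ENNReal.ofReal_add (norm_nonneg _)
      (Finset.sum_nonneg fun _ _ => norm_nonneg _),
      ENNReal.ofReal_sum_of_nonneg fun _ _ => norm_nonneg _] at h2
    simpa only [ofReal_norm] using h2
  set G : Cylinder n → ℝ≥0∞ := fun x => ‖w x‖ₑ ^ (2 : ℝ) + ∑ i, ‖W i x‖ₑ ^ (2 : ℝ) with hG
  have hGm : Measurable G := by
    refine (hw.enorm.measurable.pow_const _).add ?_
    exact Finset.measurable_sum _ fun i _ => (hW i).enorm.measurable.pow_const _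
  have hbd2 : ∀ p, ‖fderiv ℝ F p‖ₑ ^ (2 : ℝ) ≤
      ENNReal.ofReal A ^ (2 : ℝ) * (2 * (n + 1) * G (cover n p)) := by
    intro p
    refine (ENNReal.rpow_le_rpow (hbd p) (by norm_num)).trans ?_
    rw [ENNReal.mul_rpow_of_nonneg _ _ (by norm_num : (0 : ℝ) ≤ 2)]
    refine mul_le_mul' le_rfl ?_
    refine (ENNReal.rpow_add_le_mul_rpow_add_rpow _ _ (by norm_num : (1 : ℝ) ≤ 2)).trans ?_
    have e2 : (2 : ℝ≥0∞) ^ ((2 : ℝ) - 1) = 2 := by norm_num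
    have k1 := ENNReal.rpow_sum_le_const_mul_sum_rpow (p := 2) (Finset.univ : Finset (Fin (n + 1)))
      (fun i => ‖W i (cover n p)‖ₑ) (by norm_num)
    have e3 : ((n + 1 : ℕ) : ℝ≥0∞) ^ ((2 : ℝ) - 1) = n + 1 := by norm_num
    rw [Finset.card_univ, Fintype.card_fin, e3] at k1
    rw [e2, mul_assoc]
    refine mul_le_mul' le_rfl ?_
    rw [hG]
    simp only [mul_add]
    refine add_le_add ?_ k1
    exact le_mul_of_one_le_left' le_add_self
  have hright : eLpNorm (fderiv ℝ F) 2 volume ≤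
      (B * ∫⁻ x in slab n (s - 2) (s + 3), G x) ^ (1 / 2 : ℝ) := by
    rw [eLpNorm_two_eq]
    refine ENNReal.rpow_le_rpow ?_ (by norm_num)
    have hQm : MeasurableSet Q :=
      measurableSet_Icc.prod (MeasurableSet.univ_pi fun _ => measurableSet_Ioc)
    calc ∫⁻ p, ‖fderiv ℝ F p‖ₑ ^ (2 : ℝ) = ∫⁻ p in Q, ‖fderiv ℝ F p‖ₑ ^ (2 : ℝ) := by
          rw [← lintegral_indicator hQm]
          refine lintegral_congr fun p => ?_
          by_cases hp : p ∈ Q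
          · rw [Set.indicator_of_mem hp]
          · rw [Set.indicator_of_notMem hp, hzero p hp, ← ofReal_norm, norm_zero,
              ENNReal.ofReal_zero,
              ENNReal.zero_rpow_of_pos (by norm_num)]
      _ ≤ ∫⁻ p in Q, ENNReal.ofReal A ^ (2 : ℝ) * (2 * (n + 1) * G (cover n p)) :=
          lintegral_mono hbd2
      _ = ENNReal.ofReal A ^ (2 : ℝ) * (2 * (n + 1) * ∫⁻ p in Q, G (cover n p)) := by
          rw [lintegral_const_mul' _ _ (ENNReal.rpow_ne_top_of_nonneg (by norm_num)
            ENNReal.ofReal_ne_top), lintegral_const_mul' _ _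
              (ENNReal.mul_ne_top (by simp) (by simp))]
      _ ≤ ENNReal.ofReal A ^ (2 : ℝ) *
          (2 * (n + 1) * (5 ^ n * ∫⁻ x in slab n (s - 2) (s + 3), G x)) := by
          gcongr
          exact setLIntegral_cover_le _ _ hGm
      _ = _ := by rw [hB]; ring
  have hleft : (∫⁻ x in slab n s (s + 1), ‖w x‖ₑ ^ q) ≤ eLpNorm F q.toNNReal volume ^ q := by
    have e : (q.toNNReal : ℝ≥0∞) = ENNReal.ofReal q := rfl
    rw [e, eLpNorm_eq_lintegral_rpow_enorm_toReal (by simpa using hq0) ENNReal.ofReal_ne_top,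
      ENNReal.toReal_ofReal hq0.le, ← ENNReal.rpow_mul, one_div, inv_mul_cancel₀ hq0.ne',
      ENNReal.rpow_one,
      ← setLIntegral_cover (fun _ => 0) s (s + 1) (hw.enorm.measurable.pow_const q)]
    refine le_trans (le_of_eq ?_) (setLIntegral_le_lintegral
      (Set.Icc s (s + 1) ×ˢ cell fun _ : Fin n => (0 : ℝ)) _)
    refine setLIntegral_congr_fun (measurableSet_Icc.prod (measurableSet_cell _)) fun p hp => ?_
    simp only [hone p hp]
  refine hleft.trans (ENNReal.rpow_le_rpow (hsob.trans ?_) hq0.le)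
  rw [ENNReal.coe_mul, mul_assoc]
  refine mul_le_mul' le_rfl ?_
  refine hright.trans (le_of_eq ?_)
  rw [ENNReal.mul_rpow_of_nonneg _ _ (by norm_num : (0 : ℝ) ≤ 1 / 2),
    ENNReal.coe_toNNReal (ENNReal.rpow_ne_top_of_nonneg (by norm_num) hBt)]

end Cylinder

namespace IsSolenoidal
variable {n : ℕ} {u : Cylinder n → Vec (n + 1)} {g : Fin (n + 1) → Fin (n + 1) → Cylinder n → ℝ}

/-- In dimension at least three, the bounds on slabs improve to the critical Sobolev exponent. -/
lemma hasLimits_sobolev (h : IsSolenoidal u g) (hn : 2 ≤ n) {um up : Vec (n + 1)} {M : ℝ≥0∞}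
    (hl : HasLimits u 2 M um up) :
    ∃ M', HasLimits u (2 * (n + 1) / (n - 1) : ℝ) M' um up := by
  have hn' : (2 : ℝ) ≤ n := by exact_mod_cast hn
  obtain ⟨C, hC⟩ := exists_sobolev_const hn
  set q : ℝ := 2 * (n + 1) / (n - 1) with hq
  have hq1 : 1 ≤ q := by rw [hq, le_div_iff₀ (by linarith)]; linarith
  have hq0 : 0 < q := by linarith
  have huj : ∀ j a b, MemLp (fun x => u x j) 2 (volume.restrict (slab n a b)) := fun j a b =>
    (EuclideanSpace.proj j : Vec (n + 1) →L[ℝ] ℝ).comp_memLp' (h.memLp_slab a b)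
  set J : Fin (n + 1) → ℝ≥0∞ := fun j => (C * (2 * ((5 + 1) * M) +
    ∑ i, 2 * ∫⁻ x, ‖g i j x‖ₑ ^ (2 : ℝ)) ^ (1 / 2 : ℝ)) ^ q with hJ
  have hcomp : ∀ j s, ∫⁻ x in slab n s (s + 1), ‖u x j‖ₑ ^ q ≤ J j := by
    intro j s
    obtain ⟨ρ, hρ, hae⟩ := h.exists_isMollifier_ae s (s + 1)
    have t0 := hρ.tendsto_setLIntegral_slab (f := fun x => u x j) (q := 2) (by norm_num)
      (fun a b => by simpa using huj j a b) (s - 2) (s + 3)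
    have t1 := fun i => h.tendsto_moll_grad hρ i j (s - 2) (s + 3)
    set I0 := ∫⁻ x in slab n (s - 2) (s + 3), ‖u x j‖ₑ ^ (2 : ℝ) with hI0
    set I1 : Fin (n + 1) → ℝ≥0∞ := fun i => ∫⁻ x in slab n (s - 2) (s + 3), ‖g i j x‖ₑ ^ (2 : ℝ)
      with hI1
    -- the inequality for smooth functions, applied to mollifications, passes to the limit by Fatou
    have hb : ∀ m, ∫⁻ x in slab n s (s + 1), ‖moll (ρ m) (fun x => u x j) x‖ₑ ^ q ≤
        (C * (2 * (I0 + ∫⁻ x in slab n (s - 2) (s + 3),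
          ‖u x j - moll (ρ m) (fun x => u x j) x‖ₑ ^ (2 : ℝ)) +
          ∑ i, 2 * (I1 i + ∫⁻ x in slab n (s - 2) (s + 3),
            ‖g i j x - moll (ρ m) (g i j) x‖ₑ ^ (2 : ℝ))) ^ (1 / 2 : ℝ)) ^ q := by
      intro m
      have hm := (hρ.kernel m).test
      have hli := (h.weak 0 j).locInt_fun
      have cw := Cylinder.continuous_moll hm hli
      have cW := fun i => h.continuous_moll_grad hm i j
      refine (hC _ (fun i => moll (ρ m) (g i j)) cw cW (fun y => ?_) s).trans ?_
      · have := hasFDerivAt_moll_proj hm hli y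
        simpa only [(h.weak _ j).moll_partialDeriv hm] using this
      · refine ENNReal.rpow_le_rpow (mul_le_mul' le_rfl (ENNReal.rpow_le_rpow ?_ (by norm_num)))
          hq0.le
        have split : ∀ {f v : Cylinder n → ℝ},
            AEStronglyMeasurable f (volume.restrict (slab n (s - 2) (s + 3))) →
            ∫⁻ x in slab n (s - 2) (s + 3), ‖v x‖ₑ ^ (2 : ℝ) ≤
              2 * ((∫⁻ x in slab n (s - 2) (s + 3), ‖f x‖ₑ ^ (2 : ℝ)) +
                ∫⁻ x in slab n (s - 2) (s + 3), ‖f x - v x‖ₑ ^ (2 : ℝ)) := by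
          intro f v hf
          have := lintegral_enorm_add_sq_le (g := fun x => -(f x - v x)) hf
          simp only [enorm_neg] at this
          have e : ∀ x, f x + -(f x - v x) = v x := fun x => by ring
          simpa only [e] using this
        rw [lintegral_add_left (cw.enorm.measurable.pow_const _),
          lintegral_finsetSum _ fun i _ => (cW i).enorm.measurable.pow_const _]
        exact add_le_add (split (huj j _ _).1)
          (Finset.sum_le_sum fun i _ => split (h.memLp_grad i j).1.restrict)
    have t2 : Tendsto (fun m => (C * (2 * (I0 + ∫⁻ x in slab n (s - 2) (s + 3),
          ‖u x j - moll (ρ m) (fun x => u x j) x‖ₑ ^ (2 : ℝ)) +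
          ∑ i, 2 * (I1 i + ∫⁻ x in slab n (s - 2) (s + 3),
            ‖g i j x - moll (ρ m) (g i j) x‖ₑ ^ (2 : ℝ))) ^ (1 / 2 : ℝ)) ^ q) atTop
        (𝓝 ((C * (2 * (I0 + 0) + ∑ i, 2 * (I1 i + 0)) ^ (1 / 2 : ℝ)) ^ q)) := by
      refine ((ENNReal.continuous_rpow_const (y := q)).tendsto _).comp ?_
      refine ENNReal.Tendsto.const_mul ?_ (Or.inr ENNReal.coe_ne_top)
      refine ((ENNReal.continuous_rpow_const (y := (1 / 2 : ℝ))).tendsto _).comp ?_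
      refine (ENNReal.Tendsto.const_mul (t0.const_add I0) (Or.inr (by simp))).add ?_
      exact tendsto_finsetSum _ fun i _ =>
        ENNReal.Tendsto.const_mul ((t1 i).const_add (I1 i)) (Or.inr (by simp))
    have hfatou : ∫⁻ x in slab n s (s + 1), ‖u x j‖ₑ ^ q ≤
        (C * (2 * (I0 + 0) + ∑ i, 2 * (I1 i + 0)) ^ (1 / 2 : ℝ)) ^ q := by
      calc ∫⁻ x in slab n s (s + 1), ‖u x j‖ₑ ^ q
          = ∫⁻ x in slab n s (s + 1),
              liminf (fun m => ‖moll (ρ m) (fun x => u x j) x‖ₑ ^ q) atTop := by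
            refine lintegral_congr_ae ?_
            filter_upwards [hae] with x hx
            have h1 : Tendsto (fun m => moll (ρ m) (fun x => u x j) x) atTop (𝓝 (u x j)) := by
              have := ((EuclideanSpace.proj j : Vec (n + 1) →L[ℝ] ℝ).continuous.tendsto _).comp hx
              refine this.congr fun m => ?_
              exact moll_apply (hρ.kernel m).test h.locallyIntegrable x j
            exact (((ENNReal.continuous_rpow_const (y := q)).tendsto _).comp
              h1.enorm).liminf_eq.symm
        _ ≤ liminf (fun m => ∫⁻ x in slab n s (s + 1),
              ‖moll (ρ m) (fun x => u x j) x‖ₑ ^ q) atTop :=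
            lintegral_liminf_le fun m => (Cylinder.continuous_moll (hρ.kernel m).test
              (h.weak 0 j).locInt_fun).enorm.measurable.pow_const _
        _ ≤ _ := by
            rw [← t2.liminf_eq]
            exact liminf_le_liminf (Eventually.of_forall hb)
    refine hfatou.trans (ENNReal.rpow_le_rpow (mul_le_mul' le_rfl (ENNReal.rpow_le_rpow ?_
      (by norm_num))) hq0.le)
    simp only [add_zero]
    refine add_le_add (mul_le_mul' le_rfl ?_) (Finset.sum_le_sum fun i _ => mul_le_mul' le_rfl
      (setLIntegral_le_lintegral _ _))
    have h5 := setLIntegral_slab_le hl.bound (s - 2) 5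
    have e5 : s - 2 + ((5 : ℕ) : ℝ) = s + 3 := by push_cast; ring
    rw [e5] at h5
    refine le_trans (lintegral_mono fun x => ENNReal.rpow_le_rpow ?_ (by norm_num)) h5
    rw [← ofReal_norm, ← ofReal_norm]
    exact ENNReal.ofReal_le_ofReal (PiLp.norm_apply_le (u x) j)
  refine ⟨((n + 1 : ℕ) : ℝ≥0∞) ^ (q - 1) * ∑ j, J j, ?_, fun s => ?_, hl.tendsto_top,
    hl.tendsto_bot⟩
  · refine ENNReal.mul_ne_top (ENNReal.rpow_ne_top_of_nonneg (by linarith) (by simp))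
      (ENNReal.sum_ne_top.2 fun j _ => ENNReal.rpow_ne_top_of_nonneg hq0.le
        (ENNReal.mul_ne_top ENNReal.coe_ne_top (ENNReal.rpow_ne_top_of_nonneg (by norm_num)
          (ENNReal.add_ne_top.2 ⟨?_, ?_⟩))))
    · exact ENNReal.mul_ne_top (by simp) (ENNReal.mul_ne_top (by norm_num) hl.ne_top)
    · exact ENNReal.sum_ne_top.2 fun i _ => ENNReal.mul_ne_top (by simp)
        (lintegral_rpow_ne_top (by norm_num) (by simpa using h.memLp_grad i j))
  · have hle : ∀ x, ‖u x‖ₑ ^ q ≤ ((n + 1 : ℕ) : ℝ≥0∞) ^ (q - 1) * ∑ j, ‖u x j‖ₑ ^ q := by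
      intro x
      have h1 : ‖u x‖ₑ ≤ ∑ j, ‖u x j‖ₑ := by
        have e : u x = ∑ j, EuclideanSpace.single j (u x j) := by
          ext l; simp
        conv_lhs => rw [e]
        refine (enorm_sum_le _ _).trans (le_of_eq (Finset.sum_congr rfl fun j _ => ?_))
        rw [← ofReal_norm, PiLp.norm_single, ofReal_norm]
      have h2 := ENNReal.rpow_sum_le_const_mul_sum_rpow (Finset.univ : Finset (Fin (n + 1)))
        (fun j => ‖u x j‖ₑ) hq1
      rw [Finset.card_univ, Fintype.card_fin] at h2
      exact (ENNReal.rpow_le_rpow h1 hq0.le).trans h2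
    refine (lintegral_mono hle).trans ?_
    rw [lintegral_const_mul' _ _ (ENNReal.rpow_ne_top_of_nonneg (by linarith) (by simp)),
      lintegral_finsetSum' _ fun j _ => (huj j _ _).1.enorm.pow_const _]
    exact mul_le_mul' le_rfl (Finset.sum_le_sum fun j _ => hcomp j s)

end IsSolenoidal

/-! ### Structure of the calibration maps -/

section Structure
variable {d : ℕ} {Φ : Vec d → Vec d}

lemma norm_fderiv_le_sum_jac (z : Vec d) : ‖fderiv ℝ Φ z‖ ≤ ∑ i, ∑ j, |jac Φ i j z| := by
  refine ContinuousLinearMap.opNorm_le_bound _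
    (Finset.sum_nonneg fun _ _ => Finset.sum_nonneg fun _ _ => abs_nonneg _) fun v => ?_
  have single_sum : ∀ w : Vec d, ‖w‖ ≤ ∑ j, |w j| := by
    intro w
    have e : w = ∑ j, EuclideanSpace.single j (w j) := by ext l; simp
    conv_lhs => rw [e]
    refine norm_sum_le_of_le _ fun j _ => ?_
    rw [PiLp.norm_single, Real.norm_eq_abs]
  have e : v = ∑ i, v i • EuclideanSpace.single i (1 : ℝ) := by
    ext l; simp [Pi.single_apply]
  conv_lhs => rw [e, map_sum]
  rw [Finset.sum_mul]
  refine norm_sum_le_of_le _ fun i _ => ?_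
  rw [map_smul, norm_smul, mul_comm]
  exact mul_le_mul (single_sum _) (PiLp.norm_apply_le v i) (norm_nonneg _)
    (Finset.sum_nonneg fun _ _ => abs_nonneg _)

lemma hasFDerivAt_comb (hΦ : ContDiff ℝ 1 Φ) (i j : Fin d) (σ : ℝ) (z : Vec d) :
    HasFDerivAt (fun z => Φ z i + σ * Φ z j)
      ((EuclideanSpace.proj i : Vec d →L[ℝ] ℝ).comp (fderiv ℝ Φ z) +
        σ • (EuclideanSpace.proj j : Vec d →L[ℝ] ℝ).comp (fderiv ℝ Φ z)) z := by
  have h := (hΦ.differentiable one_ne_zero z).hasFDerivAt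
  have hi := (EuclideanSpace.proj i : Vec d →L[ℝ] ℝ).hasFDerivAt.comp z h
  have hj := (EuclideanSpace.proj j : Vec d →L[ℝ] ℝ).hasFDerivAt.comp z h
  exact hi.add (hj.const_mul σ)

/-- Because the Jacobian is symmetric with scalar diagonal, `Φᵢ + σ Φⱼ` (`σ = ±1`) does not change
along `eᵢ - σ eⱼ`: this is d'Alembert's formula for the wave equation satisfied by a potential of
`Φ` in the variables `zᵢ`, `zⱼ`. -/
lemma comb_add_smul (hΦ : ContDiff ℝ 1 Φ) (hsymm : ∀ z i j, jac Φ i j z = jac Φ j i z)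
    (hdiag : ∀ z i j, jac Φ i i z = jac Φ j j z) (i j : Fin d) {σ : ℝ} (hσ : σ * σ = 1)
    (z : Vec d) (t : ℝ) :
    Φ (z + t • (EuclideanSpace.single i 1 - σ • EuclideanSpace.single j 1)) i +
      σ * Φ (z + t • (EuclideanSpace.single i 1 - σ • EuclideanSpace.single j 1)) j =
    Φ z i + σ * Φ z j := by
  set v : Vec d := EuclideanSpace.single i 1 - σ • EuclideanSpace.single j 1 with hv
  have hd : ∀ s : ℝ, HasDerivAt (fun s : ℝ => Φ (z + s • v) i + σ * Φ (z + s • v) j) 0 s := by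
    intro s
    have h2 : HasDerivAt (fun s : ℝ => z + s • v) v s := by
      simpa using ((hasDerivAt_id s).smul_const v).const_add z
    have h3 := (hasFDerivAt_comb hΦ i j σ (z + s • v)).comp_hasDerivAt s h2
    have e : ((EuclideanSpace.proj i : Vec d →L[ℝ] ℝ).comp (fderiv ℝ Φ (z + s • v)) +
        σ • (EuclideanSpace.proj j : Vec d →L[ℝ] ℝ).comp (fderiv ℝ Φ (z + s • v))) v = 0 := by
      have h4 : jac Φ i i (z + s • v) + σ * jac Φ i j (z + s • v) -
          σ * (jac Φ j i (z + s • v) + σ * jac Φ j j (z + s • v)) = 0 := by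
        rw [hsymm _ j i, hdiag _ j i]
        linear_combination (-jac Φ i i (z + s • v)) * hσ
      rw [hv, map_sub, map_smul, ← hv]
      exact h4
    rw [e] at h3
    exact h3
  have := is_const_of_deriv_eq_zero (fun s => (hd s).differentiableAt) (fun s => (hd s).deriv) t 0
  simpa using this

lemma jac_comb_add_smul (hΦ : ContDiff ℝ 1 Φ) (hsymm : ∀ z i j, jac Φ i j z = jac Φ j i z)
    (hdiag : ∀ z i j, jac Φ i i z = jac Φ j j z) (i j : Fin d) {σ : ℝ} (hσ : σ * σ = 1)
    (z : Vec d) (t : ℝ) :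
    jac Φ i i (z + t • (EuclideanSpace.single i 1 - σ • EuclideanSpace.single j 1)) +
      σ * jac Φ i j (z + t • (EuclideanSpace.single i 1 - σ • EuclideanSpace.single j 1)) =
    jac Φ i i z + σ * jac Φ i j z := by
  set v : Vec d := EuclideanSpace.single i 1 - σ • EuclideanSpace.single j 1 with hv
  have e : (fun z => Φ (z + t • v) i + σ * Φ (z + t • v) j) = fun z => Φ z i + σ * Φ z j :=
    funext fun z => comb_add_smul hΦ hsymm hdiag i j hσ z t
  have h1 := (hasFDerivAt_comb hΦ i j σ (z + t • v)).comp z ((hasFDerivAt_id z).add_const (t • v))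
  have h2 : HasFDerivAt (fun z => Φ z i + σ * Φ z j)
      (((EuclideanSpace.proj i : Vec d →L[ℝ] ℝ).comp (fderiv ℝ Φ (z + t • v)) +
        σ • (EuclideanSpace.proj j : Vec d →L[ℝ] ℝ).comp (fderiv ℝ Φ (z + t • v))).comp
          (ContinuousLinearMap.id ℝ (Vec d))) z := by
    rw [← e]; exact h1
  have h3 := congrArg (fun f => f (EuclideanSpace.single i 1))
    (h2.unique (hasFDerivAt_comb hΦ i j σ z))
  exact h3

lemma jac_sq_le_potential (hsymm : ∀ z i j, jac Φ i j z = jac Φ j i z) {i j : Fin d} (hij : i ≠ j)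
    (z : Vec d) : jac Φ i j z ^ 2 ≤ 2 * potential Φ z := by
  have key : ∀ {i j : Fin d}, i < j → jac Φ i j z ^ 2 ≤ 2 * potential Φ z := by
    intro i j h
    have h1 : jac Φ i j z ^ 2 ≤ ∑ i, ∑ j ∈ Finset.Ioi i, jac Φ i j z ^ 2 :=
      (Finset.single_le_sum (f := fun j => jac Φ i j z ^ 2) (fun _ _ => sq_nonneg _)
        (Finset.mem_Ioi.2 h)).trans
      (Finset.single_le_sum (f := fun i => ∑ j ∈ Finset.Ioi i, jac Φ i j z ^ 2)
        (fun _ _ => Finset.sum_nonneg fun _ _ => sq_nonneg _) (Finset.mem_univ i))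
    rw [potential]
    linarith
  rcases lt_or_gt_of_ne hij with h | h
  · exact key h
  · rw [hsymm]; exact key h

/-- A bound on the off-diagonal entries of `∇Φ` in a ball controls the variation of its diagonal
along coordinate directions. -/
lemma abs_jac_diag_sub_le (hΦ : ContDiff ℝ 1 Φ) (hsymm : ∀ z i j, jac Φ i j z = jac Φ j i z)
    (hdiag : ∀ z i j, jac Φ i i z = jac Φ j j z) {i j k : Fin d} {B R : ℝ}
    (hB : ∀ z, ‖z‖ ≤ R → |jac Φ i j z| ≤ B) (z : Vec d) (t : ℝ) (hz : ‖z‖ + |t| ≤ R) :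
    |jac Φ k k (z + t • EuclideanSpace.single i 1)| ≤ |jac Φ k k z| + 4 * B := by
  set e : Vec d := EuclideanSpace.single i 1
  set f : Vec d := EuclideanSpace.single j 1
  have he : ‖e‖ = 1 := by simp [e]
  have hf : ‖f‖ = 1 := by simp [f]
  have h1 := jac_comb_add_smul hΦ hsymm hdiag i j (σ := 1) (by norm_num) z (t / 2)
  have h2 := jac_comb_add_smul hΦ hsymm hdiag i j (σ := -1) (by norm_num)
    (z + (t / 2) • (e - (1 : ℝ) • f)) (t / 2)
  have e1 : z + (t / 2) • (e - (1 : ℝ) • f) + (t / 2) • (e - (-1 : ℝ) • f) = z + t • e := by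
    module
  rw [e1] at h2
  have b0 := hB z (by linarith [abs_nonneg t])
  have b1 := hB (z + (t / 2) • (e - (1 : ℝ) • f)) (by
    refine (norm_add_le _ _).trans (le_trans (add_le_add le_rfl ?_) hz)
    rw [norm_smul, Real.norm_eq_abs, abs_div, abs_two]
    have := norm_sub_le e ((1 : ℝ) • f)
    rw [one_smul, he, hf] at this
    rw [one_smul]
    nlinarith [abs_nonneg t])
  have b2 := hB (z + t • e) (by
    refine (norm_add_le _ _).trans (le_trans (add_le_add le_rfl ?_) hz)
    rw [norm_smul, he, mul_one, Real.norm_eq_abs])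
  rw [abs_le] at b0 b1 b2
  rw [hdiag _ k i, hdiag z k i, abs_le]
  change jac Φ i i (z + (t / 2) • (e - (1 : ℝ) • f)) + _ = _ at h1
  have := abs_le.1 (le_refl |jac Φ i i z|)
  constructor <;> linarith [this.1, this.2, b0.1, b0.2, b1.1, b1.2, b2.1, b2.2]

/-- Growth of the potential controls the growth of the whole Jacobian: the potential bounds the
off-diagonal entries, and a path from `0` to `z` along the coordinate axes carries this bound to the
diagonal. -/
lemma exists_fderiv_growth (hd : 2 ≤ d) (hΦ : ContDiff ℝ 1 Φ)
    (hsymm : ∀ z i j, jac Φ i j z = jac Φ j i z) (hdiag : ∀ z i j, jac Φ i i z = jac Φ j j z)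
    {C q : ℝ} (hC : 0 ≤ C) (hq : 0 ≤ q) (hP : ∀ z, potential Φ z ≤ C * (1 + ‖z‖ ^ q)) :
    ∃ K, 0 ≤ K ∧ ∀ z, ‖fderiv ℝ Φ z‖ ^ 2 ≤ K * (1 + ‖z‖ ^ q) := by
  set b : ℝ := Real.sqrt (2 * C) with hb
  have hb0 : 0 ≤ b := Real.sqrt_nonneg _
  -- the square root of the growth function
  set ϑ : ℝ → ℝ := fun r => 1 + r ^ (q / 2) with hϑ
  have hϑ0 : ∀ {r : ℝ}, 0 ≤ r → 0 ≤ r ^ (q / 2) := fun hr => Real.rpow_nonneg hr _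
  have hsq : ∀ {r : ℝ}, 0 ≤ r → r ^ q = (r ^ (q / 2)) ^ 2 := fun hr => by
    rw [← Real.rpow_natCast, ← Real.rpow_mul hr]
    norm_num
  have hmono : ∀ {r s : ℝ}, 0 ≤ r → r ≤ s → r ^ (q / 2) ≤ s ^ (q / 2) := fun hr hs =>
    Real.rpow_le_rpow hr hs (by linarith)
  have hoff : ∀ {i j : Fin d}, i ≠ j → ∀ z, |jac Φ i j z| ≤ b * ϑ ‖z‖ := by
    intro i j hij z
    have h0 := hϑ0 (norm_nonneg z)
    refine abs_le_of_sq_le_sq ?_ (mul_nonneg hb0 (by rw [hϑ]; positivity))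
    rw [mul_pow, hb, Real.sq_sqrt (by linarith)]
    refine (jac_sq_le_potential hsymm hij z).trans ?_
    have h1 := hP z
    rw [hsq (norm_nonneg z)] at h1
    have h2 : C * (1 + (‖z‖ ^ (q / 2)) ^ 2) ≤ C * ϑ ‖z‖ ^ 2 := by
      refine mul_le_mul_of_nonneg_left ?_ hC
      rw [hϑ]
      nlinarith
    linarith
  have hother : ∀ i : Fin d, ∃ j, i ≠ j := by
    intro i
    have : Nontrivial (Fin d) := Fin.nontrivial_iff_two_le.2 hd
    obtain ⟨j, hj⟩ := exists_ne i
    exact ⟨j, hj.symm⟩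
  have hdiag' : ∀ (k : Fin d) z, |jac Φ k k z| ≤ |jac Φ k k 0| + d * (4 * (b * ϑ (2 * ‖z‖))) := by
    intro k z
    have key : ∀ s : Finset (Fin d), |jac Φ k k (∑ i ∈ s, z i • EuclideanSpace.single i (1 : ℝ))| ≤
        |jac Φ k k 0| + s.card * (4 * (b * ϑ (2 * ‖z‖))) := by
      intro s
      induction s using Finset.induction_on with
      | empty => simp
      | insert i s hi ih =>
        obtain ⟨j, hij⟩ := hother i
        rw [Finset.sum_insert hi, Finset.card_insert_of_notMem hi, add_comm]
        have hn : ‖∑ i ∈ s, z i • EuclideanSpace.single i (1 : ℝ)‖ ≤ ‖z‖ := by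
          rw [EuclideanSpace.norm_eq, EuclideanSpace.norm_eq]
          refine Real.sqrt_le_sqrt (Finset.sum_le_sum fun l _ => ?_)
          have : (∑ i ∈ s, z i • EuclideanSpace.single i (1 : ℝ)) l = if l ∈ s then z l else 0 := by
            simp [Pi.single_apply]
          rw [this]
          split_ifs
          · exact le_rfl
          · simpa using sq_nonneg (z l)
        have := abs_jac_diag_sub_le hΦ hsymm hdiag (i := i) (j := j) (k := k) (B := b * ϑ (2 * ‖z‖))
          (R := 2 * ‖z‖) (fun y hy => (hoff hij y).trans (mul_le_mul_of_nonneg_left (by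
            rw [hϑ]
            have := hmono (norm_nonneg y) hy
            simp only
            linarith) hb0)) (∑ i ∈ s, z i • EuclideanSpace.single i (1 : ℝ)) (z i)
          (by
            have := PiLp.norm_apply_le z i
            rw [Real.norm_eq_abs] at this
            linarith)
        push_cast
        linarith
    have e : z = ∑ i, z i • EuclideanSpace.single i (1 : ℝ) := by
      ext l; simp [Pi.single_apply]
    have := key Finset.univ
    rwa [← e, Finset.card_univ, Fintype.card_fin] at this
  set L : ℝ := ∑ k, |jac Φ k k 0| with hL
  have hL0 : 0 ≤ L := Finset.sum_nonneg fun _ _ => abs_nonneg _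
  set A : ℝ := L + d * (4 * (b * (1 + 2 ^ (q / 2)))) + b with hA
  have h2q : (0 : ℝ) ≤ 2 ^ (q / 2) := Real.rpow_nonneg (by norm_num) _
  have hA0 : 0 ≤ A := by positivity
  have hentry : ∀ i j z, |jac Φ i j z| ≤ A * ϑ ‖z‖ := by
    intro i j z
    have h0 := hϑ0 (norm_nonneg z)
    have h1 : (1 : ℝ) ≤ ϑ ‖z‖ := by rw [hϑ]; simp only; linarith
    have hc : 0 ≤ (d : ℝ) * (4 * (b * (1 + 2 ^ (q / 2)))) := by positivity
    by_cases hij : i = j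
    · subst hij
      have h3 : |jac Φ i i 0| ≤ L :=
        Finset.single_le_sum (f := fun k => |jac Φ k k 0|) (fun _ _ => abs_nonneg _)
          (Finset.mem_univ i)
      have h2 : ϑ (2 * ‖z‖) ≤ (1 + 2 ^ (q / 2)) * ϑ ‖z‖ := by
        rw [hϑ]
        simp only
        rw [Real.mul_rpow (by norm_num) (norm_nonneg z)]
        nlinarith
      calc |jac Φ i i z| ≤ |jac Φ i i 0| + d * (4 * (b * ϑ (2 * ‖z‖))) := hdiag' i z
        _ ≤ L * ϑ ‖z‖ + d * (4 * (b * ((1 + 2 ^ (q / 2)) * ϑ ‖z‖))) := by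
            gcongr
            nlinarith
        _ ≤ A * ϑ ‖z‖ := by
            rw [hA]
            nlinarith [mul_nonneg hb0 (zero_le_one.trans h1)]
    · refine (hoff hij z).trans (mul_le_mul_of_nonneg_right ?_ (by linarith))
      rw [hA]
      linarith
  refine ⟨(d * (d * A)) ^ 2 * 2, by positivity, fun z => ?_⟩
  have h0 := hϑ0 (norm_nonneg z)
  have h1 : ‖fderiv ℝ Φ z‖ ≤ d * (d * A) * ϑ ‖z‖ := by
    refine (norm_fderiv_le_sum_jac z).trans ?_
    refine (Finset.sum_le_sum fun i _ => Finset.sum_le_sum fun j _ => hentry i j z).trans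
      (le_of_eq ?_)
    simp only [Finset.sum_const, Finset.card_univ, Fintype.card_fin, nsmul_eq_mul]
    ring
  calc ‖fderiv ℝ Φ z‖ ^ 2 ≤ (d * (d * A) * ϑ ‖z‖) ^ 2 := pow_le_pow_left₀ (norm_nonneg _) h1 2
    _ = (d * (d * A)) ^ 2 * ϑ ‖z‖ ^ 2 := by ring
    _ ≤ (d * (d * A)) ^ 2 * (2 * (1 + ‖z‖ ^ q)) := by
        refine mul_le_mul_of_nonneg_left ?_ (sq_nonneg _)
        rw [hsq (norm_nonneg z), hϑ]
        simp only
        nlinarith [sq_nonneg (1 - ‖z‖ ^ (q / 2))]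
    _ = _ := by ring

end Structure

/-! ### Truncation in the plane -/

/-- The planar field `Φ` with `Φ₁ + Φ₂ = α(z₁ + z₂)` and `Φ₁ - Φ₂ = β(z₁ - z₂)`. -/
def planarField (α β : ℝ → ℝ) (z : Vec 2) : Vec 2 :=
  WithLp.toLp 2 ![(α (z 0 + z 1) + β (z 0 - z 1)) / 2, (α (z 0 + z 1) - β (z 0 - z 1)) / 2]

section Planar
variable {α β α' β' : ℝ → ℝ}

lemma hasFDerivAt_planarField (hα : ∀ s, HasDerivAt α (α' s) s) (hβ : ∀ s, HasDerivAt β (β' s) s)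
    (z : Vec 2) (σ : ℝ) :
    HasFDerivAt (fun z : Vec 2 => (α (z 0 + z 1) + σ * β (z 0 - z 1)) / 2)
      ((1 / 2 : ℝ) • (α' (z 0 + z 1) •
          ((EuclideanSpace.proj 0 : Vec 2 →L[ℝ] ℝ) + EuclideanSpace.proj 1) +
        σ • β' (z 0 - z 1) •
          ((EuclideanSpace.proj 0 : Vec 2 →L[ℝ] ℝ) - EuclideanSpace.proj 1))) z := by
  have h0 := (EuclideanSpace.proj 0 : Vec 2 →L[ℝ] ℝ).hasFDerivAt (x := z)
  have h1 := (EuclideanSpace.proj 1 : Vec 2 →L[ℝ] ℝ).hasFDerivAt (x := z)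
  have ha := (hα (z 0 + z 1)).comp_hasFDerivAt z (h0.add h1)
  have hb := (hβ (z 0 - z 1)).comp_hasFDerivAt z (h0.sub h1)
  have := (ha.add (hb.const_mul σ)).const_mul (1 / 2)
  refine this.congr_of_eventuallyEq (Eventually.of_forall fun y => ?_)
  change (α (y 0 + y 1) + σ * β (y 0 - y 1)) / 2 = 1 / 2 * (α (y 0 + y 1) + σ * β (y 0 - y 1))
  ring

lemma contDiff_planarField (hα : ∀ s, HasDerivAt α (α' s) s) (hβ : ∀ s, HasDerivAt β (β' s) s)
    (hα' : Continuous α') (hβ' : Continuous β') : ContDiff ℝ 1 (planarField α β) := by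
  have c : ∀ {f f' : ℝ → ℝ}, (∀ s, HasDerivAt f (f' s) s) → Continuous f' → ContDiff ℝ 1 f := by
    intro f f' hf hf'
    refine contDiff_one_iff_deriv.2 ⟨fun s => (hf s).differentiableAt, ?_⟩
    rwa [show deriv f = f' from funext fun s => (hf s).deriv]
  have hp : ∀ i : Fin 2, ContDiff ℝ 1 fun z : Vec 2 => z i := fun i =>
    (EuclideanSpace.proj i : Vec 2 →L[ℝ] ℝ).contDiff
  have ha : ContDiff ℝ 1 fun z : Vec 2 => α (z 0 + z 1) := (c hα hα').comp ((hp 0).add (hp 1))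
  have hb : ContDiff ℝ 1 fun z : Vec 2 => β (z 0 - z 1) := (c hβ hβ').comp ((hp 0).sub (hp 1))
  refine contDiff_euclidean.2 fun i => ?_
  fin_cases i
  · exact (ha.add hb).div_const 2
  · exact (ha.sub hb).div_const 2

lemma jac_planarField (hα : ∀ s, HasDerivAt α (α' s) s) (hβ : ∀ s, HasDerivAt β (β' s) s)
    (hα' : Continuous α') (hβ' : Continuous β') (z : Vec 2) :
    jac (planarField α β) 0 0 z = (α' (z 0 + z 1) + β' (z 0 - z 1)) / 2 ∧
    jac (planarField α β) 0 1 z = (α' (z 0 + z 1) - β' (z 0 - z 1)) / 2 ∧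
    jac (planarField α β) 1 0 z = (α' (z 0 + z 1) - β' (z 0 - z 1)) / 2 ∧
    jac (planarField α β) 1 1 z = (α' (z 0 + z 1) + β' (z 0 - z 1)) / 2 := by
  have h := ((contDiff_planarField hα hβ hα' hβ').differentiable one_ne_zero z).hasFDerivAt
  have h0 := (EuclideanSpace.proj 0 : Vec 2 →L[ℝ] ℝ).hasFDerivAt.comp z h
  have h1 := (EuclideanSpace.proj 1 : Vec 2 →L[ℝ] ℝ).hasFDerivAt.comp z h
  have e0 : (EuclideanSpace.proj 0 : Vec 2 →L[ℝ] ℝ) ∘ planarField α β =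
      fun z : Vec 2 => (α (z 0 + z 1) + 1 * β (z 0 - z 1)) / 2 := by
    funext z; simp [planarField]
  have e1 : (EuclideanSpace.proj 1 : Vec 2 →L[ℝ] ℝ) ∘ planarField α β =
      fun z : Vec 2 => (α (z 0 + z 1) + -1 * β (z 0 - z 1)) / 2 := by
    funext z; simp [planarField, sub_eq_add_neg]
  rw [e0] at h0
  rw [e1] at h1
  have u0 := h0.unique (hasFDerivAt_planarField hα hβ z 1)
  have u1 := h1.unique (hasFDerivAt_planarField hα hβ z (-1))
  have k0 : ∀ i, jac (planarField α β) i 0 z = _ := fun i =>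
    congrArg (fun f => f (EuclideanSpace.single i 1)) u0
  have k1 : ∀ i, jac (planarField α β) i 1 z = _ := fun i =>
    congrArg (fun f => f (EuclideanSpace.single i 1)) u1
  refine ⟨(k0 0).trans ?_, (k1 0).trans ?_, (k0 1).trans ?_, (k1 1).trans ?_⟩ <;>
  · simp
    ring

lemma potential_two (Φ : Vec 2 → Vec 2) (z : Vec 2) :
    potential Φ z = (1 / 2) * jac Φ 0 1 z ^ 2 := by
  have e0 : Finset.Ioi (0 : Fin 2) = {1} := rfl
  have e1 : Finset.Ioi (1 : Fin 2) = ∅ := rfl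
  simp [potential, Fin.sum_univ_two, e0, e1]

end Planar

/-- Truncation of a real number to `[-c, c]`. -/
def clamp (c t : ℝ) : ℝ := max (-c) (min c t)

lemma continuous_clamp (c : ℝ) : Continuous (clamp c) :=
  continuous_const.max (continuous_const.min continuous_id)

lemma clamp_eq_self {c t : ℝ} (h : |t| ≤ c) : clamp c t = t := by
  rw [abs_le] at h
  rw [clamp, min_eq_right h.2, max_eq_right h.1]

lemma abs_clamp_le {c : ℝ} (hc : 0 ≤ c) (t : ℝ) : |clamp c t| ≤ c :=
  abs_le.2 ⟨le_max_left _ _, max_le (by linarith) (min_le_left _ _)⟩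

lemma abs_clamp_sub_le (c s t : ℝ) : |clamp c s - clamp c t| ≤ |s - t| := by
  refine (abs_max_sub_max_le_max _ _ _ _).trans (max_le (by simp) ?_)
  exact (abs_min_sub_min_le_max _ _ _ _).trans (max_le (by simp) le_rfl)

/-- Truncating the derivative of a `C¹` function away from a compact interval. -/
lemma exists_primitive_clamp {f f' : ℝ → ℝ} (hf : ∀ s, HasDerivAt f (f' s) s)
    (hf' : Continuous f') {c R : ℝ} (hR : ∀ s, |s| ≤ R → |f' s| ≤ c) :
    ∃ F : ℝ → ℝ, (∀ s, HasDerivAt F (clamp c (f' s)) s) ∧ ∀ s, |s| ≤ R → F s = f s := by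
  have hc : Continuous fun s => clamp c (f' s) := (continuous_clamp c).comp hf'
  refine ⟨fun s => f 0 + ∫ t in (0 : ℝ)..s, clamp c (f' t), fun s => ?_, fun s hs => ?_⟩
  · exact (hc.integral_hasStrictDerivAt 0 s).hasDerivAt.const_add _
  · have h1 : ∫ t in (0 : ℝ)..s, clamp c (f' t) = ∫ t in (0 : ℝ)..s, f' t := by
      refine intervalIntegral.integral_congr fun t ht => ?_
      refine clamp_eq_self (hR t (le_trans ?_ hs))
      rcases le_total 0 s with h | h
      · rw [Set.uIcc_of_le h] at ht
        rw [abs_of_nonneg ht.1, abs_of_nonneg h]; exact ht.2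
      · rw [Set.uIcc_of_ge h] at ht
        rw [abs_of_nonpos ht.2, abs_of_nonpos h]; linarith [ht.1]
    simp only
    rw [h1, intervalIntegral.integral_eq_sub_of_hasDerivAt (fun t _ => hf t)
      (hf'.intervalIntegrable _ _)]
    ring

/-- In the plane, the derivatives of the two characteristic components of `Φ` can be truncated: this
makes the gradient bounded and does not increase the potential, which is a multiple of the squared
difference of these derivatives. A large truncation level leaves `Φ` unchanged on a given ball. -/
lemma exists_planar_truncation {Φ : Vec 2 → Vec 2} (hΦ : ContDiff ℝ 1 Φ)
    (hsymm : ∀ z i j, jac Φ i j z = jac Φ j i z) (hdiag : ∀ z i j, jac Φ i i z = jac Φ j j z)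
    (R : ℝ) : ∃ Ψ : Vec 2 → Vec 2, ContDiff ℝ 1 Ψ ∧ (∀ z i j, jac Ψ i j z = jac Ψ j i z) ∧
      (∀ z i j, jac Ψ i i z = jac Ψ j j z) ∧ (∃ K, 0 ≤ K ∧ ∀ z, ‖fderiv ℝ Ψ z‖ ≤ K) ∧
      (∀ z, potential Ψ z ≤ potential Φ z) ∧ ∀ z, ‖z‖ ≤ R → Ψ z 0 = Φ z 0 := by
  set p : ℝ → ℝ → Vec 2 := fun σ s =>
    (s / 2) • (EuclideanSpace.single 0 1 + σ • EuclideanSpace.single 1 1) with hp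
  set f : ℝ → ℝ → ℝ := fun σ s => Φ (p σ s) 0 + σ * Φ (p σ s) 1 with hf
  have hfC : ∀ σ, ContDiff ℝ 1 (f σ) := by
    intro σ
    have h1 : ContDiff ℝ 1 (p σ) := (contDiff_id.div_const 2).smul contDiff_const
    have h2 := hΦ.comp h1
    exact ((EuclideanSpace.proj 0 : Vec 2 →L[ℝ] ℝ).contDiff.comp h2).add
      (contDiff_const.mul ((EuclideanSpace.proj 1 : Vec 2 →L[ℝ] ℝ).contDiff.comp h2))
  have hfd : ∀ σ s, HasDerivAt (f σ) (deriv (f σ) s) s := fun σ s =>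
    ((hfC σ).differentiable one_ne_zero s).hasDerivAt
  have hfc : ∀ σ, Continuous (deriv (f σ)) := fun σ => (hfC σ).continuous_deriv le_rfl
  -- d'Alembert's formula: `Φ₁ + σ Φ₂` is a function of `z₁ + σ z₂`
  have hchar : ∀ σ : ℝ, σ * σ = 1 → ∀ z : Vec 2, Φ z 0 + σ * Φ z 1 = f σ (z 0 + σ * z 1) := by
    intro σ hσ z
    have h := comb_add_smul hΦ hsymm hdiag 0 1 hσ (p σ (z 0 + σ * z 1)) ((z 0 - σ * z 1) / 2)
    have e : p σ (z 0 + σ * z 1) + ((z 0 - σ * z 1) / 2) •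
        (EuclideanSpace.single 0 1 - σ • EuclideanSpace.single 1 1) = z := by
      ext l
      fin_cases l
      · simp [hp]; ring
      · simp [hp]; linear_combination (z 1) * hσ
    rw [e] at h
    exact h
  have hcharD : ∀ σ : ℝ, σ * σ = 1 → ∀ z : Vec 2,
      jac Φ 0 0 z + σ * jac Φ 0 1 z = deriv (f σ) (z 0 + σ * z 1) := by
    intro σ hσ z
    have h1 := hasFDerivAt_comb hΦ 0 1 σ z
    rw [show (fun z => Φ z 0 + σ * Φ z 1) = fun z : Vec 2 => f σ (z 0 + σ * z 1) from
      funext fun z => hchar σ hσ z] at h1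
    have h0 := (EuclideanSpace.proj 0 : Vec 2 →L[ℝ] ℝ).hasFDerivAt (x := z)
    have h01 := (EuclideanSpace.proj 1 : Vec 2 →L[ℝ] ℝ).hasFDerivAt (x := z)
    have h2 := (hfd σ (z 0 + σ * z 1)).comp_hasFDerivAt z (h0.add (h01.const_mul σ))
    have h3 := congrArg (fun f => f (EuclideanSpace.single 0 1)) (h1.unique h2)
    refine Eq.trans h3 ?_
    simp
  obtain ⟨c, hc0, hc⟩ : ∃ c, 0 ≤ c ∧ ∀ σ ∈ ({1, -1} : Set ℝ), ∀ s, |s| ≤ 2 * R →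
      |deriv (f σ) s| ≤ c := by
    obtain ⟨c1, h1⟩ := (isCompact_Icc (a := -(2 * R)) (b := 2 * R)).exists_bound_of_continuousOn
      (hfc 1).continuousOn
    obtain ⟨c2, h2⟩ := (isCompact_Icc (a := -(2 * R)) (b := 2 * R)).exists_bound_of_continuousOn
      (hfc (-1)).continuousOn
    refine ⟨max 0 (max c1 c2), le_max_left _ _, ?_⟩
    rintro σ (rfl | rfl) s hs
    · exact (h1 s (abs_le.1 hs)).trans ((le_max_left _ _).trans (le_max_right _ _))
    · exact (h2 s (abs_le.1 hs)).trans ((le_max_right _ _).trans (le_max_right _ _))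
  obtain ⟨α, hα, hαeq⟩ := exists_primitive_clamp (hfd 1) (hfc 1) (hc 1 (by simp))
  obtain ⟨β, hβ, hβeq⟩ := exists_primitive_clamp (hfd (-1)) (hfc (-1)) (hc (-1) (by simp))
  have hα' : Continuous fun s => clamp c (deriv (f 1) s) := (continuous_clamp c).comp (hfc 1)
  have hβ' : Continuous fun s => clamp c (deriv (f (-1)) s) := (continuous_clamp c).comp (hfc (-1))
  have hj := jac_planarField hα hβ hα' hβ'
  have hbound : ∀ z i j, |jac (planarField α β) i j z| ≤ c := by
    intro z i j
    obtain ⟨h1, h2, h3, h4⟩ := hj z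
    have ba := abs_le.1 (abs_clamp_le hc0 (deriv (f 1) (z 0 + z 1)))
    have bb := abs_le.1 (abs_clamp_le hc0 (deriv (f (-1)) (z 0 - z 1)))
    rw [abs_le]
    fin_cases i <;> fin_cases j <;> simp only [Fin.zero_eta, Fin.mk_one, h1, h2, h3, h4] <;>
      constructor <;> linarith [ba.1, ba.2, bb.1, bb.2]
  refine ⟨planarField α β, contDiff_planarField hα hβ hα' hβ', ?_, ?_, ?_, ?_, ?_⟩
  · intro z i j
    obtain ⟨h1, h2, h3, h4⟩ := hj z
    fin_cases i <;> fin_cases j <;> simp only [Fin.zero_eta, Fin.mk_one, h2, h3]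
  · intro z i j
    obtain ⟨h1, h2, h3, h4⟩ := hj z
    fin_cases i <;> fin_cases j <;> simp only [Fin.zero_eta, Fin.mk_one, h1, h4]
  · refine ⟨2 * (2 * c), by positivity, fun z => (norm_fderiv_le_sum_jac z).trans ?_⟩
    refine (Finset.sum_le_sum fun i _ => Finset.sum_le_sum fun j _ => hbound z i j).trans
      (le_of_eq ?_)
    simp
  · intro z
    obtain ⟨h1, h2, h3, h4⟩ := hj z
    have d1 := hcharD 1 (by norm_num) z
    have d2 := hcharD (-1) (by norm_num) z
    rw [one_mul, one_mul] at d1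
    rw [neg_one_mul, neg_one_mul, ← sub_eq_add_neg, ← sub_eq_add_neg] at d2
    have e : jac Φ 0 1 z = (deriv (f 1) (z 0 + z 1) - deriv (f (-1)) (z 0 - z 1)) / 2 := by
      rw [← d1, ← d2]; ring
    rw [potential_two, potential_two, h2, e]
    refine mul_le_mul_of_nonneg_left (sq_le_sq.2 ?_) (by norm_num)
    rw [abs_div, abs_div]
    exact div_le_div_of_nonneg_right (abs_clamp_sub_le _ _ _) (abs_nonneg _)
  · intro z hz
    have b0 := abs_le.1 ((PiLp.norm_apply_le z 0).trans hz)
    have b1 := abs_le.1 ((PiLp.norm_apply_le z 1).trans hz)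
    have c1 := hchar 1 (by norm_num) z
    have c2 := hchar (-1) (by norm_num) z
    rw [one_mul, one_mul] at c1
    rw [neg_one_mul, neg_one_mul, ← sub_eq_add_neg, ← sub_eq_add_neg] at c2
    have e : planarField α β z 0 = (α (z 0 + z 1) + β (z 0 - z 1)) / 2 := rfl
    rw [e, hαeq _ (abs_le.2 ⟨by linarith [b0.1, b1.1], by linarith [b0.2, b1.2]⟩),
      hβeq _ (abs_le.2 ⟨by linarith [b0.1, b1.2], by linarith [b0.2, b1.1]⟩), ← c1, ← c2]
    ring

/-! ### One-dimensional fields -/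

section OneDim
variable {n : ℕ}

/-- A Lipschitz function of `x₁` is weakly differentiable, and its weak derivative is the classical
one, which exists almost everywhere: integrate by parts on each line `ℝ × {y}`. -/
lemma isWeakPartial_zero_comp_fst {K : ℝ≥0} {f : ℝ → ℝ} (hf : LipschitzWith K f) :
    IsWeakPartial (0 : Fin (n + 1)) (fun x : Cylinder n => f x.1) fun x => deriv f x.1 where
  locInt_fun := (hf.continuous.comp continuous_fst).locallyIntegrable
  locInt_deriv := by
    refine MemLp.locallyIntegrable (p := ∞) (memLp_top_of_bound ((measurable_deriv f).comp
      measurable_fst).aestronglyMeasurable K (Eventually.of_forall fun x => ?_)) le_top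
    exact norm_deriv_le_of_lipschitz hf
  integral_eq φ hφ := by
    have hc := hφ.continuous
    have hc' := (hφ.partialDeriv 0).continuous
    obtain ⟨N, hN⟩ := hφ.compact.exists_bound_of_continuousOn continuous_fst.continuousOn
    have hN0 : ∀ x : Cylinder n, N < |x.1| → φ x = 0 := fun x hx => by
      by_contra h
      exact absurd (hN x (subset_tsupport _ h)) (not_le.2 hx)
    have hN1 : ∀ x : Cylinder n, N < |x.1| → partialDeriv 0 φ x = 0 := fun x hx => by
      refine IsTestFunction.partialDeriv_eq_zero 0 fun h => ?_
      exact absurd (hN x h) (not_le.2 hx)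
    obtain ⟨C, hC⟩ := hc'.bounded_above_of_compact_support (hφ.partialDeriv 0).compact
    have hdm : Measurable fun x : Cylinder n => deriv f x.1 :=
      (measurable_deriv f).comp measurable_fst
    have i1 : Integrable (fun x : Cylinder n => f x.1 * partialDeriv 0 φ x) volume :=
      ((hf.continuous.comp continuous_fst).mul hc').integrable_of_hasCompactSupport
        (hφ.partialDeriv 0).compact.mul_left
    have i2 : Integrable (fun x : Cylinder n => deriv f x.1 * φ x) volume :=
      (hc.integrable_of_hasCompactSupport hφ.compact).bdd_mul (c := K) hdm.aestronglyMeasurable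
        (Eventually.of_forall fun x => norm_deriv_le_of_lipschitz hf)
    rw [Measure.volume_eq_prod] at i1 i2 ⊢
    rw [integral_prod_symm _ i1, integral_prod_symm _ i2, ← integral_neg]
    refine integral_congr_ae (Eventually.of_forall fun y => ?_)
    simp only
    have hd : ∀ t, HasDerivAt (fun t => φ (t, y)) (partialDeriv 0 φ (t, y)) t := by
      intro t
      have h1 := (hφ.hasPartial 0).hasDerivAt (0, y) t
      simpa [dir_first] using h1
    have hLip : LipschitzWith C.toNNReal fun t => φ (t, y) := by
      refine lipschitzWith_of_nnnorm_deriv_le (fun t => (hd t).differentiableAt) fun t => ?_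
      rw [(hd t).deriv, ← NNReal.coe_le_coe, coe_nnnorm]
      exact (hC _).trans (Real.le_coe_toNNReal C)
    set T := |N| + 1 with hT
    have hsupp : ∀ h : ℝ → ℝ, (∀ t, N < |t| → h t = 0) → ∫ t, h t = ∫ t in (-T)..T, h t := by
      intro h hh
      refine (intervalIntegral.integral_eq_integral_of_support_subset fun t ht => ?_).symm
      have h1 : |t| ≤ N := not_lt.1 fun h2 => ht (hh t h2)
      have h2 := le_abs_self N
      have h3 := abs_le.1 h1
      constructor <;> linarith [h3.1, h3.2]
    rw [hsupp _ fun t ht => by rw [hN1 (t, y) ht, mul_zero],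
      hsupp _ fun t ht => by rw [hN0 (t, y) ht, mul_zero]]
    have hibp := AbsolutelyContinuousOnInterval.integral_mul_deriv_eq_deriv_mul
      (hf.lipschitzOnWith (s := Set.uIcc (-T) T)).absolutelyContinuousOnInterval
      (hLip.lipschitzOnWith (s := Set.uIcc (-T) T)).absolutelyContinuousOnInterval
    simp only [fun t => (hd t).deriv] at hibp
    have hT0 : N < |T| := by
      rw [abs_of_nonneg (by positivity)]
      linarith [le_abs_self N]
    rw [hibp, hN0 (T, y) hT0, hN0 (-T, y) (by simpa using hT0)]
    simp

lemma isWeakPartial_succ_comp_fst {f : ℝ → ℝ} (hf : Continuous f) (k : Fin n) :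
    IsWeakPartial k.succ (fun x : Cylinder n => f x.1) fun _ => 0 where
  locInt_fun := (hf.comp continuous_fst).locallyIntegrable
  locInt_deriv := locallyIntegrable_zero
  integral_eq φ hφ := by
    have h1 : HasPartial k.succ (fun x : Cylinder n => f x.1 * φ x)
        (fun x => f x.1 * partialDeriv k.succ φ x) := by
      intro x
      have e : ∀ t, (x + dir k.succ t).1 = x.1 := fun t => by simp
      simp only [e]
      exact (hφ.hasPartial k.succ x).const_mul _
    have := h1.integral_eq_zero ((hf.comp continuous_fst).mul hφ.continuous)
      ((hf.comp continuous_fst).mul (hφ.partialDeriv _).continuous) hφ.compact.mul_left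
      (hφ.partialDeriv _).compact.mul_left
    rw [this]
    simp

variable {K : ℝ≥0} {v : ℝ → Vec (n + 1)} {a A B : ℝ}

lemma LipschitzWith.vec_apply (hv : LipschitzWith K v) (j : Fin (n + 1)) :
    LipschitzWith K fun t => v t j := by
  refine LipschitzWith.of_dist_le_mul fun s t => ?_
  refine le_trans ?_ (hv.dist_le_mul s t)
  rw [dist_eq_norm, dist_eq_norm]
  exact PiLp.norm_apply_le (v s - v t) j

lemma weakPartial_comp_fst (hv : LipschitzWith K v) (i j : Fin (n + 1)) :
    weakPartial i (fun x : Cylinder n => v x.1 j) =ᵐ[volume]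
      fun x => if i = 0 then deriv (fun t => v t j) x.1 else 0 := by
  refine Fin.cases ?_ (fun k => ?_) i
  · simpa using (isWeakPartial_zero_comp_fst (hv.vec_apply j)).weakPartial_ae_eq
  · simpa [Fin.succ_ne_zero] using
      (isWeakPartial_succ_comp_fst (hv.vec_apply j).continuous k).weakPartial_ae_eq

/-- A Lipschitz curve in a hyperplane `{z | z₁ = a}` which is constant near `±∞` is an admissible
one-dimensional field. -/
lemma memHDotOneDiv_comp_fst (hv : LipschitzWith K v) (ha : ∀ t, v t 0 = a)
    (hA : ∀ t ≤ A, v t = v A) (hB : ∀ t, B ≤ t → v t = v B) :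
    MemHDotOneDiv fun x : Cylinder n => v x.1 where
  memLp_loc S hS := by
    have hc : Continuous fun x : Cylinder n => v x.1 := hv.continuous.comp continuous_fst
    obtain ⟨C, hC⟩ := hS.exists_bound_of_continuousOn hc.continuousOn
    have : IsFiniteMeasure ((volume : Measure (Cylinder n)).restrict S) :=
      ⟨by simpa using hS.measure_lt_top⟩
    exact MemLp.of_bound hc.aestronglyMeasurable C
      ((ae_restrict_iff' hS.measurableSet).2 (Eventually.of_forall hC))
  weak_diff i j := by
    refine Fin.cases ?_ (fun k => ?_) i
    · exact ⟨_, isWeakPartial_zero_comp_fst (hv.vec_apply j)⟩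
    · exact ⟨_, isWeakPartial_succ_comp_fst (hv.vec_apply j).continuous k⟩
  memLp_grad i j := by
    rw [memLp_congr_ae (weakPartial_comp_fst hv i j)]
    split_ifs
    · -- the derivative is bounded and vanishes outside a slab
      have hz : ∀ t, t ∉ Set.Icc A B → deriv (fun t => v t j) t = 0 := by
        intro t ht
        rw [Set.mem_Icc, not_and_or, not_le, not_le] at ht
        rcases ht with ht | ht
        · have : (fun t => v t j) =ᶠ[𝓝 t] fun _ => v A j := by
            filter_upwards [Iio_mem_nhds ht] with s hs
            rw [hA s (le_of_lt hs)]
          rw [this.deriv_eq, deriv_const]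
        · have : (fun t => v t j) =ᶠ[𝓝 t] fun _ => v B j := by
            filter_upwards [Ioi_mem_nhds ht] with s hs
            rw [hB s (le_of_lt hs)]
          rw [this.deriv_eq, deriv_const]
      have h1 : MemLp (fun x : Cylinder n => deriv (fun t => v t j) x.1) 2
          (volume.restrict (slab n A B)) :=
        MemLp.of_bound ((measurable_deriv _).comp measurable_fst).aestronglyMeasurable K
          (Eventually.of_forall fun x => norm_deriv_le_of_lipschitz (hv.vec_apply j))
      rw [← memLp_indicator_iff_restrict (measurableSet_slab _ _)] at h1
      refine (memLp_congr_ae (Eventually.of_forall fun x => ?_)).1 h1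
      by_cases hx : x ∈ slab n A B
      · exact Set.indicator_of_mem hx _
      · rw [Set.indicator_of_notMem hx]
        exact (hz x.1 hx).symm
    · exact MemLp.zero
  div_free := by
    have h := ae_all_iff.2 fun i => weakPartial_comp_fst hv i i
    filter_upwards [h] with x hx
    refine Finset.sum_eq_zero fun i _ => ?_
    rw [hx i]
    split_ifs with hi
    · subst hi; simp [ha]
    · rfl

lemma boundaryCondition_comp_fst {um up : Vec (n + 1)} (hv : Continuous v)
    (hA : ∀ t ≤ A, v t = um) (hB : ∀ t, B ≤ t → v t = up) :
    BoundaryCondition um up fun x : Cylinder n => v x.1 := by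
  refine ⟨v, hv, Eventually.of_forall fun t => by simp [_root_.average], ?_, ?_⟩
  · exact tendsto_const_nhds.congr' ((eventually_le_atBot A).mono fun t ht => (hA t ht).symm)
  · exact tendsto_const_nhds.congr' ((eventually_ge_atTop B).mono fun t ht => (hB t ht).symm)

/-- The torus has volume one, so the energy of a one-dimensional field is an integral over the
line. -/
lemma energy_comp_fst (hv : LipschitzWith K v) {W : Vec (n + 1) → ℝ} (hW : Continuous W) :
    energy W (fun x : Cylinder n => v x.1) =
      ∫⁻ t, ENNReal.ofReal ((1 / 2) * ‖deriv v t‖ ^ 2 + W (v t)) := by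
  have hd : ∀ᵐ x : Cylinder n, DifferentiableAt ℝ v x.1 :=
    Measure.quasiMeasurePreserving_fst.ae hv.ae_differentiableAt
  have h := ae_all_iff.2 fun i => ae_all_iff.2 fun j => weakPartial_comp_fst hv i j
  have h1 : energy W (fun x : Cylinder n => v x.1) =
      ∫⁻ x : Cylinder n, ENNReal.ofReal ((1 / 2) * ‖deriv v x.1‖ ^ 2 + W (v x.1)) := by
    refine lintegral_congr_ae ?_
    filter_upwards [h, hd] with x hx hdx
    simp only [hx]
    congr 3
    rw [Fin.sum_univ_succ, EuclideanSpace.norm_sq_eq]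
    simp only [if_true, Fin.succ_ne_zero, if_false]
    rw [Finset.sum_eq_zero (s := (Finset.univ : Finset (Fin n)))
      fun i _ => Finset.sum_eq_zero fun j _ => by simp, add_zero]
    refine Finset.sum_congr rfl fun j _ => ?_
    have h2 := (EuclideanSpace.proj j : Vec (n + 1) →L[ℝ] ℝ).hasFDerivAt.comp_hasDerivAt x.1
      hdx.hasDerivAt
    have h3 : deriv (fun t => v t j) x.1 = deriv v x.1 j := h2.deriv
    rw [h3, Real.norm_eq_abs, sq_abs]
  rw [h1]
  have hm : MeasurePreserving (Prod.fst : Cylinder n → ℝ) volume volume :=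
    measurePreserving_fst (μ := (volume : Measure ℝ)) (ν := (volume : Measure (Torus n)))
  refine hm.lintegral_comp (f := fun t => ENNReal.ofReal ((1 / 2) * ‖deriv v t‖ ^ 2 + W (v t))) ?_
  exact ((((measurable_deriv v).norm.pow_const 2).const_mul _).add
    (hW.comp hv.continuous).measurable).ennreal_ofReal

end OneDim

/-! ### Reparametrization of curves -/

section Reparam
variable {E : Type*} [NormedAddCommGroup E] [NormedSpace ℝ E]

/-- A Lipschitz curve `v` can be traversed so that the point `v s` is reached with speed
`‖v' s‖ / ρ s`, for any continuous `ρ` bounded below by a positive constant. -/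
lemma exists_reparametrization [FiniteDimensional ℝ E] {K : ℝ≥0} {v : ℝ → E}
    (hv : LipschitzWith K v) {ρ : ℝ → ℝ} (hρ : Continuous ρ) {c : ℝ} (hc : 0 < c)
    (hcρ : ∀ s, c ≤ ρ s) (W : E → ℝ) :
    ∃ σ : ℝ → ℝ, ∃ K', LipschitzWith K' σ ∧ StrictMono σ ∧ Function.Surjective σ ∧
      ∫⁻ t, ENNReal.ofReal ((1 / 2) * ‖deriv (v ∘ σ) t‖ ^ 2 + W (v (σ t))) =
        ∫⁻ s, ENNReal.ofReal (ρ s * ((1 / 2) * (‖deriv v s‖ / ρ s) ^ 2 + W (v s))) := by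
  set τ : ℝ → ℝ := fun s => ∫ r in (0:ℝ)..s, ρ r with hτ
  have hd : ∀ s, HasDerivAt τ (ρ s) s := fun s => hρ.integral_hasStrictDerivAt 0 s |>.hasDerivAt
  have hpos : ∀ s, 0 < ρ s := fun s => hc.trans_le (hcρ s)
  have hanti : ∀ s t, s ≤ t → c * (t - s) ≤ τ t - τ s := fun s t hst =>
    convex_univ.mul_sub_le_image_sub_of_le_deriv (f := τ)
      (fun x _ => (hd x).continuousAt.continuousWithinAt)
      (fun x _ => (hd x).differentiableAt.differentiableWithinAt)
      (fun x _ => by rw [(hd x).deriv]; exact hcρ x) s (Set.mem_univ _) t (Set.mem_univ _) hst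
  have hmono : StrictMono τ := fun s t hst => by
    have := hanti s t hst.le
    nlinarith [mul_pos hc (sub_pos.2 hst)]
  have hcont : Continuous τ := continuous_iff_continuousAt.2 fun s => (hd s).continuousAt
  have htop : Tendsto τ atTop atTop := by
    refine tendsto_atTop_mono' _ ?_ ((tendsto_id.const_mul_atTop hc).atTop_add
      (tendsto_const_nhds (x := τ 0)))
    filter_upwards [eventually_ge_atTop (0:ℝ)] with s hs
    have := hanti 0 s hs
    simp only [id]
    linarith
  have hbot : Tendsto τ atBot atBot := by
    refine tendsto_atBot_mono' _ ?_ ((tendsto_id.const_mul_atBot hc).atBot_add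
      (tendsto_const_nhds (x := τ 0)))
    filter_upwards [eventually_le_atBot (0:ℝ)] with s hs
    have := hanti s 0 hs
    simp only [id]
    linarith
  have hsurj : Function.Surjective τ := hcont.surjective htop hbot
  set e : ℝ ≃o ℝ := hmono.orderIsoOfSurjective τ hsurj with he
  have heτ : ∀ s, e s = τ s := fun s => rfl
  have hes : ∀ s, e.symm (τ s) = s := fun s => by rw [← heτ]; exact e.symm_apply_apply s
  have hse : ∀ t, τ (e.symm t) = t := fun t => by rw [← heτ]; exact e.apply_symm_apply t
  have hσd : ∀ s, HasDerivAt e.symm (ρ s)⁻¹ (τ s) := fun s => by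
    refine HasDerivAt.of_local_left_inverse (f := τ) e.symm.continuous.continuousAt ?_ (hpos s).ne'
      (Eventually.of_forall hse)
    rw [hes]
    exact hd s
  have hanti' : AntilipschitzWith (c.toNNReal)⁻¹ τ := by
    refine AntilipschitzWith.of_le_mul_dist fun s t => ?_
    rw [NNReal.coe_inv, Real.coe_toNNReal _ hc.le, inv_mul_eq_div, le_div_iff₀ hc, dist_eq_norm,
      dist_eq_norm, Real.norm_eq_abs, Real.norm_eq_abs]
    rcases le_total s t with h | h
    · have := hanti s t h
      rw [abs_sub_comm, abs_of_nonneg (sub_nonneg.2 h), abs_sub_comm]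
      exact (mul_comm _ _).trans_le (this.trans (le_abs_self _))
    · have := hanti t s h
      rw [abs_of_nonneg (sub_nonneg.2 h)]
      exact (mul_comm _ _).trans_le (this.trans (le_abs_self _))
  refine ⟨e.symm, _, hanti'.to_rightInverse hse, e.symm.strictMono, e.symm.surjective, ?_⟩
  have key := lintegral_image_eq_lintegral_abs_deriv_mul MeasurableSet.univ
    (fun s _ => (hd s).hasDerivWithinAt) hmono.injective.injOn
    (fun t => ENNReal.ofReal ((1 / 2) * ‖deriv (v ∘ e.symm) t‖ ^ 2 + W (v (e.symm t))))
  rw [Set.image_univ, hsurj.range_eq, Measure.restrict_univ] at key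
  rw [key]
  refine lintegral_congr_ae ?_
  filter_upwards [hv.ae_differentiableAt_real] with s hs
  rw [abs_of_pos (hpos s), ← ENNReal.ofReal_mul (hpos s).le, hes]
  have h1 : HasDerivAt (v ∘ e.symm) ((ρ s)⁻¹ • deriv v s) (τ s) := by
    refine HasDerivAt.scomp (τ s) ?_ (hσd s)
    rw [hes]
    exact hs.hasDerivAt
  rw [h1.deriv, norm_smul, norm_inv, Real.norm_of_nonneg (hpos s).le, inv_mul_eq_div]

/-- The pointwise cost of traversing a curve with the speed `m / ρ`, where
`ρ = (g + ε) / √(r² + ε²)`, at a point where the curve has speed `m` and the potential is `r² / 2`.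
Here `g` stands for a continuous approximation of `m`; for `g = m` and `ε → 0` the kinetic and
potential energies balance and the cost is the length element `r m`. -/
lemma reparametrization_pointwise {m g ε r r0 K : ℝ} (hm : 0 ≤ m) (hmK : m ≤ K) (hg : 0 ≤ g)
    (hε : 0 < ε) (hε1 : ε ≤ 1) (hr : 0 ≤ r) (hr0 : r ≤ r0) :
    (g + ε) / √(r ^ 2 + ε ^ 2) * ((1 / 2) * (m / ((g + ε) / √(r ^ 2 + ε ^ 2))) ^ 2 + r ^ 2 / 2) ≤
      r * m + ε * (K + r0) / 2 + |m - g| * (((r0 + 1) * K + r0) / 2 / ε) := by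
  set R := √(r ^ 2 + ε ^ 2) with hR
  have hRr : r ≤ R := Real.le_sqrt_of_sq_le (by nlinarith [sq_nonneg ε])
  have hRe : R ≤ r + ε := (Real.sqrt_le_left (by positivity)).2 (by nlinarith [mul_nonneg hr hε.le])
  have hRpos : 0 < R := Real.sqrt_pos.2 (by positivity)
  have hge : 0 < g + ε := by positivity
  have hK : 0 ≤ K := hm.trans hmK
  have e1 : (g + ε) / R * ((1 / 2) * (m / ((g + ε) / R)) ^ 2 + r ^ 2 / 2) =
      (1 / 2) * R * (m ^ 2 / (g + ε)) + (1 / 2) * (g + ε) * (r ^ 2 / R) := by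
    field_simp
  rw [e1]
  have hδ := abs_nonneg (m - g)
  have hδ1 := le_abs_self (m - g)
  have hδ2 := neg_abs_le (m - g)
  set δ := |m - g|
  have h1 : m ^ 2 / (g + ε) ≤ m + K * (δ / ε) := by
    rw [div_le_iff₀ hge]
    have h2 : δ ≤ δ / ε * (g + ε) := by
      have : δ / ε * ε = δ := div_mul_cancel₀ _ hε.ne'
      have : 0 ≤ δ / ε * g := by positivity
      nlinarith
    have h3 : m * δ ≤ K * (δ / ε * (g + ε)) := mul_le_mul hmK h2 hδ hK
    nlinarith [mul_nonneg hm hε.le, mul_le_mul_of_nonneg_left hδ1 hm]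
  have h2 : r ^ 2 / R ≤ r := by
    rw [div_le_iff₀ hRpos]
    nlinarith
  have hb : 0 ≤ δ / ε := by positivity
  have hδb : δ ≤ δ / ε := by
    rw [le_div_iff₀ hε]
    nlinarith
  have h3 : (1 / 2) * R * (m ^ 2 / (g + ε)) ≤
      (1 / 2) * (r * m + ε * K + (r0 + 1) * K * (δ / ε)) := by
    have h4 : R * (m ^ 2 / (g + ε)) ≤ (r + ε) * (m + K * (δ / ε)) :=
      mul_le_mul hRe h1 (by positivity) (by positivity)
    have h5 : (r + ε) * (K * (δ / ε)) ≤ (r0 + 1) * (K * (δ / ε)) :=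
      mul_le_mul_of_nonneg_right (by linarith) (by positivity)
    have h6 : ε * m ≤ ε * K := mul_le_mul_of_nonneg_left hmK hε.le
    nlinarith
  have h4 : (1 / 2) * (g + ε) * (r ^ 2 / R) ≤ (1 / 2) * (r * m + r0 * ε + r0 * (δ / ε)) := by
    have h5 : (g + ε) * (r ^ 2 / R) ≤ (m + δ + ε) * r :=
      mul_le_mul (by linarith) h2 (by positivity) (by linarith)
    have h6 : δ * r ≤ δ / ε * r0 := mul_le_mul hδb hr0 hr hb
    have h7 : ε * r ≤ ε * r0 := mul_le_mul_of_nonneg_left hr0 hε.le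
    nlinarith
  calc _ ≤ (1 / 2) * (r * m + ε * K + (r0 + 1) * K * (δ / ε)) +
        (1 / 2) * (r * m + r0 * ε + r0 * (δ / ε)) := add_le_add h3 h4
    _ = _ := by ring

end Reparam

section Length
variable {E : Type*} [NormedAddCommGroup E] [NormedSpace ℝ E] [FiniteDimensional ℝ E]

/-- A curve that rests at zeros of `W` outside `[-1, 1]` can be reparametrized so that its energy
exceeds its length in the metric `2W` by at most `η`. -/
lemma exists_reparametrization_energy_le {K : ℝ≥0} {v : ℝ → E} (hv : LipschitzWith K v)
    (hA : ∀ t ≤ -1, v t = v (-1)) (hB : ∀ t, 1 ≤ t → v t = v 1) {W : E → ℝ} (hW : Continuous W)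
    (hW0 : ∀ z, 0 ≤ W z) (hWA : W (v (-1)) = 0) (hWB : W (v 1) = 0) {η : ℝ} (hη : 0 < η) :
    ∃ σ : ℝ → ℝ, ∃ K', LipschitzWith K' σ ∧ StrictMono σ ∧ Function.Surjective σ ∧
      ∫⁻ t, ENNReal.ofReal ((1 / 2) * ‖deriv (v ∘ σ) t‖ ^ 2 + W (v (σ t))) ≤
        ENNReal.ofReal ((∫ t in (-1 : ℝ)..1, √(2 * W (v t)) * ‖deriv v t‖) + η) := by
  have hrc : Continuous fun t => √(2 * W (v t)) :=
    ((hW.comp hv.continuous).const_mul 2).sqrt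
  have hsq : ∀ t, √(2 * W (v t)) ^ 2 = 2 * W (v t) := fun t =>
    Real.sq_sqrt (by linarith [hW0 (v t)])
  obtain ⟨r0, hr0⟩ : ∃ r0, ∀ t, √(2 * W (v t)) ≤ r0 := by
    obtain ⟨C, hC⟩ := (isCompact_Icc (a := (-1:ℝ)) (b := 1)).exists_bound_of_continuousOn
      hrc.continuousOn
    have hC0 : 0 ≤ C := (norm_nonneg _).trans (hC 0 (by norm_num))
    refine ⟨C, fun t => ?_⟩
    rcases le_total t (-1) with h | h
    · rw [hA t h, hWA]; simpa using hC0
    rcases le_total 1 t with h' | h'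
    · rw [hB t h', hWB]; simpa using hC0
    · exact (le_abs_self _).trans (hC t ⟨h, h'⟩)
  have hr00 : 0 ≤ r0 := (Real.sqrt_nonneg _).trans (hr0 0)
  have hmK : ∀ t, ‖deriv v t‖ ≤ K := fun t => norm_deriv_le_of_lipschitz hv
  have hmm : Measurable fun t => ‖deriv v t‖ := (stronglyMeasurable_deriv v).norm.measurable
  have hout : ∀ t, t ∉ Set.Icc (-1:ℝ) 1 → deriv v t = 0 ∧ W (v t) = 0 := by
    intro t ht
    rw [Set.mem_Icc, not_and_or, not_le, not_le] at ht
    rcases ht with ht | ht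
    · have : v =ᶠ[𝓝 t] fun _ => v (-1) := by
        filter_upwards [Iio_mem_nhds ht] with s hs using hA s (le_of_lt hs)
      exact ⟨by rw [this.deriv_eq, deriv_const], by rw [hA t ht.le, hWA]⟩
    · have : v =ᶠ[𝓝 t] fun _ => v 1 := by
        filter_upwards [Ioi_mem_nhds ht] with s hs using hB s (le_of_lt hs)
      exact ⟨by rw [this.deriv_eq, deriv_const], by rw [hB t ht.le, hWB]⟩
  have hmi : IntegrableOn (fun t => ‖deriv v t‖) (Set.Icc (-1) 1) :=
    Measure.integrableOn_of_bounded (M := K) (by simp) hmm.aestronglyMeasurable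
      (Eventually.of_forall fun t => by simpa using hmK t)
  set C1 : ℝ := ((r0 + 1) * K + r0) / 2 with hC1
  have hC10 : 0 ≤ C1 := by positivity
  obtain ⟨ε, hε, hε1, hεη⟩ : ∃ ε : ℝ, 0 < ε ∧ ε ≤ 1 ∧ ε * (K + r0 + C1) ≤ η := by
    refine ⟨min 1 (η / (K + r0 + C1 + 1)), by positivity, min_le_left _ _, ?_⟩
    have h1 : min 1 (η / (K + r0 + C1 + 1)) ≤ η / (K + r0 + C1 + 1) := min_le_right _ _
    have h2 : 0 ≤ K + r0 + C1 := by positivity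
    calc _ ≤ η / (K + r0 + C1 + 1) * (K + r0 + C1) := mul_le_mul_of_nonneg_right h1 h2
      _ ≤ η / (K + r0 + C1 + 1) * (K + r0 + C1 + 1) :=
        mul_le_mul_of_nonneg_left (by linarith) (by positivity)
      _ = η := div_mul_cancel₀ _ (by positivity)
  obtain ⟨g0, -, hg0, hg0c, hg0i⟩ := ((integrable_indicator_iff measurableSet_Icc).2
    hmi).exists_hasCompactSupport_integral_sub_le (pow_pos hε 2)
  have hgi : IntegrableOn (fun t => |‖deriv v t‖ - (|g0 t|)|) (Set.Icc (-1) 1) :=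
    (hmi.sub hg0i.abs.integrableOn).abs
  have hgε : ∫ t in Set.Icc (-1:ℝ) 1, |‖deriv v t‖ - (|g0 t|)| ≤ ε ^ 2 := by
    refine le_trans ?_ hg0
    have hfi := ((integrable_indicator_iff measurableSet_Icc).2 hmi).sub hg0i
    refine le_trans ?_ (setIntegral_le_integral (s := Set.Icc (-1:ℝ) 1) hfi.norm
      (Eventually.of_forall fun t => norm_nonneg _))
    refine setIntegral_mono_on hgi hfi.norm.integrableOn measurableSet_Icc fun t ht => ?_
    simp only [Set.indicator_of_mem ht, Real.norm_eq_abs]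
    calc |‖deriv v t‖ - (|g0 t|)| = |(|‖deriv v t‖|) - (|g0 t|)| := by rw [abs_norm]
      _ ≤ _ := abs_abs_sub_abs_le _ _
  -- continuity of the density makes the change of parameter a `C¹` diffeomorphism of the line
  set ρ : ℝ → ℝ := fun t => (|g0 t| + ε) / √(√(2 * W (v t)) ^ 2 + ε ^ 2) with hρ
  have hρc : Continuous ρ := by
    refine (hg0c.abs.add continuous_const).div ((hrc.pow 2).add continuous_const).sqrt fun t => ?_
    exact (Real.sqrt_pos.2 (by positivity)).ne'
  have hρp : ∀ t, ε / (r0 + ε) ≤ ρ t := by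
    intro t
    refine div_le_div₀ (by positivity) (by linarith [abs_nonneg (g0 t)])
      (Real.sqrt_pos.2 (by positivity)) ?_
    refine (Real.sqrt_le_left (by positivity)).2 ?_
    nlinarith [hr0 t, Real.sqrt_nonneg (2 * W (v t))]
  obtain ⟨σ, K', hσ, hσm, hσs, hσe⟩ := exists_reparametrization hv hρc
    (div_pos hε (by positivity)) hρp W
  refine ⟨σ, K', hσ, hσm, hσs, hσe.trans_le ?_⟩
  set F : ℝ → ℝ := fun t => √(2 * W (v t)) * ‖deriv v t‖ + ε * (K + r0) / 2 +
    |‖deriv v t‖ - (|g0 t|)| * (C1 / ε) with hF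
  have hF0 : ∀ t, 0 ≤ F t := fun t => by positivity
  have i1 : IntegrableOn (fun t => √(2 * W (v t)) * ‖deriv v t‖) (Set.Icc (-1) 1) :=
    Integrable.bdd_mul (c := r0) hmi hrc.aestronglyMeasurable
      (Eventually.of_forall fun t => by
        rw [Real.norm_of_nonneg (Real.sqrt_nonneg _)]; exact hr0 t)
  have i2 : IntegrableOn (fun _ : ℝ => ε * (K + r0) / 2) (Set.Icc (-1) 1) :=
    integrableOn_const (by simp) (by simp)
  have iF : IntegrableOn F (Set.Icc (-1) 1) := (i1.add i2).add (hgi.mul_const _)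
  have hle : ∀ t, ENNReal.ofReal (ρ t * ((1 / 2) * (‖deriv v t‖ / ρ t) ^ 2 + W (v t))) ≤
      (Set.Icc (-1:ℝ) 1).indicator (fun t => ENNReal.ofReal (F t)) t := by
    intro t
    by_cases ht : t ∈ Set.Icc (-1:ℝ) 1
    · rw [Set.indicator_of_mem ht]
      refine ENNReal.ofReal_le_ofReal ?_
      have := reparametrization_pointwise (norm_nonneg (deriv v t)) (hmK t) (abs_nonneg (g0 t)) hε
        hε1 (Real.sqrt_nonneg (2 * W (v t))) (hr0 t)
      rw [show W (v t) = √(2 * W (v t)) ^ 2 / 2 by rw [hsq]; ring]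
      exact this
    · rw [Set.indicator_of_notMem ht, (hout t ht).1, (hout t ht).2]
      simp
  refine (lintegral_mono hle).trans ?_
  rw [lintegral_indicator measurableSet_Icc,
    ← ofReal_integral_eq_lintegral_ofReal iF (Eventually.of_forall hF0)]
  refine ENNReal.ofReal_le_ofReal ?_
  have e : ∫ t in Set.Icc (-1:ℝ) 1, F t = (∫ t in Set.Icc (-1:ℝ) 1, √(2 * W (v t)) * ‖deriv v t‖) +
      ε * (K + r0) + (∫ t in Set.Icc (-1:ℝ) 1, |‖deriv v t‖ - (|g0 t|)|) * (C1 / ε) := by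
    have e1 := integral_add (i1.add i2) (hgi.mul_const (C1 / ε))
    have e2 := integral_add i1 i2
    simp only [Pi.add_apply] at e1
    rw [integral_mul_const] at e1
    refine e1.trans ?_
    rw [e2, setIntegral_const]
    simp
    ring
  rw [e, intervalIntegral.integral_of_le (by norm_num), ← integral_Icc_eq_integral_Ioc]
  have h3 : (∫ t in Set.Icc (-1:ℝ) 1, |‖deriv v t‖ - (|g0 t|)|) * (C1 / ε) ≤ ε * C1 := by
    refine (mul_le_mul_of_nonneg_right hgε (by positivity)).trans_eq ?_
    field_simp
  linarith

end Length

/-! ### The energy of minimizers and the geodesic distance -/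

section Geodesic
variable {n : ℕ} {a : ℝ} {um up : Vec (n + 1)} {W : Vec (n + 1) → ℝ}

lemma geodDist_nonneg : 0 ≤ geodDist a W um up := by
  refine Real.sInf_nonneg ?_
  rintro L ⟨γ, -, -, -, -, rfl⟩
  exact intervalIntegral.integral_nonneg (by norm_num) fun t _ => by positivity

/-- The energy of a minimizer is at most the length of any connecting curve in the hyperplane
`{z | z₁ = a}`: follow the curve, suitably reparametrized, in the variable `x₁`. -/
lemma IsGlobalMinimizer.energy_le_length {u : Cylinder n → Vec (n + 1)}
    (hu : IsGlobalMinimizer W um up u) (hW : Continuous W) (hW0 : ∀ z, 0 ≤ W z)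
    (hWm : W um = 0) (hWp : W up = 0) {γ : ℝ → Vec (n + 1)} {K : ℝ≥0}
    (hγ : LipschitzOnWith K γ (Set.Icc (-1) 1)) (ha : ∀ t ∈ Set.Icc (-1 : ℝ) 1, γ t 0 = a)
    (hm : γ (-1) = um) (hp : γ 1 = up) :
    energy W u ≤ ENNReal.ofReal (∫ t in (-1 : ℝ)..1, √(2 * W (γ t)) * ‖deriv γ t‖) := by
  have h11 : (-1:ℝ) ≤ 1 := by norm_num
  set v : ℝ → Vec (n + 1) := fun t => γ (Set.projIcc (-1) 1 h11 t) with hv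
  have hvK : LipschitzWith K v := by
    have h1 := (lipschitzOnWith_iff_restrict.1 hγ).comp (LipschitzWith.projIcc h11)
    rw [mul_one] at h1
    exact h1
  have hvm : ∀ t ≤ -1, v t = um := fun t ht => by
    simp only [hv, Set.projIcc_of_le_left h11 ht, hm]
  have hvp : ∀ t, 1 ≤ t → v t = up := fun t ht => by
    simp only [hv, Set.projIcc_of_right_le h11 ht, hp]
  have hvγ : ∀ t ∈ Set.Icc (-1:ℝ) 1, v t = γ t := fun t ht => by
    simp only [hv, Set.projIcc_of_mem h11 ht]
  have hva : ∀ t, v t 0 = a := fun t => ha _ (Set.projIcc (-1) 1 h11 t).2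
  have hL : ∫ t in (-1 : ℝ)..1, √(2 * W (γ t)) * ‖deriv γ t‖ =
      ∫ t in (-1 : ℝ)..1, √(2 * W (v t)) * ‖deriv v t‖ := by
    rw [intervalIntegral.integral_of_le h11, intervalIntegral.integral_of_le h11,
      integral_Ioc_eq_integral_Ioo, integral_Ioc_eq_integral_Ioo]
    refine setIntegral_congr_fun measurableSet_Ioo fun t ht => ?_
    have h1 : v =ᶠ[𝓝 t] γ := by
      filter_upwards [Ioo_mem_nhds ht.1 ht.2] with s hs using hvγ s (Set.Ioo_subset_Icc_self hs)
    simp only [h1.deriv_eq, h1.eq_of_nhds]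
  rw [hL]
  have hL0 : 0 ≤ ∫ t in (-1 : ℝ)..1, √(2 * W (v t)) * ‖deriv v t‖ :=
    intervalIntegral.integral_nonneg h11 fun t _ => by positivity
  refine ENNReal.le_of_forall_pos_le_add fun η hη _ => ?_
  obtain ⟨σ, K', hσ, hσm, hσs, hσe⟩ := exists_reparametrization_energy_le hvK
    (fun t ht => by rw [hvm t ht, hvm _ le_rfl]) (fun t ht => by rw [hvp t ht, hvp _ le_rfl]) hW hW0
    (by rw [hvm _ le_rfl, hWm]) (by rw [hvp _ le_rfl, hWp]) (NNReal.coe_pos.2 hη)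
  rw [ENNReal.ofReal_add hL0 η.coe_nonneg, ENNReal.ofReal_coe_nnreal] at hσe
  refine le_trans ?_ hσe
  have hw : LipschitzWith (K * K') (v ∘ σ) := hvK.comp hσ
  obtain ⟨A, hA⟩ := hσs (-1)
  obtain ⟨B, hB⟩ := hσs 1
  have hwA : ∀ t ≤ A, (v ∘ σ) t = um := fun t ht => hvm _ (hA ▸ hσm.monotone ht)
  have hwB : ∀ t, B ≤ t → (v ∘ σ) t = up := fun t ht => hvp _ (hB ▸ hσm.monotone ht)
  refine (hu.le _ (memHDotOneDiv_comp_fst hw (a := a) (fun t => hva _)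
    (fun t ht => by rw [hwA t ht, hwA A le_rfl]) (fun t ht => by rw [hwB t ht, hwB B le_rfl]))
    (boundaryCondition_comp_fst hw.continuous hwA hwB)).trans_eq ?_
  exact energy_comp_fst hw hW

lemma IsGlobalMinimizer.energy_le_geodDist {u : Cylinder n → Vec (n + 1)}
    (hu : IsGlobalMinimizer W um up u) (hW : Continuous W) (hW0 : ∀ z, 0 ≤ W z)
    (hWm : W um = 0) (hWp : W up = 0) (ham : um 0 = a) (hap : up 0 = a) :
    energy W u ≤ ENNReal.ofReal (geodDist a W um up) := by
  -- the segment from `um` to `up` is an admissible curve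
  obtain ⟨K, hK⟩ : ∃ K, LipschitzOnWith K
      (fun t : ℝ => (1 / 2 : ℝ) • (um + up) + (t / 2) • (up - um)) (Set.Icc (-1) 1) := by
    refine ⟨‖(1 / 2 : ℝ) • (up - um)‖₊,
      (LipschitzWith.of_dist_le_mul fun s t => ?_).lipschitzOnWith⟩
    rw [dist_eq_norm, dist_eq_norm, add_sub_add_left_eq_sub, ← sub_smul, ← sub_div,
      div_eq_mul_one_div, mul_smul, norm_smul, mul_comm, coe_nnnorm]
  have hm1 : (1 / 2 : ℝ) • (um + up) + ((-1:ℝ) / 2) • (up - um) = um := by module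
  have hp1 : (1 / 2 : ℝ) • (um + up) + ((1:ℝ) / 2) • (up - um) = up := by module
  have hne := hu.energy_le_length hW hW0 hWm hWp hK (a := a)
    (fun t _ => by simp [ham, hap]; ring) hm1 hp1
  have hfin : energy W u ≠ ∞ := ne_top_of_le_ne_top ENNReal.ofReal_ne_top hne
  rw [← ENNReal.ofReal_toReal hfin]
  refine ENNReal.ofReal_le_ofReal (le_csInf ?_ ?_)
  · exact ⟨_, _, ⟨K, hK⟩, fun t _ => by simp [ham, hap]; ring, hm1, hp1, rfl⟩
  · rintro L ⟨γ, ⟨K', hγ⟩, ha, hm, hp, rfl⟩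
    refine ENNReal.toReal_le_of_le_ofReal ?_ (hu.energy_le_length hW hW0 hWm hWp hγ ha hm hp)
    exact intervalIntegral.integral_nonneg (by norm_num) fun t _ => by positivity

end Geodesic

/-! ### One-dimensional symmetry -/

theorem mainTheorem4 (n : ℕ) (hn : 1 ≤ n)
    (Φ : Vec (n + 1) → Vec (n + 1)) (hΦ : ContDiff ℝ 1 Φ)
    (hsymm : ∀ z i j, jac Φ i j z = jac Φ j i z)
    (hdiag : ∀ z i j, jac Φ i i z = jac Φ j j z)
    (a : ℝ) (um up : Vec (n + 1))
    (hum : um 0 = a) (hup : up 0 = a)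
    (hWum : potential Φ um = 0) (hWup : potential Φ up = 0)
    (hsat : Φ up 0 - Φ um 0 = geodDist a (potential Φ) um up)
    (u : Cylinder n → Vec (n + 1))
    (hu : IsGlobalMinimizer (potential Φ) um up u)
    (hcond : (MemLp u ⊤ volume ∧ ContDiff ℝ 2 (potential Φ)) ∨ GrowthCondition (potential Φ)) :
    ∃ g : ℝ → Vec (n + 1), ∀ᵐ x ∂(volume : Measure (Cylinder n)), u x = g x.1 := by
  have h := hu.mem.isSolenoidal
  obtain ⟨M, hM⟩ := h.hasLimits_two hu.boundary
  have hD : 0 ≤ Φ up 0 - Φ um 0 := hsat ▸ geodDist_nonneg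
  have hE : energy (potential Φ) u ≤ ENNReal.ofReal (Φ up 0 - Φ um 0) := hsat ▸
    hu.energy_le_geodDist (continuous_potential hΦ) (potential_nonneg Φ) hWum hWup hum hup
  suffices h0 : ∀ (k : Fin n) j, (weakPartial k.succ fun x => u x j) =ᵐ[volume] 0 from
    ⟨_, h.ae_eq_average h0⟩
  rcases hcond with ⟨hb, -⟩ | ⟨C, hC, β, hβ, hW⟩
  · -- only the values of `Φ` on a large ball matter
    set R := max (eLpNorm u ∞ volume).toReal (max ‖um‖ ‖up‖)
    obtain ⟨K, hK⟩ := (isCompact_closedBall (0 : Vec (n + 1)) R).exists_bound_of_continuousOn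
      (hΦ.continuous_fderiv one_ne_zero).continuousOn
    have hg : HasGrowthOn Φ (Metric.closedBall 0 R) (K ^ 2) 2 := by
      refine ⟨hΦ, convex_closedBall _ _, Metric.isClosed_closedBall, le_rfl, sq_nonneg K,
        fun z hz => ?_⟩
      calc ‖fderiv ℝ Φ z‖ ^ 2 ≤ K ^ 2 * 1 := by
            rw [mul_one]; exact pow_le_pow_left₀ (norm_nonneg _) (hK z hz) 2
        _ ≤ _ := mul_le_mul_of_nonneg_left (le_add_of_nonneg_right (by positivity)) (sq_nonneg K)
    have huS : ∀ᵐ x, u x ∈ Metric.closedBall (0 : Vec (n + 1)) R := by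
      filter_upwards [ae_le_eLpNormEssSup (f := u) (μ := volume)] with x hx
      rw [mem_closedBall_zero_iff, ← toReal_enorm]
      refine le_trans ?_ (le_max_left _ _)
      rw [eLpNorm_exponent_top]
      exact ENNReal.toReal_mono (by simpa using hb.2.ne) hx
    exact h.grad_succ_eq_zero hg hsymm hdiag huS hM
      (mem_closedBall_zero_iff.2 ((le_max_left _ _).trans (le_max_right _ _)))
      (mem_closedBall_zero_iff.2 ((le_max_right _ _).trans (le_max_right _ _))) hD hE
  · rcases hn.eq_or_lt with rfl | hn2
    · -- in the plane, `Φ` is replaced by a field with bounded derivative and smaller potential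
      obtain ⟨Ψ, hΨ, hs, hd, ⟨K, hK0, hK⟩, hP, hΨ0⟩ :=
        exists_planar_truncation hΦ hsymm hdiag (max ‖um‖ ‖up‖)
      have hg : HasGrowthOn Ψ Set.univ (K ^ 2) 2 := by
        refine ⟨hΨ, convex_univ, isClosed_univ, le_rfl, sq_nonneg K, fun z _ => ?_⟩
        calc ‖fderiv ℝ Ψ z‖ ^ 2 ≤ K ^ 2 * 1 := by
              rw [mul_one]; exact pow_le_pow_left₀ (norm_nonneg _) (hK z) 2
          _ ≤ _ := mul_le_mul_of_nonneg_left (le_add_of_nonneg_right (by positivity)) (sq_nonneg K)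
      have hm := hΨ0 um (le_max_left _ _)
      have hp := hΨ0 up (le_max_right _ _)
      refine h.grad_succ_eq_zero hg hs hd (Eventually.of_forall fun _ => Set.mem_univ _) hM
        (Set.mem_univ _) (Set.mem_univ _) (by rwa [hm, hp]) ?_
      rw [hm, hp]
      exact (lintegral_mono fun x => ENNReal.ofReal_le_ofReal
        (add_le_add_right (hP (u x)) _)).trans hE
    · have hn' : (2 : ℝ) ≤ n := by exact_mod_cast hn2
      set q : ℝ := 2 * (n + 1) / (n - 1) with hq
      have hq2 : 2 ≤ q := by rw [hq, le_div_iff₀ (by linarith)]; linarith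
      have hWq : ∀ z, potential Φ z ≤ C * (1 + ‖z‖ ^ q) := by
        intro z
        have h1 := hW z
        rw [if_neg (by omega)] at h1
        have e : 2 * ((n + 1 : ℕ) : ℝ) / (((n + 1 : ℕ) : ℝ) - 2) = q := by
          rw [hq]; push_cast; congr 1; ring
        rwa [e] at h1
      obtain ⟨K, hK0, hK⟩ := exists_fderiv_growth (by omega) hΦ hsymm hdiag hC.le (by linarith) hWq
      obtain ⟨M', hM'⟩ := h.hasLimits_sobolev hn2 hM
      exact h.grad_succ_eq_zero ⟨hΦ, convex_univ, isClosed_univ, hq2, hK0, fun z _ => hK z⟩ hsymm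
        hdiag (Eventually.of_forall fun _ => Set.mem_univ _) hM' (Set.mem_univ _) (Set.mem_univ _)
        hD hE
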